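/- Let $(M,J)$ be a compact complex manifold of complex dimension at least $2$ (real dimension $n\ge 4$), and let $g$ be a Riemannian metric on $M$ that is Hermitian, $g(JX,JY)=g(X,Y)$. Let $D$ be a torsion-free affine connection on $M$ and $\omega$ a $1$-form such that $(M,[g],D)$ is an Einstein–Weyl structure, i.e. $Dg=\omega\otimes g$ and the Ricci tensor $\rho^D$ of $D$ satisfies $\rho^D(X,Y)+\rho^D(Y,X)=\bar\Lambda\, g(X,Y)$ for some $\bar\Lambda\in C^\infty(M)$. Assume that $g$ is the standard (Gauduchon) metric of this structure, i.e. $\delta\omega=0$, where $\delta$ is the codifferential of $g$. Assume moreover that $f\in C^\infty(M)$ is such that $f^2g$ is a Kähler metric on $(M,J)$, and that $\rho^D$ is $J$-invariant: $\rho^D(JX,JY)=\rho^D(X,Y)$. Let $\xi=\omega^\sharp$ be the vector field with $g(\xi,\cdot)=\omega$. Then $\xi$ is a holomorphic Killing field of $(M,f^2g,J)$, i.e. $L_\xi J=0$ and $L_\xi(f^2g)=0$. Moreover, $J\xi$ is collinear with the gradient $\nabla f$ on $U=\{x\in M:\xi_x\neq 0\}$: for every $x\in U$ there is $c\in\mathbb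 R$ with $(\nabla f)_x=c\,J\xi_x$. -/

import Mathlib

open Bundle VectorField
open scoped Manifold ContDiff

noncomputable section

namespace EinsteinWeyl

section Real

variable {E : Type*} [NormedAddCommGroup E] [NormedSpace ℝ E]
  {M : Type*} [TopologicalSpace M] [ChartedSpace E M] [IsManifold 𝓘(ℝ, E) ∞ M]

variable (E M) in
/-- Smooth Riemannian metrics on the tangent bundle of `M`. -/
abbrev Metric := ContMDiffRiemannianMetric 𝓘(ℝ, E) ∞ E (TangentSpace 𝓘(ℝ, E) : M → Type _)

variable (E M) in
/-- Affine connections on `M`; `D Y x (X x)` is `(D_X Y)(x)`. -/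
abbrev Connection := CovariantDerivative 𝓘(ℝ, E) E (TangentSpace 𝓘(ℝ, E) : M → Type _)

/-- The vector field `X` on `M` is differentiable at `x`. -/
abbrev DiffFieldAt (X : Π x : M, TangentSpace 𝓘(ℝ, E) x) (x : M) : Prop :=
  MDifferentiableAt 𝓘(ℝ, E) 𝓘(ℝ, E).tangent
    (fun y ↦ (⟨y, X y⟩ : TangentBundle 𝓘(ℝ, E) M)) x

/-- The vector field `X` on `M` is smooth. -/
abbrev SmoothField (X : Π x : M, TangentSpace 𝓘(ℝ, E) x) : Prop :=
  ContMDiff 𝓘(ℝ, E) 𝓘(ℝ, E).tangent ∞ (fun y ↦ (⟨y, X y⟩ : TangentBundle 𝓘(ℝ, E) M))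

/-- The 1-form `α` on `M` is smooth. -/
def IsSmoothOneForm (α : Π x : M, TangentSpace 𝓘(ℝ, E) x →L[ℝ] ℝ) : Prop :=
  ContMDiff 𝓘(ℝ, E) (𝓘(ℝ, E).prod 𝓘(ℝ, E →L[ℝ] ℝ)) ∞
    (fun x ↦ TotalSpace.mk' (E →L[ℝ] ℝ)
      (E := fun x : M ↦ TangentSpace 𝓘(ℝ, E) x →L[ℝ] ℝ) x (α x))

theorem exists_sharp [FiniteDimensional ℝ E] (g : Metric E M) (x : M)
    (α : TangentSpace 𝓘(ℝ, E) x →L[ℝ] ℝ) :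
    ∃ v : TangentSpace 𝓘(ℝ, E) x, ∀ w, g.inner x v w = α w := by
  let φ : E →ₗ[ℝ] Module.Dual ℝ E :=
    { toFun := fun v ↦ ((g.inner x v : TangentSpace 𝓘(ℝ, E) x →L[ℝ] ℝ) :
        TangentSpace 𝓘(ℝ, E) x →ₗ[ℝ] ℝ)
      map_add' := fun v w ↦ by
        ext u
        exact congrArg (fun l : TangentSpace 𝓘(ℝ, E) x →L[ℝ] ℝ ↦ l u) ((g.inner x).map_add v w)
      map_smul' := fun c v ↦ by
        ext u
        exact congrArg (fun l : TangentSpace 𝓘(ℝ, E) x →L[ℝ] ℝ ↦ l u) ((g.inner x).map_smul c v) }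
  have hφ : Function.Injective φ := by
    rw [injective_iff_map_eq_zero]
    intro v hv
    by_contra hne
    exact (g.pos x v hne).ne' (congrArg (fun l : Module.Dual ℝ E ↦ l v) hv)
  have hs : Function.Surjective φ :=
    (LinearMap.injective_iff_surjective_of_finrank_eq_finrank
      Subspace.dual_finrank_eq.symm).1 hφ
  obtain ⟨v, hv⟩ := hs (α : TangentSpace 𝓘(ℝ, E) x →ₗ[ℝ] ℝ)
  exact ⟨v, fun w ↦ congrArg (fun l : Module.Dual ℝ E ↦ l w) hv⟩

/-- The vector field `α^♯` that is `g`-dual to the 1-form `α`. -/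
def sharp [FiniteDimensional ℝ E] (g : Metric E M) (α : Π x : M, TangentSpace 𝓘(ℝ, E) x →L[ℝ] ℝ)
    (x : M) : TangentSpace 𝓘(ℝ, E) x :=
  (exists_sharp g x (α x)).choose

theorem inner_sharp [FiniteDimensional ℝ E] (g : Metric E M)
    (α : Π x : M, TangentSpace 𝓘(ℝ, E) x →L[ℝ] ℝ) (x : M) (w : TangentSpace 𝓘(ℝ, E) x) :
    g.inner x (sharp g α x) w = α x w :=
  (exists_sharp g x (α x)).choose_spec w

/-- The gradient of a function with respect to `g`. -/
def gradient [FiniteDimensional ℝ E] (g : Metric E M) (f : M → ℝ) (x : M) :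
    TangentSpace 𝓘(ℝ, E) x :=
  sharp g (mvfderiv 𝓘(ℝ, E) f) x

/-- `D g = α ⊗ g`, that is
`X (g (Y, Z)) - g (D_X Y, Z) - g (Y, D_X Z) = α (X) g (Y, Z)`. -/
def DerivMetricEq (g : Metric E M) (D : Connection E M)
    (α : Π x : M, TangentSpace 𝓘(ℝ, E) x →L[ℝ] ℝ) : Prop :=
  ∀ (x : M) (v : TangentSpace 𝓘(ℝ, E) x) (Y Z : Π x : M, TangentSpace 𝓘(ℝ, E) x),
    DiffFieldAt Y x → DiffFieldAt Z x →
    mvfderiv 𝓘(ℝ, E) (fun y ↦ g.inner y (Y y) (Z y)) x v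
      - g.inner x (D Y x v) (Z x) - g.inner x (Y x) (D Z x v) = α x v * g.inner x (Y x) (Z x)

/-- `ξ` is a Killing field of `g`: it is smooth and `L_ξ g = 0`, that is
`ξ (g (X, Y)) - g ([ξ, X], Y) - g (X, [ξ, Y]) = 0`. -/
def IsKilling (g : Metric E M) (ξ : Π x : M, TangentSpace 𝓘(ℝ, E) x) : Prop :=
  SmoothField ξ ∧
  ∀ (x : M) (X Y : Π x : M, TangentSpace 𝓘(ℝ, E) x),
    DiffFieldAt X x → DiffFieldAt Y x →
    mvfderiv 𝓘(ℝ, E) (fun y ↦ g.inner y (X y) (Y y)) x (ξ x)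
      - g.inner x (mlieBracket 𝓘(ℝ, E) ξ X x) (Y x)
      - g.inner x (X x) (mlieBracket 𝓘(ℝ, E) ξ Y x) = 0

/-- `R(X, Y) Z = D_X D_Y Z - D_Y D_X Z - D_[X, Y] Z`. -/
def curvature (D : Connection E M) (X Y Z : Π x : M, TangentSpace 𝓘(ℝ, E) x) (x : M) :
    TangentSpace 𝓘(ℝ, E) x :=
  D (fun y ↦ D Z y (Y y)) x (X x) - D (fun y ↦ D Z y (X y)) x (Y x)
    - D Z x (mlieBracket 𝓘(ℝ, E) X Y x)

/-- The Ricci tensor `ρ^D (u, v) = tr (w ↦ R(w, u) v)` of a connection. The curvature is tensorial,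
so it may be computed with any smooth local extensions of the tangent vectors; the trace is
computed in a basis of the tangent space. -/
def ricci [FiniteDimensional ℝ E] (D : Connection E M) (x : M) (u v : TangentSpace 𝓘(ℝ, E) x) : ℝ :=
  letI b : Module.Basis (Fin (Module.finrank ℝ E)) ℝ (TangentSpace 𝓘(ℝ, E) x) :=
    Module.finBasis ℝ E
  ∑ i, b.coord i (curvature D (FiberBundle.extend E (b i)) (FiberBundle.extend E u)
    (FiberBundle.extend E v) x)

variable [FiniteDimensional ℝ E]

/-- The torsion `D_X Y - D_Y X - [X, Y]` of `D` vanishes. -/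
def IsTorsionFree (D : Connection E M) : Prop :=
  haveI : CompleteSpace E := FiniteDimensional.complete ℝ E
  D.torsion = 0

/-- `D` is the Levi-Civita connection of `g`: it is torsion free and `D g = 0`. -/
structure IsLeviCivita (g : Metric E M) (D : Connection E M) : Prop where
  torsion_free : IsTorsionFree D
  deriv_metric : DerivMetricEq g D 0

/-- `δα = - div α^♯ = - tr (∇ α^♯)`, where `D = ∇` is meant to be the Levi-Civita connection
of `g`. -/
def codifferential (g : Metric E M) (D : Connection E M)
    (α : Π x : M, TangentSpace 𝓘(ℝ, E) x →L[ℝ] ℝ) (x : M) : ℝ :=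
  - LinearMap.trace ℝ (TangentSpace 𝓘(ℝ, E) x) (D (sharp g α) x).toLinearMap

/-- The smooth torsion-free connection `D` preserves the conformal class of `g`, with `D g = θ ⊗ g`,
and the symmetrized Ricci tensor of `D` is a multiple of `g`. (Replacing `g` by `e^u g` replaces
`θ` by `θ + du`, so this is a property of the conformal class and `D`, with `θ` attached to the
representative `g`.) -/
structure IsEinsteinWeyl (g : Metric E M) (D : Connection E M)
    (θ : Π x : M, TangentSpace 𝓘(ℝ, E) x →L[ℝ] ℝ) : Prop where
  smooth : CovariantDerivative.ContMDiffCovariantDerivative D ∞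
  torsion_free : IsTorsionFree D
  smooth_form : IsSmoothOneForm θ
  deriv_metric : DerivMetricEq g D θ
  ricci_eq : ∃ Λ : M → ℝ, ContMDiff 𝓘(ℝ, E) 𝓘(ℝ, ℝ) ∞ Λ ∧
    ∀ (x : M) (u v : TangentSpace 𝓘(ℝ, E) x), ricci D x u v + ricci D x v u = Λ x * g.inner x u v

/-- `g` is a standard (Gauduchon) metric for the Weyl structure with 1-form `θ`: `δθ = 0`. The
connection `D` here is the Levi-Civita connection of `g`, which is unique. -/
def IsStandard (g : Metric E M)
    (θ : Π x : M, TangentSpace 𝓘(ℝ, E) x →L[ℝ] ℝ) : Prop :=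
  ∃ D : Connection E M, IsLeviCivita g D ∧ ∀ x, codifferential g D θ x = 0

end Real

section Complex

variable {E : Type*} [NormedAddCommGroup E] [NormedSpace ℂ E]
  {M : Type*} [TopologicalSpace M] [ChartedSpace E M]

/-- A complex manifold is a smooth real manifold with the same charts. -/
instance isManifold_real [h : IsManifold 𝓘(ℂ, E) ω M] : IsManifold 𝓘(ℝ, E) ∞ M := by
  apply isManifold_of_contDiffOn
  intro e e' he he'
  have h1 := contDiffGroupoid_le (I := 𝓘(ℂ, E)) (m := ∞) (n := ω) le_top (h.compatible he he')
  have h2 := ((mem_groupoid_of_pregroupoid).1 h1).1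
  exact ContDiffOn.restrict_scalars ℝ h2

/-- The complex structure `J` on the real tangent spaces of a complex manifold. The tangent space at
`x` is the model space `E`, through a holomorphic chart at `x`, and `J` is multiplication by `i`;
as coordinate changes have complex linear derivatives, every holomorphic chart gives the same `J`. -/
def J (x : M) : TangentSpace 𝓘(ℝ, E) x →L[ℝ] TangentSpace 𝓘(ℝ, E) x :=
  (Complex.I • ContinuousLinearMap.id ℝ E : E →L[ℝ] E)

variable [IsManifold 𝓘(ℂ, E) ω M]

/-- The vector field `ξ` is (real) holomorphic: it is smooth and `L_ξ J = 0`, that is `[ξ, J X] = J [ξ, X]`. -/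
def IsHolomorphicField (ξ : Π x : M, TangentSpace 𝓘(ℝ, E) x) : Prop :=
  SmoothField ξ ∧
  ∀ (x : M) (X : Π x : M, TangentSpace 𝓘(ℝ, E) x), DiffFieldAt X x →
    mlieBracket 𝓘(ℝ, E) ξ (fun y ↦ J y (X y)) x = J x (mlieBracket 𝓘(ℝ, E) ξ X x)

/-- `g (J X, J Y) = g (X, Y)`. -/
def IsHermitian (g : Metric E M) : Prop :=
  ∀ (x : M) (u v : TangentSpace 𝓘(ℝ, E) x), g.inner x (J x u) (J x v) = g.inner x u v

/-- `g` is a Kähler metric on the complex manifold `(M, J)`: it is Hermitian and `J` is parallel for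
its Levi-Civita connection, `∇ (J X) = J (∇ X)`. -/
def IsKaehler [FiniteDimensional ℝ E] (g : Metric E M) : Prop :=
  IsHermitian g ∧ ∃ D : Connection E M, IsLeviCivita g D ∧
    ∀ (x : M) (v : TangentSpace 𝓘(ℝ, E) x) (X : Π x : M, TangentSpace 𝓘(ℝ, E) x),
      DiffFieldAt X x → D (fun y ↦ J y (X y)) x v = J x (D X x v)

end Complex

end EinsteinWeyl

end

/-!
Let `∇` be the Levi-Civita connection of `g`. The argument of Gauduchon and Tod shows that `ξ` is a
Killing field of `g`: since `δω = 0`, the contracted second Bianchi identity identifies the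
divergence of `½ (∇_ξ ξ + ½ ∇|ξ|²) + (½ Λ + ¼ (n - 2) |ξ|²) ξ` with `¼ |L_ξ g|²`, and the integral
of a divergence vanishes.

Hence `L_ξ (f² g) = 2 l f² g` with `l = ξ f / f`. Write `∇¹` for the Levi-Civita connection of the
Kähler metric `f² g`. As the 2-form dual to `∇¹ (J ξ)` is closed, the field
`(n - 2) l ξ - (∇¹_ξ ξ + J ∇¹_{Jξ} ξ)` has divergence `n (n - 2) l² + ½ |L_ξ J|²`, so `l = 0` and
`L_ξ J = 0`.

The skew-symmetric part of `ρ^D` is a multiple of `dω`, so `dω` is `J`-invariant. So is `d (f² ω)`,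
because `∇¹ ξ` commutes with `J`, and then also `df ∧ ω`, as `d (f² ω) = 2 f df ∧ ω + f² dω`. With
`ξ f = 0` this makes `∇f` a multiple of `J ξ`.
-/

set_option maxSynthPendingDepth 3

noncomputable section

namespace EinsteinWeyl

section LinearAlgebra

variable {E : Type*} [NormedAddCommGroup E] [NormedSpace ℝ E] {B : E →L[ℝ] E →L[ℝ] ℝ}

/-- The bilinear form `B` is an inner product: it is symmetric and positive definite. -/
structure IsInnerProduct (B : E →L[ℝ] E →L[ℝ] ℝ) : Prop where
  symm : ∀ u v, B u v = B v u
  pos : ∀ u, u ≠ 0 → 0 < B u u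

theorem IsInnerProduct.eq_zero_of_self (hB : IsInnerProduct B) {u : E} (hu : B u u = 0) : u = 0 :=
  of_not_not fun h ↦ (hB.pos u h).ne' hu

theorem IsInnerProduct.nonneg (hB : IsInnerProduct B) (u : E) : 0 ≤ B u u := by
  rcases eq_or_ne u 0 with rfl | hu
  · simp
  · exact (hB.pos u hu).le

theorem IsInnerProduct.ext (hB : IsInnerProduct B) {u v : E} (h : ∀ w, B u w = B v w) : u = v :=
  sub_eq_zero.1 <| hB.eq_zero_of_self <| by
    rw [map_sub B, sub_apply, h, sub_self]

/-- This is what makes torsion-free metric connections unique. -/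
theorem eq_zero_of_symm_of_skew {α : Type*} {S : α → α → α → ℝ}
    (hsymm : ∀ u v w, S u v w = S v u w) (hskew : ∀ u v w, S u v w = -S u w v) (u v w : α) :
    S u v w = 0 := by
  linarith [hskew u v w, hsymm u w v, hskew w u v, hsymm w v u, hskew v w u, hsymm v u w]

variable {ι : Type*} [Fintype ι]

theorem trace_eq_sum_repr (b : Module.Basis ι ℝ E) (A : E →ₗ[ℝ] E) :
    LinearMap.trace ℝ E A = ∑ i, b.repr (A (b i)) i := by
  classical
  rw [LinearMap.trace_eq_matrix_trace ℝ b, Matrix.trace]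
  simp [LinearMap.toMatrix_apply]

theorem skew_of_sum_sum_add_sq_eq_zero {e : Module.Basis ι ℝ E} {A : E →L[ℝ] E}
    (h : ∑ i, ∑ j, (B (A (e i)) (e j) + B (A (e j)) (e i)) ^ 2 = 0) (u v : E) :
    B (A u) v + B (A v) u = 0 := by
  have hbasis : ∀ i j, B (A (e i)) (e j) + B (A (e j)) (e i) = 0 := fun i j ↦ by
    have hi := (Finset.sum_eq_zero_iff_of_nonneg fun i _ ↦
      Finset.sum_nonneg fun j _ ↦ sq_nonneg (B (A (e i)) (e j) + B (A (e j)) (e i))).1 h i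
        (Finset.mem_univ i)
    exact pow_eq_zero_iff two_ne_zero |>.1 <|
      (Finset.sum_eq_zero_iff_of_nonneg fun j _ ↦ sq_nonneg _).1 hi j (Finset.mem_univ j)
  have hzero : B.comp A + (B.comp A).flip = 0 := by
    refine ContinuousLinearMap.coe_injective <| e.ext fun i ↦
      ContinuousLinearMap.coe_injective <| e.ext fun j ↦ hbasis i j
  exact congr($hzero u v)

variable [DecidableEq ι]

/-- The basis `e` is orthonormal for the bilinear form `B`. -/
def IsOrthonormal {ι : Type*} [DecidableEq ι] (B : E →L[ℝ] E →L[ℝ] ℝ) (e : Module.Basis ι ℝ E) :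
    Prop := ∀ i j, B (e i) (e j) = if i = j then 1 else 0

theorem IsInnerProduct.exists_isOrthonormal [FiniteDimensional ℝ E] (hB : IsInnerProduct B) :
    ∃ e : Module.Basis (Fin (Module.finrank ℝ E)) ℝ E, IsOrthonormal B e := by
  let B' : LinearMap.BilinForm ℝ E := LinearMap.mk₂ ℝ (fun u v ↦ B u v) (by simp) (by simp)
    (by simp) (by simp)
  obtain ⟨v, hv⟩ := LinearMap.BilinForm.exists_orthogonal_basis (B := B') ⟨hB.symm⟩
  have hpos : ∀ i, 0 < B (v i) (v i) := fun i ↦ hB.pos _ (v.ne_zero i)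
  have hsqrt : ∀ i, Real.sqrt (B (v i) (v i)) ≠ 0 := fun i ↦ (Real.sqrt_pos.2 (hpos i)).ne'
  refine ⟨v.isUnitSMul fun i ↦ (inv_ne_zero (hsqrt i)).isUnit, fun i j ↦ ?_⟩
  simp only [Module.Basis.isUnitSMul_apply, map_smul, smul_apply, smul_eq_mul]
  split_ifs with hij
  · subst hij
    have := Real.sq_sqrt (hpos i).le
    have := hsqrt i
    field_simp
    linarith
  · have : B (v i) (v j) = 0 := hv hij
    rw [this, mul_zero, mul_zero]

namespace IsOrthonormal

variable {e : Module.Basis ι ℝ E} (he : IsOrthonormal B e)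

include he

omit [Fintype ι] in
theorem repr_eq [Finite ι] (v : E) (i : ι) : e.repr v i = B v (e i) := by
  have := Fintype.ofFinite ι
  conv_rhs => rw [← e.sum_repr v]
  simp only [map_sum, map_smul, sum_apply, smul_apply, he _ _, smul_eq_mul]
  simp

theorem sum_smul (v : E) : ∑ i, B v (e i) • e i = v := by
  simpa only [he.repr_eq] using e.sum_repr v

theorem sum_mul (L : E →L[ℝ] ℝ) (v : E) : ∑ i, L (e i) * B v (e i) = L v := by
  conv_rhs => rw [← he.sum_smul v]
  simp [mul_comm]

theorem trace_eq (A : E →ₗ[ℝ] E) : LinearMap.trace ℝ E A = ∑ i, B (A (e i)) (e i) := by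
  simp only [trace_eq_sum_repr e, he.repr_eq]

theorem sum_inner_self : ∑ i, B (e i) (e i) = Module.finrank ℝ E := by
  have he' : ∀ i, B (e i) (e i) = 1 := fun i ↦ by simpa using he i i
  simp [he', Module.finrank_eq_card_basis e]

theorem sum_sum_add_sq (A : E →L[ℝ] E) :
    ∑ i, ∑ j, (B (A (e i)) (e j) + B (A (e j)) (e i)) ^ 2
      = 2 * (∑ i, B (A (e i)) (A (e i)) + ∑ i, B (A (A (e i))) (e i)) := by
  have hnorm : ∀ i, ∑ j, B (A (e i)) (e j) * B (A (e i)) (e j) = B (A (e i)) (A (e i)) :=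
    fun i ↦ he.sum_mul (B (A (e i))) (A (e i))
  have hsquare : ∀ i, ∑ j, B (A (e j)) (e i) * B (A (e i)) (e j) = B (A (A (e i))) (e i) :=
    fun i ↦ he.sum_mul ((B.flip (e i)).comp A) (A (e i))
  have hexpand : ∀ i j, (B (A (e i)) (e j) + B (A (e j)) (e i)) ^ 2
      = B (A (e i)) (e j) * B (A (e i)) (e j) + B (A (e j)) (e i) * B (A (e j)) (e i)
        + 2 * (B (A (e j)) (e i) * B (A (e i)) (e j)) := fun i j ↦ by ring
  simp only [hexpand, Finset.sum_add_distrib, ← Finset.mul_sum, hnorm, hsquare]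
  rw [Finset.sum_comm (f := fun i j ↦ B (A (e j)) (e i) * B (A (e j)) (e i))]
  simp only [hnorm]
  ring

end IsOrthonormal

theorem IsInnerProduct.trace_eq_zero_of_skew [FiniteDimensional ℝ E] (hB : IsInnerProduct B)
    {A : E →ₗ[ℝ] E} (hA : ∀ u v, B (A u) v + B (A v) u = 0) : LinearMap.trace ℝ E A = 0 := by
  obtain ⟨e, he⟩ := hB.exists_isOrthonormal
  rw [he.trace_eq]
  exact Finset.sum_eq_zero fun i _ ↦ by linarith [hA (e i) (e i)]

section Complex

variable {J T : E →L[ℝ] E} {l : ℝ}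

/-- `J` is an orthogonal complex structure for the bilinear form `B`. -/
structure IsOrthogonalComplex (B : E →L[ℝ] E →L[ℝ] ℝ) (J : E →L[ℝ] E) : Prop where
  sq : ∀ u, J (J u) = -u
  inner : ∀ u v, B (J u) (J v) = B u v

theorem IsOrthogonalComplex.skew (hJ : IsOrthogonalComplex B J) (u v : E) :
    B (J u) v = -B u (J v) := by
  rw [← hJ.inner u (J v), hJ.sq, map_neg, neg_neg]

theorem IsOrthogonalComplex.sum_apply (hJ : IsOrthogonalComplex B J) (hB : IsInnerProduct B)
    {e : Module.Basis ι ℝ E} (he : IsOrthonormal B e) (F : E →L[ℝ] E →L[ℝ] ℝ) :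
    ∑ i, F (J (e i)) (e i) = -∑ i, F (e i) (J (e i)) := by
  have hleft : ∀ i, F (J (e i)) (e i) = ∑ j, B (J (e i)) (e j) * F (e j) (e i) := fun i ↦ by
    conv_lhs => rw [← he.sum_smul (J (e i))]
    simp
  have hright : ∀ i, F (e i) (J (e i)) = ∑ j, B (J (e i)) (e j) * F (e i) (e j) := fun i ↦ by
    conv_lhs => rw [← he.sum_smul (J (e i))]
    simp
  simp only [hleft, hright, ← Finset.sum_neg_distrib]
  rw [Finset.sum_comm]
  refine Finset.sum_congr rfl fun i _ ↦ Finset.sum_congr rfl fun j _ ↦ ?_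
  rw [hJ.skew, hB.symm, neg_mul]

/-- The endomorphism `T + J T J = J [T, J]`, which measures the failure of `T` to commute with the
complex structure `J`. -/
def complexDefect (J T : E →L[ℝ] E) : E →L[ℝ] E := T + J.comp (T.comp J)

theorem complexDefect_apply (u : E) : complexDefect J T u = T u + J (T (J u)) := rfl

namespace IsOrthogonalComplex

variable (hJ : IsOrthogonalComplex B J)

include hJ

theorem comm_of_complexDefect_eq_zero {u : E} (h : complexDefect J T u = 0) :
    T (J u) = J (T u) := by
  have := congrArg J h
  rw [complexDefect_apply, map_add, hJ.sq, map_zero] at this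
  exact (sub_eq_zero.1 (by rw [sub_eq_add_neg]; exact this)).symm

theorem complexDefect_skew (hT : ∀ u v, B (T u) v + B (T v) u = 2 * l * B u v) (u v : E) :
    B (complexDefect J T u) v = -B (complexDefect J T v) u := by
  have hTJ := hT (J u) (J v)
  rw [hJ.inner] at hTJ
  simp only [complexDefect_apply, map_add, add_apply, hJ.skew (T _)]
  linarith [hT u v]

theorem sum_inner_complexDefect (hB : IsInnerProduct B) {e : Module.Basis ι ℝ E}
    (he : IsOrthonormal B e) :
    ∑ i, B (complexDefect J T (e i)) (complexDefect J T (e i))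
      = 2 * ∑ i, B (T (e i)) (complexDefect J T (e i)) := by
  have hanti : ∀ u, J (complexDefect J T u) = -complexDefect J T (J u) := fun u ↦ by
    simp only [complexDefect_apply, map_add, hJ.sq, map_neg]; abel
  have hsum := hJ.sum_apply hB he (B.bilinearComp T ((complexDefect J T).comp J))
  simp only [ContinuousLinearMap.bilinearComp_apply, ContinuousLinearMap.comp_apply, hJ.sq,
    map_neg, Finset.sum_neg_distrib, neg_neg] at hsum
  have hsplit : ∀ i, B (complexDefect J T (e i)) (complexDefect J T (e i))
      = B (T (e i)) (complexDefect J T (e i))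
        + B (T (J (e i))) (complexDefect J T (J (e i))) := fun i ↦ by
    nth_rw 1 [complexDefect_apply]
    rw [map_add B, add_apply, hJ.skew, hanti, map_neg, neg_neg]
  simp only [hsplit, Finset.sum_add_distrib, hsum]
  ring

/-- If `B a ∧ β` is `J`-invariant and `β a = 0`, contracting with `a` shows that `β` is a multiple
of the form dual to `J a`. -/
theorem mul_inner_self_of_invariant (hB : IsInnerProduct B) {β : E →L[ℝ] ℝ} {a : E} (hβ : β a = 0)
    (h : ∀ u v, β (J u) * B a (J v) - β (J v) * B a (J u) = β u * B a v - β v * B a u) (v : E) :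
    β v * B a a = β (J a) * B (J a) v := by
  have haJ : B a (J a) = 0 := by linarith [hJ.skew a a, hB.symm (J a) a]
  have hav := h a v
  rw [haJ, hβ] at hav
  rw [hJ.skew]
  linarith

end IsOrthogonalComplex

end Complex

end LinearAlgebra

section Calculus

variable {E : Type*} [NormedAddCommGroup E] [NormedSpace ℝ E]
  {F F' F'' : Type*} [NormedAddCommGroup F] [NormedSpace ℝ F] [NormedAddCommGroup F']
  [NormedSpace ℝ F'] [NormedAddCommGroup F''] [NormedSpace ℝ F''] {y : E}

theorem fderiv_apply_const {A : E → F →L[ℝ] F'} (hA : DifferentiableAt ℝ A y) (v : F) (u : E) :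
    fderiv ℝ (fun z ↦ A z v) y u = fderiv ℝ A y u v := by
  simp [fderiv_clm_apply hA (differentiableAt_const v)]

theorem fderiv_apply {A : E → F →L[ℝ] F'} {B : E → F} (hA : DifferentiableAt ℝ A y)
    (hB : DifferentiableAt ℝ B y) (u : E) :
    fderiv ℝ (fun z ↦ A z (B z)) y u = fderiv ℝ A y u (B y) + A y (fderiv ℝ B y u) := by
  simp [fderiv_clm_apply hA hB, add_comm]

theorem fderiv_apply₂ {A : E → F →L[ℝ] F' →L[ℝ] F''} {B : E → F} {C : E → F'}
    (hA : DifferentiableAt ℝ A y) (hB : DifferentiableAt ℝ B y) (hC : DifferentiableAt ℝ C y)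
    (u : E) : fderiv ℝ (fun z ↦ A z (B z) (C z)) y u =
      fderiv ℝ A y u (B y) (C y) + A y (fderiv ℝ B y u) (C y) + A y (B y) (fderiv ℝ C y u) := by
  rw [fderiv_apply (hA.clm_apply hB) hC, fderiv_apply hA hB, add_apply]

theorem differentiableAt_flip {A : E → F →L[ℝ] F' →L[ℝ] F''} (hA : DifferentiableAt ℝ A y) :
    DifferentiableAt ℝ (fun z ↦ (A z).flip) y :=
  (ContinuousLinearMap.flipₗᵢ ℝ F F' F'').toContinuousLinearEquiv.differentiableAt.comp y hA

theorem differentiableAt_fderiv {f : E → F} (hf : ContDiffAt ℝ ∞ f y) :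
    DifferentiableAt ℝ (fderiv ℝ f) y :=
  (hf.fderiv_right (m := 1) (WithTop.coe_le_coe.2 le_top)).differentiableAt one_ne_zero

theorem fderiv_fderiv_symm {f : E → F} (hf : ContDiffAt ℝ ∞ f y) (u v : E) :
    fderiv ℝ (fderiv ℝ f) y u v = fderiv ℝ (fderiv ℝ f) y v u :=
  hf.isSymmSndFDerivAt
    (by rw [minSmoothness_of_isRCLikeNormedField]; exact WithTop.coe_le_coe.2 le_top) u v

end Calculus

section Connection

variable {E : Type*} [NormedAddCommGroup E] [NormedSpace ℝ E] {Γ : E → E →L[ℝ] E →L[ℝ] E}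
  {U : Set E} {X Y : E → E} {A : E → E →L[ℝ] E} {y : E}

/-- `Γ` are the Christoffel symbols of a smooth torsion-free connection on the open set `U`, where
`Γ y u v` is the derivative at `y`, in the direction `u`, of the field with constant value `v`. -/
structure IsTorsionFreeOn (U : Set E) (Γ : E → E →L[ℝ] E →L[ℝ] E) : Prop where
  isOpen : IsOpen U
  contDiffOn : ContDiffOn ℝ ∞ Γ U
  symm : ∀ y ∈ U, ∀ u v, Γ y u v = Γ y v u

namespace IsTorsionFreeOn

variable (h : IsTorsionFreeOn U Γ) (hy : y ∈ U)

include h hy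

theorem contDiffAt : ContDiffAt ℝ ∞ Γ y := h.contDiffOn.contDiffAt (h.isOpen.mem_nhds hy)

theorem differentiableAt : DifferentiableAt ℝ Γ y := (h.contDiffAt hy).differentiableAt (by simp)

theorem fderiv_symm (u v w : E) : fderiv ℝ Γ y u v w = fderiv ℝ Γ y u w v := by
  have hd := h.differentiableAt hy
  have hsymm : (fun z ↦ Γ z v w) =ᶠ[nhds y] fun z ↦ Γ z w v := by
    filter_upwards [h.isOpen.mem_nhds hy] with z hz using h.symm z hz v w
  rw [← fderiv_apply_const hd, ← fderiv_apply_const (by fun_prop), hsymm.fderiv_eq,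
    fderiv_apply_const (by fun_prop), fderiv_apply_const hd]

end IsTorsionFreeOn

/-- The covariant derivative `∇ X` of the vector field `X`. -/
def covField (Γ : E → E →L[ℝ] E →L[ℝ] E) (X : E → E) (y : E) : E →L[ℝ] E :=
  fderiv ℝ X y + (Γ y).flip (X y)

theorem covField_apply (u : E) : covField Γ X y u = fderiv ℝ X y u + Γ y u (X y) := rfl

theorem covField_const (v u : E) : covField Γ (fun _ ↦ v) y u = Γ y u v := by
  simp [covField_apply]

theorem covField_congr (h : X =ᶠ[nhds y] Y) : covField Γ X y = covField Γ Y y := by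
  rw [covField, covField, h.fderiv_eq, h.eq_of_nhds]

theorem differentiableAt_covField (hΓ : DifferentiableAt ℝ Γ y) (hX : ContDiffAt ℝ ∞ X y) :
    DifferentiableAt ℝ (covField Γ X) y := by
  have hX' := differentiableAt_fderiv hX
  exact hX'.add ((differentiableAt_flip hΓ).clm_apply (hX.differentiableAt (by simp)))

theorem contDiffOn_covField (hU : IsOpen U) (hΓ : ContDiffOn ℝ ∞ Γ U) (hX : ContDiffOn ℝ ∞ X U) :
    ContDiffOn ℝ ∞ (covField Γ X) U := by
  have hflip : ContDiffOn ℝ ∞ (fun y ↦ (Γ y).flip) U :=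
    (ContinuousLinearMap.flipₗᵢ ℝ E E E).contDiff.comp_contDiffOn hΓ
  exact (hX.fderiv_of_isOpen hU le_rfl).add (hflip.clm_apply hX)

/-- The covariant derivative `∇ A` of the field of endomorphisms `A`; `covEnd Γ A y u` is
`∇_u A`. -/
def covEnd (Γ : E → E →L[ℝ] E →L[ℝ] E) (A : E → E →L[ℝ] E) (y : E) : E →L[ℝ] E →L[ℝ] E :=
  fderiv ℝ A y + ((ContinuousLinearMap.compL ℝ E E E).flip (A y)).comp (Γ y)
    - (ContinuousLinearMap.compL ℝ E E E (A y)).comp (Γ y)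

theorem covEnd_apply (u v : E) :
    covEnd Γ A y u v = fderiv ℝ A y u v + Γ y u (A y v) - A y (Γ y u v) := rfl

theorem covField_apply_field (hA : DifferentiableAt ℝ A y) (hX : DifferentiableAt ℝ X y) (u : E) :
    covField Γ (fun z ↦ A z (X z)) y u = covEnd Γ A y u (X y) + A y (covField Γ X y u) := by
  simp only [covField_apply, covEnd_apply, fderiv_apply hA hX, map_add]
  abel

theorem trace_covEnd [FiniteDimensional ℝ E] (hA : DifferentiableAt ℝ A y) (u : E) :
    LinearMap.trace ℝ E (covEnd Γ A y u).toLinearMap =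
      fderiv ℝ (fun z ↦ LinearMap.trace ℝ E (A z).toLinearMap) y u := by
  let tr : (E →L[ℝ] E) →L[ℝ] ℝ := LinearMap.toContinuousLinearMap
    (LinearMap.trace ℝ E ∘ₗ ContinuousLinearMap.coeLM ℝ)
  have hderiv : fderiv ℝ (fun z ↦ tr (A z)) y u = tr (fderiv ℝ A y u) := by
    simp [fderiv_fun_comp y tr.differentiableAt hA]
  have hcomm : tr ((Γ y u).comp (A y)) = tr ((A y).comp (Γ y u)) :=
    LinearMap.trace_comp_comm' _ _
  have hsum : tr (covEnd Γ A y u)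
      = tr (fderiv ℝ A y u) + tr ((Γ y u).comp (A y)) - tr ((A y).comp (Γ y u)) := by
    rw [← map_add, ← map_sub]
    rfl
  change tr (covEnd Γ A y u) = fderiv ℝ (fun z ↦ tr (A z)) y u
  rw [hsum, hcomm, hderiv, add_sub_cancel_right]

/-- The curvature tensor `R(u, v) w` of the connection with Christoffel symbols `Γ`. -/
def riem (Γ : E → E →L[ℝ] E →L[ℝ] E) (y : E) : E →L[ℝ] E →L[ℝ] E →L[ℝ] E :=
  fderiv ℝ Γ y - (fderiv ℝ Γ y).flip
    + (ContinuousLinearMap.compL ℝ E E E).bilinearComp (Γ y) (Γ y)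
    - ((ContinuousLinearMap.compL ℝ E E E).bilinearComp (Γ y) (Γ y)).flip

theorem riem_apply (u v w : E) : riem Γ y u v w = fderiv ℝ Γ y u v w - fderiv ℝ Γ y v u w
    + Γ y u (Γ y v w) - Γ y v (Γ y u w) := rfl

theorem riem_swap (u v : E) : riem Γ y u v = -riem Γ y v u := by
  ext w
  simp only [neg_apply, riem_apply]
  abel

theorem riem_eq_covField_sub (hΓ : DifferentiableAt ℝ Γ y) (u v w : E) :
    riem Γ y u v w = covField Γ (fun z ↦ Γ z v w) y u - covField Γ (fun z ↦ Γ z u w) y v := by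
  simp only [covField_apply, riem_apply]
  rw [fderiv_apply_const (by fun_prop), fderiv_apply_const hΓ, fderiv_apply_const (by fun_prop),
    fderiv_apply_const hΓ]
  abel

namespace IsTorsionFreeOn

variable (h : IsTorsionFreeOn U Γ) (hy : y ∈ U)

include h hy

theorem differentiableAt_riem [FiniteDimensional ℝ E] : DifferentiableAt ℝ (riem Γ) y := by
  have hΓ := h.contDiffOn
  have hΓ' : ContDiffOn ℝ ∞ (fderiv ℝ Γ) U := hΓ.fderiv_of_isOpen h.isOpen le_rfl
  have hriem : ContDiffOn ℝ ∞ (riem Γ) U := by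
    refine contDiffOn_clm_apply.2 fun u ↦ contDiffOn_clm_apply.2 fun v ↦
      contDiffOn_clm_apply.2 fun w ↦ ?_
    have hderiv : ∀ a b c : E, ContDiffOn ℝ ∞ (fun z ↦ fderiv ℝ Γ z a b c) U := fun a b c ↦
      ((hΓ'.clm_apply contDiffOn_const).clm_apply contDiffOn_const).clm_apply contDiffOn_const
    have hprod : ∀ a b c : E, ContDiffOn ℝ ∞ (fun z ↦ Γ z a (Γ z b c)) U := fun a b c ↦
      (hΓ.clm_apply contDiffOn_const).clm_apply
        ((hΓ.clm_apply contDiffOn_const).clm_apply contDiffOn_const)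
    exact (((hderiv u v w).sub (hderiv v u w)).add (hprod u v w)).sub (hprod v u w)
  exact (hriem.contDiffAt (h.isOpen.mem_nhds hy)).differentiableAt (by simp)

theorem first_bianchi (u v w : E) : riem Γ y u v w + riem Γ y v w u + riem Γ y w u v = 0 := by
  simp only [riem_apply]
  rw [h.fderiv_symm hy u v w, h.fderiv_symm hy v u w, h.fderiv_symm hy w u v, h.symm y hy v w,
    h.symm y hy u w, h.symm y hy u v]
  abel

theorem covEnd_covField_sub (hX : ContDiffAt ℝ ∞ X y) (u v : E) :
    covEnd Γ (covField Γ X) y u v - covEnd Γ (covField Γ X) y v u = riem Γ y u v (X y) := by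
  have hΓ := h.differentiableAt hy
  have hX₀ := hX.differentiableAt (by simp)
  have hX' := differentiableAt_fderiv hX
  have hderiv : ∀ a b, fderiv ℝ (covField Γ X) y a b = fderiv ℝ (fderiv ℝ X) y a b
      + (fderiv ℝ Γ y a b (X y) + Γ y b (fderiv ℝ X y a)) := fun a b ↦ by
    rw [← fderiv_apply_const (differentiableAt_covField hΓ hX)]
    simp only [covField_apply]
    rw [fderiv_fun_add (by fun_prop) (by fun_prop), add_apply, fderiv_apply_const hX',
      fderiv_apply (by fun_prop) hX₀, fderiv_apply_const hΓ]
  simp only [covEnd_apply, hderiv, covField_apply, riem_apply, map_add]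
  rw [fderiv_fderiv_symm hX v u, h.symm y hy v u]
  abel

theorem riem_fields {Z : E → E} (hX : DifferentiableAt ℝ X y) (hY : DifferentiableAt ℝ Y y)
    (hZ : ContDiffAt ℝ ∞ Z y) :
    covField Γ (fun z ↦ covField Γ Z z (Y z)) y (X y)
      - covField Γ (fun z ↦ covField Γ Z z (X z)) y (Y y)
      - covField Γ Z y (fderiv ℝ Y y (X y) - fderiv ℝ X y (Y y))
      = riem Γ y (X y) (Y y) (Z y) := by
  have hT := differentiableAt_covField (h.differentiableAt hy) hZ
  rw [covField_apply_field hT hY, covField_apply_field hT hX, ← h.covEnd_covField_sub hy hZ,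
    covField_apply (X := X), covField_apply (X := Y), h.symm y hy (Y y)]
  simp only [map_add, map_sub]
  abel

end IsTorsionFreeOn

/-- The covariant derivative `(∇_u R)(v, w)` of the curvature tensor. -/
def covRiem (Γ : E → E →L[ℝ] E →L[ℝ] E) (y u v w : E) : E →L[ℝ] E :=
  covEnd Γ (fun z ↦ riem Γ z v w) y u - riem Γ y (Γ y u v) w - riem Γ y v (Γ y u w)

theorem covRiem_apply (u v w x : E) : covRiem Γ y u v w x =
    covEnd Γ (fun z ↦ riem Γ z v w) y u x - riem Γ y (Γ y u v) w x - riem Γ y v (Γ y u w) x := rfl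

theorem covRiem_swap (u v w : E) : covRiem Γ y u v w = -covRiem Γ y u w v := by
  have hneg : (fun z ↦ riem Γ z v w) = -fun z ↦ riem Γ z w v := funext fun z ↦ riem_swap v w
  have hend : covEnd Γ (fun z ↦ riem Γ z v w) y u = -covEnd Γ (fun z ↦ riem Γ z w v) y u := by
    ext x
    rw [hneg, covEnd_apply, neg_apply, covEnd_apply, fderiv_neg]
    simp only [Pi.neg_apply, neg_apply, map_neg]
    abel
  rw [covRiem, covRiem, hend, riem_swap (Γ y u v), riem_swap v (Γ y u w)]
  abel

theorem IsTorsionFreeOn.second_bianchi [FiniteDimensional ℝ E] (h : IsTorsionFreeOn U Γ)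
    (hy : y ∈ U) (u v w x : E) :
    covRiem Γ y u v w x + covRiem Γ y v w u x + covRiem Γ y w u v x = 0 := by
  have hΓ := h.differentiableAt hy
  have hΓ' := differentiableAt_fderiv (h.contDiffAt hy)
  have hR := h.differentiableAt_riem hy
  have hderiv : ∀ a b c, fderiv ℝ (fun z ↦ riem Γ z b c) y a x =
      fderiv ℝ (fderiv ℝ Γ) y a b c x - fderiv ℝ (fderiv ℝ Γ) y a c b x
        + (fderiv ℝ Γ y a b (Γ y c x) + Γ y b (fderiv ℝ Γ y a c x))
        - (fderiv ℝ Γ y a c (Γ y b x) + Γ y c (fderiv ℝ Γ y a b x)) := fun a b c ↦ by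
    have hsecond : ∀ b c, fderiv ℝ (fun z ↦ fderiv ℝ Γ z b c x) y a
        = fderiv ℝ (fderiv ℝ Γ) y a b c x := fun b c ↦ by
      iterate 3 rw [fderiv_apply_const (by fun_prop)]
    have hprod : ∀ b c, fderiv ℝ (fun z ↦ Γ z b (Γ z c x)) y a
        = fderiv ℝ Γ y a b (Γ y c x) + Γ y b (fderiv ℝ Γ y a c x) := fun b c ↦ by
      rw [fderiv_apply (by fun_prop) (by fun_prop)]
      iterate 3 rw [fderiv_apply_const (by fun_prop)]
    rw [← fderiv_apply_const (by fun_prop)]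
    simp only [riem_apply]
    rw [fderiv_fun_sub (by fun_prop) (by fun_prop), fderiv_fun_add (by fun_prop) (by fun_prop),
      fderiv_fun_sub (by fun_prop) (by fun_prop)]
    simp only [sub_apply, add_apply, hsecond, hprod]
  have hsymm : ∀ a b c, fderiv ℝ (fderiv ℝ Γ) y a b c x = fderiv ℝ (fderiv ℝ Γ) y b a c x :=
    fun a b c ↦ by rw [fderiv_fderiv_symm (h.contDiffAt hy) a b]
  simp only [covRiem_apply, covEnd_apply, hderiv]
  rw [hsymm v u w, hsymm w u v, hsymm w v u, h.symm y hy v u, h.symm y hy w u, h.symm y hy w v,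
    riem_swap v (Γ y u w), riem_swap w (Γ y u v), riem_swap u (Γ y v w)]
  simp only [neg_apply, riem_apply, map_add, map_sub]
  abel

/-- The Ricci tensor `tr (u ↦ R(u, v) w)` of the connection with Christoffel symbols `Γ`. -/
def ric (Γ : E → E →L[ℝ] E →L[ℝ] E) (y v w : E) : ℝ :=
  LinearMap.trace ℝ E (((riem Γ y).flip v).flip w).toLinearMap

/-- The covariant derivative `(∇_u Ric)(v, w)` of the Ricci tensor. -/
def covRic (Γ : E → E →L[ℝ] E →L[ℝ] E) (y u v w : E) : ℝ :=
  fderiv ℝ (fun z ↦ ric Γ z v w) y u - ric Γ y (Γ y u v) w - ric Γ y v (Γ y u w)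

namespace IsTorsionFreeOn

variable (h : IsTorsionFreeOn U Γ) (hy : y ∈ U)

include h hy

theorem ric_sub_ric (v w : E) :
    ric Γ y v w - ric Γ y w v = -LinearMap.trace ℝ E (riem Γ y v w).toLinearMap := by
  rw [ric, ric, ← map_sub, ← map_neg]
  congr 1
  ext u
  have hb := h.first_bianchi hy u v w
  rw [riem_swap w u, neg_apply] at hb
  change riem Γ y u v w - riem Γ y u w v = -riem Γ y v w u
  rw [← sub_eq_zero, ← hb]
  abel

theorem covRic_eq [FiniteDimensional ℝ E] {ι : Type*} [Fintype ι] (b : Module.Basis ι ℝ E)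
    (u v w : E) : covRic Γ y u v w = ∑ i, b.repr (covRiem Γ y u (b i) v w) i := by
  have hR := h.differentiableAt_riem hy
  let S : E → E →L[ℝ] E := fun z ↦ ((riem Γ z).flip v).flip w
  have hS : DifferentiableAt ℝ S y :=
    (differentiableAt_flip ((differentiableAt_flip hR).clm_apply
      (differentiableAt_const v))).clm_apply (differentiableAt_const w)
  have hcov : ∀ x, covRiem Γ y u x v w = covEnd Γ S y u x
      - riem Γ y x (Γ y u v) w - riem Γ y x v (Γ y u w) := fun x ↦ by
    rw [covRiem_apply, covEnd_apply, covEnd_apply, ← fderiv_apply_const hS,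
      ← fderiv_apply_const (by fun_prop)]
    change _ - riem Γ y x v (Γ y u w) - _ - _
      = _ + Γ y u (riem Γ y x v w) - riem Γ y (Γ y u x) v w - _ - _
    simp only [S, ContinuousLinearMap.flip_apply]
    abel
  simp only [hcov, map_sub, Finsupp.sub_apply, Finset.sum_sub_distrib]
  have htrace := trace_covEnd (Γ := Γ) hS u
  rw [trace_eq_sum_repr b] at htrace
  rw [covRic, ric, ric, trace_eq_sum_repr b, trace_eq_sum_repr b]
  exact congr($htrace.symm - _ - _)

end IsTorsionFreeOn

end Connection

section Sharp

variable {E : Type*} [NormedAddCommGroup E] [NormedSpace ℝ E] [FiniteDimensional ℝ E]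

theorem contDiffAt_of_inner {k : ℕ∞ω} {y : E} {G : E → E →L[ℝ] E →L[ℝ] ℝ} {X : E → E}
    (hG : ContDiffAt ℝ k G y) (hpos : IsInnerProduct (G y))
    (h : ContDiffAt ℝ k (fun z ↦ G z (X z)) y) : ContDiffAt ℝ k X y := by
  have : CompleteSpace E := FiniteDimensional.complete ℝ E
  have hinj : Function.Injective (G y) := fun u v huv ↦ hpos.ext fun w ↦ by rw [huv]
  have hdim : Module.finrank ℝ E = Module.finrank ℝ (E →L[ℝ] ℝ) := by
    rw [← (LinearMap.toContinuousLinearMap (𝕜 := ℝ) (E := E) (F' := ℝ)).finrank_eq]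
    exact Subspace.dual_finrank_eq.symm
  let e : E ≃L[ℝ] (E →L[ℝ] ℝ) := (LinearEquiv.ofInjectiveOfFinrankEq (G y : E →ₗ[ℝ] _)
    hinj hdim).toContinuousLinearEquiv
  have he : (e : E →L[ℝ] E →L[ℝ] ℝ) = G y := by
    ext v w
    rfl
  have hinverse : ContDiffAt ℝ k (fun z ↦ (G z).inverse) y :=
    (he ▸ contDiffAt_map_inverse (𝕜 := ℝ) (n := k) e).comp y hG
  have hinvertible : ∀ᶠ z in nhds y, G z ∈ Set.range
      ((↑) : (E ≃L[ℝ] E →L[ℝ] ℝ) → E →L[ℝ] E →L[ℝ] ℝ) :=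
    hG.continuousAt.eventually (he ▸ ContinuousLinearEquiv.nhds e)
  refine (hinverse.clm_apply h).congr_of_eventuallyEq ?_
  filter_upwards [hinvertible] with z ⟨e', he'⟩
  rw [← he', ContinuousLinearMap.inverse_equiv]
  simp

end Sharp

section LeviCivita

variable {E : Type*} [NormedAddCommGroup E] [NormedSpace ℝ E] {U : Set E}
  {G : E → E →L[ℝ] E →L[ℝ] ℝ} {Γ : E → E →L[ℝ] E →L[ℝ] E} {X Y : E → E} {A : E → E →L[ℝ] E} {y : E}

/-- `Γ` are the Christoffel symbols of the Levi-Civita connection of the smooth Riemannian metric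
`G` on the open set `U`. -/
structure IsLeviCivitaOn (U : Set E) (G : E → E →L[ℝ] E →L[ℝ] ℝ) (Γ : E → E →L[ℝ] E →L[ℝ] E) : Prop
    extends IsTorsionFreeOn U Γ where
  contDiffOn_metric : ContDiffOn ℝ ∞ G U
  isInnerProduct : ∀ y ∈ U, IsInnerProduct (G y)
  fderiv_metric : ∀ y ∈ U, ∀ u v w, fderiv ℝ G y u v w = G y (Γ y u v) w + G y v (Γ y u w)

namespace IsLeviCivitaOn

variable (h : IsLeviCivitaOn U G Γ) (hy : y ∈ U)

include h hy

theorem metric_symm (u v : E) : G y u v = G y v u := (h.isInnerProduct y hy).symm u v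

theorem differentiableAt_metric : DifferentiableAt ℝ G y :=
  (h.contDiffOn_metric.contDiffAt (h.isOpen.mem_nhds hy)).differentiableAt (by simp)

theorem fderiv_inner (hX : DifferentiableAt ℝ X y) (hY : DifferentiableAt ℝ Y y) (u : E) :
    fderiv ℝ (fun z ↦ G z (X z) (Y z)) y u =
      G y (covField Γ X y u) (Y y) + G y (X y) (covField Γ Y y u) := by
  rw [fderiv_apply₂ (h.differentiableAt_metric hy) hX hY, h.fderiv_metric y hy]
  simp only [covField_apply, map_add, add_apply]
  ring

theorem covEnd_add_covEnd {c : E → ℝ} (hA : DifferentiableAt ℝ A y) (hc : DifferentiableAt ℝ c y)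
    (hconf : ∀ z ∈ U, ∀ v w, G z (A z v) w + G z (A z w) v = c z * G z v w) (u v w : E) :
    G y (covEnd Γ A y u v) w + G y (covEnd Γ A y u w) v = fderiv ℝ c y u * G y v w := by
  have hd : ∀ v : E, DifferentiableAt ℝ (fun z ↦ A z v) y := fun v ↦ by fun_prop
  have hG : ∀ v w : E, DifferentiableAt ℝ (fun z ↦ G z v w) y := fun v w ↦ by
    have := h.differentiableAt_metric hy
    fun_prop
  have hGA : ∀ v w : E, DifferentiableAt ℝ (fun z ↦ G z (A z v) w) y := fun v w ↦ by
    have := h.differentiableAt_metric hy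
    fun_prop
  have hcov : ∀ v : E, covField Γ (fun z ↦ A z v) y u = covEnd Γ A y u v + A y (Γ y u v) :=
    fun v ↦ by rw [covField_apply_field hA (differentiableAt_const v), covField_const]
  have hlocal : (fun z ↦ G z (A z v) w + G z (A z w) v) =ᶠ[nhds y] fun z ↦ c z * G z v w := by
    filter_upwards [h.isOpen.mem_nhds hy] with z hz using hconf z hz v w
  have hderiv := congr($(hlocal.fderiv_eq (𝕜 := ℝ)) u)
  rw [fderiv_fun_add (hGA v w) (hGA w v), add_apply, fderiv_fun_mul hc (hG v w),
    h.fderiv_inner hy (hd v) (differentiableAt_const w),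
    h.fderiv_inner hy (hd w) (differentiableAt_const v)] at hderiv
  simp only [add_apply, smul_apply, smul_eq_mul] at hderiv
  rw [h.fderiv_inner hy (differentiableAt_const v) (differentiableAt_const w)] at hderiv
  simp only [covField_const, hcov, map_add, add_apply] at hderiv
  linarith [hconf y hy (Γ y u v) w, hconf y hy v (Γ y u w), h.metric_symm hy (A y v) (Γ y u w),
    h.metric_symm hy (A y (Γ y u w)) v, h.metric_symm hy (A y (Γ y u v)) w,
    h.metric_symm hy (A y w) (Γ y u v)]

theorem riem_skew (u v x w : E) : G y (riem Γ y u v x) w + G y (riem Γ y u v w) x = 0 := by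
  have hΓ := h.differentiableAt hy
  let f : E → ℝ := fun z ↦ G z x w
  have hf : ContDiffAt ℝ ∞ f y :=
    ((h.contDiffOn_metric.clm_apply contDiffOn_const).clm_apply contDiffOn_const).contDiffAt
      (h.isOpen.mem_nhds hy)
  have hfirst : ∀ a, (fun z ↦ fderiv ℝ f z a) =ᶠ[nhds y]
      fun z ↦ G z (Γ z a x) w + G z x (Γ z a w) := fun a ↦ by
    filter_upwards [h.isOpen.mem_nhds hy] with z hz
    simpa only [covField_const] using
      h.fderiv_inner hz (differentiableAt_const x) (differentiableAt_const w) a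
  have hsecond : ∀ a b, fderiv ℝ (fderiv ℝ f) y a b =
      (G y (covField Γ (fun z ↦ Γ z b x) y a) w + G y (Γ y b x) (Γ y a w))
        + (G y (Γ y a x) (Γ y b w) + G y x (covField Γ (fun z ↦ Γ z b w) y a)) := fun a b ↦ by
    have hG := h.differentiableAt_metric hy
    rw [← fderiv_apply_const (differentiableAt_fderiv hf), (hfirst b).fderiv_eq,
      fderiv_fun_add (by fun_prop) (by fun_prop), add_apply,
      h.fderiv_inner hy (by fun_prop) (by fun_prop), h.fderiv_inner hy (by fun_prop) (by fun_prop),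
      covField_const, covField_const]
  rw [riem_eq_covField_sub hΓ, riem_eq_covField_sub hΓ, h.metric_symm hy _ x]
  simp only [map_sub, sub_apply]
  linarith [fderiv_fderiv_symm hf u v, hsecond u v, hsecond v u]

variable [FiniteDimensional ℝ E]

theorem covRiem_skew (u v w x t : E) :
    G y (covRiem Γ y u v w x) t + G y (covRiem Γ y u v w t) x = 0 := by
  have hR := h.differentiableAt_riem hy
  have hend := h.covEnd_add_covEnd hy (A := fun z ↦ riem Γ z v w) (c := fun _ ↦ 0) (by fun_prop)
    (by fun_prop) (fun z hz a b ↦ by rw [h.riem_skew hz, zero_mul]) u x t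
  simp only [fderiv_fun_const, Pi.zero_apply, zero_apply, zero_mul] at hend
  simp only [covRiem_apply, map_sub, sub_apply]
  linarith [h.riem_skew hy (Γ y u v) w x t, h.riem_skew hy v (Γ y u w) x t]

theorem trace_riem (u v : E) : LinearMap.trace ℝ E (riem Γ y u v).toLinearMap = 0 :=
  (h.isInnerProduct y hy).trace_eq_zero_of_skew fun x w ↦ h.riem_skew hy u v x w

theorem ric_symm (v w : E) : ric Γ y v w = ric Γ y w v := by
  have hsub := h.ric_sub_ric hy v w
  rw [h.trace_riem hy, neg_zero] at hsub
  exact sub_eq_zero.1 hsub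

theorem contracted_bianchi {ι : Type*} [Fintype ι] [DecidableEq ι] {e : Module.Basis ι ℝ E}
    (he : IsOrthonormal (G y) e) (v : E) :
    2 * ∑ i, covRic Γ y (e i) v (e i) = ∑ i, covRic Γ y v (e i) (e i) := by
  simp only [h.covRic_eq hy e, he.repr_eq]
  have hsplit : ∑ i, ∑ j, G y (covRiem Γ y v (e j) (e i) (e i)) (e j)
      = (∑ i, ∑ j, G y (covRiem Γ y (e i) (e j) v (e i)) (e j))
        + ∑ i, ∑ j, G y (covRiem Γ y (e j) (e i) v (e j)) (e i) := by
    simp only [← Finset.sum_add_distrib]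
    refine Finset.sum_congr rfl fun i _ ↦ Finset.sum_congr rfl fun j _ ↦ ?_
    have hb := congr(G y $(h.second_bianchi hy v (e j) (e i) (e i)) (e j))
    have hs := h.covRiem_skew hy (e j) (e i) v (e i) (e j)
    rw [covRiem_swap (e i) v (e j)] at hb
    simp only [map_add, add_apply, map_zero, zero_apply, map_neg, neg_apply] at hb
    linarith
  rw [hsplit, Finset.sum_comm (f := fun i j ↦ G y (covRiem Γ y (e j) (e i) v (e j)) (e i))]
  ring

end IsLeviCivitaOn

/-- The Koszul formula expresses `Γ` by the first derivatives of the metric. -/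
theorem isLeviCivitaOn_of_fderiv_metric [FiniteDimensional ℝ E] (hU : IsOpen U)
    (hG : ContDiffOn ℝ ∞ G U) (hinner : ∀ y ∈ U, IsInnerProduct (G y))
    (hsymm : ∀ y ∈ U, ∀ u v, Γ y u v = Γ y v u)
    (hderiv : ∀ y ∈ U, ∀ u v w, fderiv ℝ G y u v w = G y (Γ y u v) w + G y v (Γ y u w)) :
    IsLeviCivitaOn U G Γ where
  isOpen := hU
  symm := hsymm
  contDiffOn_metric := hG
  isInnerProduct := hinner
  fderiv_metric := hderiv
  contDiffOn := by
    have hG' : ∀ a b c : E, ContDiffOn ℝ ∞ (fun z ↦ fderiv ℝ G z a b c) U := fun a b c ↦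
      (((hG.fderiv_of_isOpen hU le_rfl).clm_apply contDiffOn_const).clm_apply
        contDiffOn_const).clm_apply contDiffOn_const
    have hform : ∀ u v, ContDiffOn ℝ ∞ (fun z ↦ G z (Γ z u v)) U := fun u v ↦ by
      refine contDiffOn_clm_apply.2 fun w ↦ (contDiffOn_const (c := (1 / 2 : ℝ)).mul
        (((hG' u v w).add (hG' v u w)).sub (hG' w u v))).congr fun z hz ↦ ?_
      rw [hderiv z hz, hderiv z hz, hderiv z hz, hsymm z hz v u, hsymm z hz w u, hsymm z hz w v,
        (hinner z hz).symm u, (hinner z hz).symm v]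
      ring
    refine contDiffOn_clm_apply.2 fun u ↦ contDiffOn_clm_apply.2 fun v y hy ↦ ?_
    have hyU := hU.mem_nhds hy
    exact (contDiffAt_of_inner (hG.contDiffAt hyU) (hinner y hy)
      ((hform u v).contDiffAt hyU)).contDiffWithinAt

end LeviCivita

section Weyl

variable {E : Type*} [NormedAddCommGroup E] [NormedSpace ℝ E] {B : E →L[ℝ] E →L[ℝ] ℝ}

/-- The difference between the Weyl connection with `Dg = ω ⊗ g` and the Levi-Civita connection
of `g`, where `B` is the value of `g` at a point and `x` that of the dual field of `ω`. -/
def weylTensor (B : E →L[ℝ] E →L[ℝ] ℝ) (x : E) : E →L[ℝ] E →L[ℝ] E :=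
  (1 / 2 : ℝ) • (((ContinuousLinearMap.smulRightL ℝ E E).flip x).comp B
    - (B x).smulRight (ContinuousLinearMap.id ℝ E)
    - ((B x).smulRight (ContinuousLinearMap.id ℝ E)).flip)

theorem weylTensor_apply (x u v : E) :
    weylTensor B x u v = (1 / 2 : ℝ) • (B u v • x - B x u • v - B x v • u) := rfl

namespace IsInnerProduct

variable (hB : IsInnerProduct B)

include hB

theorem weylTensor_symm (x u v : E) : weylTensor B x u v = weylTensor B x v u := by
  rw [weylTensor_apply, weylTensor_apply, hB.symm u v, sub_right_comm]

theorem inner_weylTensor_add (x u v w : E) :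
    B (weylTensor B x u v) w + B v (weylTensor B x u w) = -(B x u * B v w) := by
  simp only [weylTensor_apply, map_sub, map_smul, sub_apply, smul_apply, smul_eq_mul]
  rw [hB.symm v x, hB.symm v u]
  ring

variable [FiniteDimensional ℝ E]

theorem trace_weylTensor (x u : E) : LinearMap.trace ℝ E (weylTensor B x u).toLinearMap =
    -(Module.finrank ℝ E / 2 * B x u) := by
  have hsplit : (weylTensor B x u).toLinearMap = (1 / 2 : ℝ) •
      ((B u).toLinearMap.smulRight x - B x u • LinearMap.id - (B x).toLinearMap.smulRight u) := rfl
  rw [hsplit]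
  simp only [map_smul, map_sub, LinearMap.trace_smulRight, LinearMap.trace_id, smul_eq_mul,
    ContinuousLinearMap.coe_coe, hB.symm u x]
  ring

theorem trace_weylTensor_comp (x v w : E) :
    LinearMap.trace ℝ E ((weylTensor B x v).toLinearMap ∘ₗ (weylTensor B x w).toLinearMap) =
      (Module.finrank ℝ E + 2) / 4 * (B x v * B x w) - 1 / 2 * B x x * B v w := by
  have hsplit : (weylTensor B x v).toLinearMap ∘ₗ (weylTensor B x w).toLinearMap = (1 / 2 : ℝ) •
      ((B w).toLinearMap.smulRight (weylTensor B x v x) - B x w • (weylTensor B x v).toLinearMap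
        - (B x).toLinearMap.smulRight (weylTensor B x v w)) := by
    ext z
    simp [weylTensor_apply x w]
  rw [hsplit]
  simp only [map_smul, map_sub, LinearMap.trace_smulRight, hB.trace_weylTensor, smul_eq_mul,
    ContinuousLinearMap.coe_coe]
  simp only [weylTensor_apply, map_sub, map_smul, smul_eq_mul]
  rw [hB.symm w x, hB.symm w v, hB.symm v x]
  ring

end IsInnerProduct

variable {U : Set E} {G : E → E →L[ℝ] E →L[ℝ] ℝ} {Γ Γ' : E → E →L[ℝ] E →L[ℝ] E} {Ξ : E → E}
  {y : E}

theorem eq_add_weylTensor (hG : IsInnerProduct (G y)) (hΓ : ∀ u v, Γ y u v = Γ y v u)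
    (hΓ' : ∀ u v, Γ' y u v = Γ' y v u)
    (hderiv : ∀ u v w, fderiv ℝ G y u v w = G y (Γ y u v) w + G y v (Γ y u w))
    (hderiv' : ∀ u v w, fderiv ℝ G y u v w = G y (Γ' y u v) w + G y v (Γ' y u w)
      + G y (Ξ y) u * G y v w) : Γ' y = Γ y + weylTensor (G y) (Ξ y) := by
  ext u v
  refine hG.ext fun w ↦ sub_eq_zero.1 <| eq_zero_of_symm_of_skew
    (S := fun u v w ↦ G y (Γ' y u v) w - G y ((Γ y + weylTensor (G y) (Ξ y)) u v) w)
    (fun u v w ↦ ?_) (fun u v w ↦ ?_) u v w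
  · simp only [add_apply, hΓ u v, hΓ' u v, hG.weylTensor_symm _ u v]
  · simp only [add_apply, map_add]
    linarith [hderiv u v w, hderiv' u v w, hG.inner_weylTensor_add (Ξ y) u v w,
      hG.symm v (Γ' y u w), hG.symm v (Γ y u w), hG.symm v (weylTensor (G y) (Ξ y) u w)]

namespace IsLeviCivitaOn

variable (h : IsLeviCivitaOn U G Γ) (hy : y ∈ U) (hΞ : DifferentiableAt ℝ Ξ y)

include h hy hΞ

theorem covField_weylTensor (u v w : E) :
    covField Γ (fun z ↦ weylTensor (G z) (Ξ z) v w) y u = weylTensor (G y) (covField Γ Ξ y u) v w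
      + weylTensor (G y) (Ξ y) (Γ y u v) w + weylTensor (G y) (Ξ y) v (Γ y u w) := by
  have hG := h.differentiableAt_metric hy
  have hinner : ∀ a, fderiv ℝ (fun z ↦ G z (Ξ z) a) y u
      = G y (covField Γ Ξ y u) a + G y (Ξ y) (Γ y u a) := fun a ↦ by
    rw [h.fderiv_inner hy hΞ (differentiableAt_const a), covField_const]
  rw [covField_apply (X := fun z ↦ weylTensor (G z) (Ξ z) v w)]
  simp only [weylTensor_apply]
  rw [fderiv_fun_const_smul (by fun_prop), fderiv_fun_sub (by fun_prop) (by fun_prop),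
    fderiv_fun_sub (by fun_prop) (by fun_prop), fderiv_fun_smul (by fun_prop) hΞ,
    fderiv_smul_const (by fun_prop), fderiv_smul_const (by fun_prop)]
  simp only [smul_apply, sub_apply, add_apply, ContinuousLinearMap.smulRight_apply, hinner,
    h.fderiv_inner hy (differentiableAt_const v) (differentiableAt_const w), covField_const,
    map_smul, map_sub]
  rw [covField_apply]
  module

theorem riem_weyl (hΓ' : DifferentiableAt ℝ Γ' y)
    (hW : Γ' =ᶠ[nhds y] fun z ↦ Γ z + weylTensor (G z) (Ξ z)) (u v w : E) :
    riem Γ' y u v w = riem Γ y u v w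
      + weylTensor (G y) (covField Γ Ξ y u) v w - weylTensor (G y) (covField Γ Ξ y v) u w
      + weylTensor (G y) (Ξ y) u (weylTensor (G y) (Ξ y) v w)
      - weylTensor (G y) (Ξ y) v (weylTensor (G y) (Ξ y) u w) := by
  have hΓ := h.differentiableAt hy
  have hcov : ∀ a b, covField Γ' (fun z ↦ Γ' z b w) y a
      = covField Γ (fun z ↦ Γ z b w) y a + covField Γ (fun z ↦ weylTensor (G z) (Ξ z) b w) y a
        + weylTensor (G y) (Ξ y) a (Γ y b w + weylTensor (G y) (Ξ y) b w) := fun a b ↦ by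
    have hfield : (fun z ↦ Γ' z b w) =ᶠ[nhds y] fun z ↦ Γ z b w + weylTensor (G z) (Ξ z) b w :=
      hW.mono fun z hz ↦ congr($hz b w)
    have hweyl : DifferentiableAt ℝ (fun z ↦ weylTensor (G z) (Ξ z) b w) y := by
      have hG := h.differentiableAt_metric hy
      simp only [weylTensor_apply]
      fun_prop
    rw [covField_congr hfield]
    simp only [covField_apply, hW.eq_of_nhds, add_apply, map_add]
    rw [fderiv_fun_add (by fun_prop) hweyl, add_apply]
    abel
  rw [riem_eq_covField_sub hΓ', riem_eq_covField_sub hΓ, hcov, hcov, h.covField_weylTensor hy hΞ,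
    h.covField_weylTensor hy hΞ, h.symm y hy v u, map_add, map_add]
  abel

theorem ric_weyl [FiniteDimensional ℝ E] (hΓ' : DifferentiableAt ℝ Γ' y)
    (hW : Γ' =ᶠ[nhds y] fun z ↦ Γ z + weylTensor (G z) (Ξ z)) (v w : E) :
    ric Γ' y v w = ric Γ y v w
      - 1 / 2 * (G y (covField Γ Ξ y v) w + G y (covField Γ Ξ y w) v)
      + 1 / 2 * G y v w * LinearMap.trace ℝ E (covField Γ Ξ y).toLinearMap
      + (Module.finrank ℝ E : ℝ) / 2 * G y (covField Γ Ξ y v) w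
      + ((Module.finrank ℝ E : ℝ) - 2) / 4
        * (G y (Ξ y) v * G y (Ξ y) w - G y (Ξ y) (Ξ y) * G y v w) := by
  have hG := h.isInnerProduct y hy
  set T := covField Γ Ξ y
  set W := weylTensor (G y) (Ξ y)
  have hsymm : ∀ u v, W u v = W v u := hG.weylTensor_symm (Ξ y)
  let D : E →ₗ[ℝ] E := (1 / 2 : ℝ) • (G y v w • T.toLinearMap
    - (((G y).flip v).comp T).toLinearMap.smulRight w
    - (((G y).flip w).comp T).toLinearMap.smulRight v)
  have hsplit : (((riem Γ' y).flip v).flip w).toLinearMap = (((riem Γ y).flip v).flip w).toLinearMap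
      + D - (weylTensor (G y) (T v) w).toLinearMap + (W (W v w)).toLinearMap
      - (W v).toLinearMap ∘ₗ (W w).toLinearMap := by
    ext u
    change riem Γ' y u v w = riem Γ y u v w + weylTensor (G y) (T u) v w
      - weylTensor (G y) (T v) w u + W (W v w) u - W v (W w u)
    rw [hG.weylTensor_symm _ w u, hsymm _ u, hsymm w u]
    exact h.riem_weyl hy hΞ hΓ' hW u v w
  have hD : LinearMap.trace ℝ E D = 1 / 2 * (G y v w * LinearMap.trace ℝ E T.toLinearMap
      - G y (T w) v - G y (T v) w) := by
    simp only [D, map_smul, map_sub, LinearMap.trace_smulRight, smul_eq_mul]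
    rfl
  rw [ric, ric, hsplit, map_sub, map_add, map_sub, map_add, hD, hG.trace_weylTensor,
    hG.trace_weylTensor, hG.trace_weylTensor_comp]
  simp only [W, weylTensor_apply, map_sub, map_smul, smul_eq_mul]
  ring

end IsLeviCivitaOn

end Weyl

section EinsteinWeyl

variable {E : Type*} [NormedAddCommGroup E] [NormedSpace ℝ E] {U : Set E}
  {G : E → E →L[ℝ] E →L[ℝ] ℝ} {Γ Γ' : E → E →L[ℝ] E →L[ℝ] E} {Ξ : E → E} {Λ : E → ℝ}

/-- An Einstein-Weyl structure in its Gauduchon gauge, in coordinates on the open set `U`: `Γ` and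
`Γ'` are the Levi-Civita connection of `G` and the Weyl connection, `Ξ` is the field dual to the
1-form of the structure, and `Λ` is the factor of the symmetrised Ricci tensor. -/
structure IsEinsteinWeylOn (U : Set E) (G : E → E →L[ℝ] E →L[ℝ] ℝ)
    (Γ Γ' : E → E →L[ℝ] E →L[ℝ] E) (Ξ : E → E) (Λ : E → ℝ) : Prop
    extends IsLeviCivitaOn U G Γ where
  contDiffOn_field : ContDiffOn ℝ ∞ Ξ U
  differentiableOn_weyl : DifferentiableOn ℝ Γ' U
  differentiableOn_factor : DifferentiableOn ℝ Λ U
  weyl_eq : ∀ y ∈ U, Γ' y = Γ y + weylTensor (G y) (Ξ y)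
  trace_eq_zero : ∀ y ∈ U, LinearMap.trace ℝ E (covField Γ Ξ y).toLinearMap = 0
  ric_add_ric : ∀ y ∈ U, ∀ v w, ric Γ' y v w + ric Γ' y w v = Λ y * G y v w

/-- The coefficient of the metric in the Ricci tensor of the Gauduchon metric of an Einstein-Weyl
structure. -/
def einsteinFactor (G : E → E →L[ℝ] E →L[ℝ] ℝ) (Ξ : E → E) (Λ : E → ℝ) (y : E) : ℝ :=
  1 / 2 * Λ y + ((Module.finrank ℝ E : ℝ) - 2) / 4 * G y (Ξ y) (Ξ y)

namespace IsEinsteinWeylOn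

variable (h : IsEinsteinWeylOn U G Γ Γ' Ξ Λ) {y : E} (hy : y ∈ U)

include h hy

theorem differentiableAt_field : DifferentiableAt ℝ Ξ y :=
  (h.contDiffOn_field.contDiffAt (h.isOpen.mem_nhds hy)).differentiableAt (by simp)

theorem differentiableAt_covField_field : DifferentiableAt ℝ (covField Γ Ξ) y :=
  differentiableAt_covField (h.differentiableAt hy)
    (h.contDiffOn_field.contDiffAt (h.isOpen.mem_nhds hy))

theorem differentiableAt_einsteinFactor : DifferentiableAt ℝ (einsteinFactor G Ξ Λ) y := by
  have hG := h.differentiableAt_metric hy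
  have hΞ := h.differentiableAt_field hy
  have hΛ := h.differentiableOn_factor.differentiableAt (h.isOpen.mem_nhds hy)
  unfold einsteinFactor
  fun_prop

variable [FiniteDimensional ℝ E]

theorem trace_covEnd_eq_zero (u : E) :
    LinearMap.trace ℝ E (covEnd Γ (covField Γ Ξ) y u).toLinearMap = 0 := by
  have htrace : (fun z ↦ LinearMap.trace ℝ E (covField Γ Ξ z).toLinearMap) =ᶠ[nhds y] fun _ ↦ 0 :=
    Filter.eventually_of_mem (h.isOpen.mem_nhds hy) h.trace_eq_zero
  rw [trace_covEnd (h.differentiableAt_covField_field hy), htrace.fderiv_eq, fderiv_fun_const,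
    Pi.zero_apply, zero_apply]

theorem ric_eq (v w : E) :
    ric Γ y v w = einsteinFactor G Ξ Λ y * G y v w - ((Module.finrank ℝ E : ℝ) - 2) / 4
      * (G y (covField Γ Ξ y v) w + G y (covField Γ Ξ y w) v + G y (Ξ y) v * G y (Ξ y) w) := by
  have hW : Γ' =ᶠ[nhds y] fun z ↦ Γ z + weylTensor (G z) (Ξ z) :=
    Filter.eventually_of_mem (h.isOpen.mem_nhds hy) h.weyl_eq
  have hΓ' := h.differentiableOn_weyl.differentiableAt (h.isOpen.mem_nhds hy)
  have hsum := h.ric_add_ric y hy v w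
  rw [h.ric_weyl hy (h.differentiableAt_field hy) hΓ' hW,
    h.ric_weyl hy (h.differentiableAt_field hy) hΓ' hW, h.trace_eq_zero y hy, h.ric_symm hy w v,
    h.metric_symm hy w v] at hsum
  rw [einsteinFactor]
  linarith

theorem covRic_eq (u v w : E) :
    covRic Γ y u v w = fderiv ℝ (einsteinFactor G Ξ Λ) y u * G y v w
      - ((Module.finrank ℝ E : ℝ) - 2) / 4 * (G y (covEnd Γ (covField Γ Ξ) y u v) w
        + G y (covEnd Γ (covField Γ Ξ) y u w) v
        + G y (covField Γ Ξ y u) v * G y (Ξ y) w + G y (Ξ y) v * G y (covField Γ Ξ y u) w) := by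
  have hG := h.differentiableAt_metric hy
  have hΞ := h.differentiableAt_field hy
  have hT := h.differentiableAt_covField_field hy
  have hL := h.differentiableAt_einsteinFactor hy
  have hric : (fun z ↦ ric Γ z v w) =ᶠ[nhds y] fun z ↦ einsteinFactor G Ξ Λ z * G z v w
      - ((Module.finrank ℝ E : ℝ) - 2) / 4
        * (G z (covField Γ Ξ z v) w + G z (covField Γ Ξ z w) v + G z (Ξ z) v * G z (Ξ z) w) :=
    Filter.eventually_of_mem (h.isOpen.mem_nhds hy) fun z hz ↦ h.ric_eq hz v w
  have hmetric : fderiv ℝ (fun z ↦ G z v w) y u = G y (Γ y u v) w + G y v (Γ y u w) := by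
    rw [h.fderiv_inner hy (differentiableAt_const v) (differentiableAt_const w), covField_const,
      covField_const]
  have hfield : ∀ a, fderiv ℝ (fun z ↦ G z (Ξ z) a) y u
      = G y (covField Γ Ξ y u) a + G y (Ξ y) (Γ y u a) := fun a ↦ by
    rw [h.fderiv_inner hy hΞ (differentiableAt_const a), covField_const]
  have hcov : ∀ a b, fderiv ℝ (fun z ↦ G z (covField Γ Ξ z a) b) y u
      = G y (covEnd Γ (covField Γ Ξ) y u a) b + G y (covField Γ Ξ y (Γ y u a)) b
        + G y (covField Γ Ξ y a) (Γ y u b) := fun a b ↦ by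
    rw [h.fderiv_inner hy (by fun_prop) (differentiableAt_const b), covField_const,
      covField_apply_field hT (differentiableAt_const a), covField_const, map_add, add_apply]
  rw [covRic, hric.fderiv_eq, fderiv_fun_sub (by fun_prop) (by fun_prop),
    fderiv_fun_mul hL (by fun_prop), fderiv_const_mul (by fun_prop),
    fderiv_fun_add (by fun_prop) (by fun_prop), fderiv_fun_add (by fun_prop) (by fun_prop),
    fderiv_fun_mul (by fun_prop) (by fun_prop), h.ric_eq hy, h.ric_eq hy]
  simp only [add_apply, sub_apply, smul_apply, smul_eq_mul, hmetric, hfield, hcov]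
  ring

variable {ι : Type*} [Fintype ι] [DecidableEq ι] {e : Module.Basis ι ℝ E}

/-- The Einstein-Weyl form of the contracted second Bianchi identity, paired with `Ξ`. -/
theorem sum_covEnd_field (he : IsOrthonormal (G y) e) (hn : 2 < Module.finrank ℝ E) :
    ∑ i, G y (covEnd Γ (covField Γ Ξ) y (e i) (Ξ y)) (e i)
      + ∑ i, G y (covEnd Γ (covField Γ Ξ) y (e i) (e i)) (Ξ y)
      = -2 * fderiv ℝ (einsteinFactor G Ξ Λ) y (Ξ y) := by
  have htrace : ∑ i, G y (covField Γ Ξ y (e i)) (e i) = 0 := by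
    rw [← h.trace_eq_zero y hy, he.trace_eq]; rfl
  have htrace' : ∑ i, G y (covEnd Γ (covField Γ Ξ) y (Ξ y) (e i)) (e i) = 0 := by
    rw [← h.trace_covEnd_eq_zero hy (Ξ y), he.trace_eq]; rfl
  have hflip : ∑ i, G y (covField Γ Ξ y (e i)) (Ξ y) * G y (Ξ y) (e i)
      = G y (covField Γ Ξ y (Ξ y)) (Ξ y) :=
    he.sum_mul (((G y).flip (Ξ y)).comp (covField Γ Ξ y)) (Ξ y)
  have hbianchi := h.contracted_bianchi hy he (Ξ y)
  simp only [h.covRic_eq hy, Finset.sum_add_distrib, Finset.sum_sub_distrib, ← Finset.mul_sum,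
    he.sum_mul, htrace, htrace', hflip, he.sum_inner_self,
    mul_comm (G y (Ξ y) _) (G y (covField Γ Ξ y (Ξ y)) _)] at hbianchi
  have hn' : ((Module.finrank ℝ E : ℝ) - 2) / 4 ≠ 0 := by
    have : (2 : ℝ) < Module.finrank ℝ E := by exact_mod_cast hn
    linarith
  apply mul_left_cancel₀ hn'
  linarith

variable {W : E → E} (hW : DifferentiableAt ℝ W y)
  (hW' : ∀ z ∈ U, ∀ u, G z (W z) u = 1 / 2 * (G z (covField Γ Ξ z (Ξ z)) u
    + G z (covField Γ Ξ z u) (Ξ z)) + einsteinFactor G Ξ Λ z * G z (Ξ z) u)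

include hW hW'

omit [FiniteDimensional ℝ E] in
theorem inner_covField_potential (v u : E) :
    G y (covField Γ W y v) u = 1 / 2 * (G y (covEnd Γ (covField Γ Ξ) y v (Ξ y)) u
      + G y (covField Γ Ξ y (covField Γ Ξ y v)) u + G y (covEnd Γ (covField Γ Ξ) y v u) (Ξ y)
      + G y (covField Γ Ξ y u) (covField Γ Ξ y v))
      + fderiv ℝ (einsteinFactor G Ξ Λ) y v * G y (Ξ y) u
      + einsteinFactor G Ξ Λ y * G y (covField Γ Ξ y v) u := by
  have hG := h.differentiableAt_metric hy
  have hΞ := h.differentiableAt_field hy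
  have hT := h.differentiableAt_covField_field hy
  have hL := h.differentiableAt_einsteinFactor hy
  have hderiv : (fun z ↦ G z (W z) u) =ᶠ[nhds y] fun z ↦ 1 / 2 * (G z (covField Γ Ξ z (Ξ z)) u
      + G z (covField Γ Ξ z u) (Ξ z)) + einsteinFactor G Ξ Λ z * G z (Ξ z) u :=
    Filter.eventually_of_mem (h.isOpen.mem_nhds hy) fun z hz ↦ hW' z hz u
  have hinner := h.fderiv_inner hy hW (differentiableAt_const u) v
  rw [hderiv.fderiv_eq, fderiv_fun_add (by fun_prop) (by fun_prop), fderiv_const_mul (by fun_prop),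
    fderiv_fun_add (by fun_prop) (by fun_prop), fderiv_fun_mul hL (by fun_prop)] at hinner
  simp only [add_apply, smul_apply, smul_eq_mul] at hinner
  rw [h.fderiv_inner hy (by fun_prop) (differentiableAt_const u),
    h.fderiv_inner hy (by fun_prop) hΞ,
    h.fderiv_inner hy hΞ (differentiableAt_const u), covField_apply_field hT hΞ,
    covField_apply_field hT (differentiableAt_const u), covField_const, hW' y hy] at hinner
  simp only [map_add, add_apply] at hinner
  linarith

/-- Integrated over a compact manifold, this shows that the dual field of the Gauduchon metric is a
Killing field. -/
theorem trace_covField_potential (he : IsOrthonormal (G y) e) (hn : 2 < Module.finrank ℝ E) :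
    LinearMap.trace ℝ E (covField Γ W y).toLinearMap = 1 / 4 * ∑ i, ∑ j,
      (G y (covField Γ Ξ y (e i)) (e j) + G y (covField Γ Ξ y (e j)) (e i)) ^ 2 := by
  have htrace : ∑ i, G y (covField Γ Ξ y (e i)) (e i) = 0 := by
    rw [← h.trace_eq_zero y hy, he.trace_eq]; rfl
  rw [he.trace_eq, he.sum_sum_add_sq]
  simp only [ContinuousLinearMap.coe_coe, h.inner_covField_potential hy hW hW',
    Finset.sum_add_distrib, ← Finset.mul_sum, htrace, he.sum_mul]
  linarith [h.sum_covEnd_field hy he hn]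

end IsEinsteinWeylOn

end EinsteinWeyl

section Kaehler

variable {E : Type*} [NormedAddCommGroup E] [NormedSpace ℝ E] {U : Set E}
  {H : E → E →L[ℝ] E →L[ℝ] ℝ} {Γ : E → E →L[ℝ] E →L[ℝ] E} {J : E →L[ℝ] E} {Ξ : E → E} {l : E → ℝ}
  {y : E}

/-- `H` is a Kähler metric with Levi-Civita connection `Γ` on the open set `U`, in coordinates in
which the complex structure is the constant endomorphism `J`. -/
structure IsKaehlerOn (U : Set E) (H : E → E →L[ℝ] E →L[ℝ] ℝ) (Γ : E → E →L[ℝ] E →L[ℝ] E)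
    (J : E →L[ℝ] E) : Prop extends IsLeviCivitaOn U H Γ where
  complex : ∀ y ∈ U, IsOrthogonalComplex (H y) J
  parallel : ∀ y ∈ U, ∀ u v, Γ y u (J v) = J (Γ y u v)

theorem differentiableAt_complexDefect {A : E → E →L[ℝ] E} (hA : DifferentiableAt ℝ A y) :
    DifferentiableAt ℝ (fun z ↦ complexDefect J (A z)) y := by
  unfold complexDefect
  fun_prop

namespace IsKaehlerOn

variable (h : IsKaehlerOn U H Γ J) (hy : y ∈ U)

include h hy

theorem riem_complex (u v w : E) : riem Γ y u v (J w) = J (riem Γ y u v w) := by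
  have hΓ := h.differentiableAt hy
  have hderiv : ∀ a b, fderiv ℝ Γ y a b (J w) = J (fderiv ℝ Γ y a b w) := fun a b ↦ by
    have hlocal : (fun z ↦ Γ z b (J w)) =ᶠ[nhds y] fun z ↦ J (Γ z b w) :=
      Filter.eventually_of_mem (h.isOpen.mem_nhds hy) fun z hz ↦ h.parallel z hz b w
    have hcongr := congr($(hlocal.fderiv_eq (𝕜 := ℝ)) a)
    rw [fderiv_fun_comp y J.differentiableAt (by fun_prop)] at hcongr
    simpa [fderiv_apply_const, hΓ, DifferentiableAt.clm_apply] using hcongr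
  simp only [riem_apply, hderiv, h.parallel y hy, map_add, map_sub]

/-- The 2-form dual to `∇ (J Ξ)` is the exterior derivative of the form dual to `J Ξ`, hence
closed. -/
theorem cyclic_inner_complex_covEnd (hΞ : ContDiffAt ℝ ∞ Ξ y) (u v w : E) :
    (H y (J (covEnd Γ (covField Γ Ξ) y u v)) w - H y (J (covEnd Γ (covField Γ Ξ) y u w)) v)
      + (H y (J (covEnd Γ (covField Γ Ξ) y v w)) u - H y (J (covEnd Γ (covField Γ Ξ) y v u)) w)
      + (H y (J (covEnd Γ (covField Γ Ξ) y w u)) v - H y (J (covEnd Γ (covField Γ Ξ) y w v)) u)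
      = 0 := by
  have hricci : ∀ a b c, H y (J (covEnd Γ (covField Γ Ξ) y a b)) c
      - H y (J (covEnd Γ (covField Γ Ξ) y b a)) c = -H y (riem Γ y a b c) (J (Ξ y)) :=
    fun a b c ↦ by
      have hskew := h.riem_skew hy a b (J (Ξ y)) c
      rw [h.riem_complex hy, ← h.covEnd_covField_sub hy hΞ, map_sub, map_sub, sub_apply] at hskew
      linarith
  have hbianchi := congr(H y $(h.first_bianchi hy u v w) (J (Ξ y)))
  simp only [map_add, map_zero, add_apply, zero_apply] at hbianchi
  linarith [hricci u v w, hricci v w u, hricci w u v]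

theorem covEnd_complexDefect {A : E → E →L[ℝ] E} (hA : DifferentiableAt ℝ A y) (u : E) :
    covEnd Γ (fun z ↦ complexDefect J (A z)) y u = complexDefect J (covEnd Γ A y u) := by
  have hderiv : ∀ v, fderiv ℝ (fun z ↦ complexDefect J (A z)) y u v
      = complexDefect J (fderiv ℝ A y u) v := fun v ↦ by
    rw [← fderiv_apply_const (differentiableAt_complexDefect hA)]
    simp only [complexDefect_apply]
    rw [fderiv_fun_add (by fun_prop) (by fun_prop), add_apply,
      fderiv_fun_comp y J.differentiableAt (by fun_prop), J.fderiv,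
      ContinuousLinearMap.comp_apply, fderiv_apply_const hA, fderiv_apply_const hA]
  ext v
  simp only [covEnd_apply, hderiv, complexDefect_apply, map_add, map_sub, h.parallel y hy]
  abel

end IsKaehlerOn

/-- A vector field `Ξ` on the Kähler manifold of `IsKaehlerOn` with `L_Ξ H = 2 l H`. -/
structure IsConformalFieldOn (U : Set E) (H : E → E →L[ℝ] E →L[ℝ] ℝ)
    (Γ : E → E →L[ℝ] E →L[ℝ] E) (J : E →L[ℝ] E) (Ξ : E → E) (l : E → ℝ) : Prop
    extends IsKaehlerOn U H Γ J where
  contDiffOn_field : ContDiffOn ℝ ∞ Ξ U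
  differentiableOn_factor : DifferentiableOn ℝ l U
  conformal : ∀ y ∈ U, ∀ u v,
    H y (covField Γ Ξ y u) v + H y (covField Γ Ξ y v) u = 2 * l y * H y u v

namespace IsConformalFieldOn

variable (h : IsConformalFieldOn U H Γ J Ξ l) (hy : y ∈ U)

include h hy

theorem contDiffAt_field : ContDiffAt ℝ ∞ Ξ y :=
  h.contDiffOn_field.contDiffAt (h.isOpen.mem_nhds hy)

theorem differentiableAt_factor : DifferentiableAt ℝ l y :=
  h.differentiableOn_factor.differentiableAt (h.isOpen.mem_nhds hy)

theorem differentiableAt_covField_field : DifferentiableAt ℝ (covField Γ Ξ) y :=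
  differentiableAt_covField (h.differentiableAt hy) (h.contDiffAt_field hy)

theorem conformal_covEnd (u v w : E) :
    H y (covEnd Γ (covField Γ Ξ) y u v) w + H y (covEnd Γ (covField Γ Ξ) y u w) v
      = 2 * fderiv ℝ l y u * H y v w := by
  have hl := h.differentiableAt_factor hy
  rw [h.covEnd_add_covEnd hy (h.differentiableAt_covField_field hy) (hl.const_mul 2) h.conformal,
    fderiv_const_mul hl]
  rfl

variable {ι : Type*} [Fintype ι] [DecidableEq ι] {e : Module.Basis ι ℝ E}
  (he : IsOrthonormal (H y) e)

include he

theorem sum_complexDefect_covEnd :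
    ∑ i, H y (complexDefect J (covEnd Γ (covField Γ Ξ) y (e i)) (e i)) (Ξ y)
      = -(((Module.finrank ℝ E : ℝ) - 2) * fderiv ℝ l y (Ξ y)) := by
  have hJ := h.complex y hy
  set T' := covEnd Γ (covField Γ Ξ) y
  have hconf : ∀ u v w, H y (T' u v) w + H y (T' u w) v = 2 * fderiv ℝ l y u * H y v w :=
    h.conformal_covEnd hy
  let F : E →L[ℝ] E →L[ℝ] ℝ := (H y).comp (J.comp (T'.flip (Ξ y)))
    - (ContinuousLinearMap.compL ℝ E E ℝ (((H y).flip (Ξ y)).comp J)).comp T'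
  have hswap : ∑ i, F (J (e i)) (e i) = -∑ i, F (e i) (J (e i)) :=
    hJ.sum_apply (h.isInnerProduct y hy) he F
  have hcyc : ∀ i, (H y (J (T' (Ξ y) (e i))) (J (e i)) - H y (J (T' (Ξ y) (J (e i)))) (e i))
      - F (e i) (J (e i)) + F (J (e i)) (e i) = 0 := fun i ↦ by
    have := h.cyclic_inner_complex_covEnd hy (h.contDiffAt_field hy) (Ξ y) (e i) (J (e i))
    change _ - (H y (J (T' (e i) (Ξ y))) (J (e i)) - H y (J (T' (e i) (J (e i)))) (Ξ y))
      + (H y (J (T' (J (e i)) (Ξ y))) (e i) - H y (J (T' (J (e i)) (e i))) (Ξ y)) = 0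
    linarith
  have htrace : ∀ i, H y (J (T' (Ξ y) (e i))) (J (e i)) - H y (J (T' (Ξ y) (J (e i)))) (e i)
      = 2 * fderiv ℝ l y (Ξ y) * H y (e i) (e i) := fun i ↦ by
    have hconfJ := hconf (Ξ y) (J (e i)) (J (e i))
    rw [hJ.inner] at hconfJ
    rw [hJ.inner, hJ.skew]
    linarith [hconf (Ξ y) (e i) (e i)]
  have hF : ∀ i, F (e i) (J (e i)) = 2 * (fderiv ℝ l y (e i) * H y (Ξ y) (e i))
      - H y (complexDefect J (T' (e i)) (e i)) (Ξ y) := fun i ↦ by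
    change H y (J (T' (e i) (Ξ y))) (J (e i)) - H y (J (T' (e i) (J (e i)))) (Ξ y) = _
    rw [hJ.inner, complexDefect_apply, map_add, add_apply]
    linarith [hconf (e i) (Ξ y) (e i)]
  have hsum := Finset.sum_eq_zero fun i (_ : i ∈ Finset.univ) ↦ hcyc i
  rw [Finset.sum_add_distrib, Finset.sum_sub_distrib, hswap] at hsum
  simp only [htrace, hF, Finset.sum_sub_distrib, ← Finset.mul_sum, he.sum_mul,
    he.sum_inner_self] at hsum
  linarith

variable {W : E → E} (hW : ∀ z ∈ U, W z = (((Module.finrank ℝ E : ℝ) - 2) * l z) • Ξ z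
  - complexDefect J (covField Γ Ξ z) (Ξ z))

include hW

omit he [Fintype ι] [DecidableEq ι] in
theorem covField_potential (u : E) :
    covField Γ W y u = (((Module.finrank ℝ E : ℝ) - 2) * fderiv ℝ l y u) • Ξ y
      + (((Module.finrank ℝ E : ℝ) - 2) * l y) • covField Γ Ξ y u
      - (complexDefect J (covEnd Γ (covField Γ Ξ) y u) (Ξ y)
        + complexDefect J (covField Γ Ξ y) (covField Γ Ξ y u)) := by
  have hΞ := (h.contDiffAt_field hy).differentiableAt (by simp)
  have hT := h.differentiableAt_covField_field hy
  have hl := h.differentiableAt_factor hy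
  have hP : DifferentiableAt ℝ (fun z ↦ complexDefect J (covField Γ Ξ z)) y :=
    differentiableAt_complexDefect hT
  have hdefect := covField_apply_field (Γ := Γ) hP hΞ u
  rw [h.covEnd_complexDefect hy hT] at hdefect
  rw [covField_congr (Filter.eventually_of_mem (h.isOpen.mem_nhds hy) hW), ← hdefect]
  simp only [covField_apply]
  rw [fderiv_fun_sub (by fun_prop) (by fun_prop), fderiv_fun_smul (by fun_prop) hΞ,
    fderiv_const_mul hl]
  simp only [sub_apply, add_apply, smul_apply, ContinuousLinearMap.smulRight_apply, smul_eq_mul,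
    map_sub, map_smul]
  module

/-- Integrated over a compact manifold, this shows that in dimension greater than two a conformal
field of a Kähler metric is Killing and holomorphic. -/
theorem trace_covField_potential :
    LinearMap.trace ℝ E (covField Γ W y).toLinearMap =
      (Module.finrank ℝ E : ℝ) * ((Module.finrank ℝ E : ℝ) - 2) * l y ^ 2
      + 1 / 2 * ∑ i, H y (complexDefect J (covField Γ Ξ y) (e i))
        (complexDefect J (covField Γ Ξ y) (e i)) := by
  have hJ := h.complex y hy
  have htrace : ∑ i, H y (covField Γ Ξ y (e i)) (e i) = Module.finrank ℝ E * l y := by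
    rw [← he.sum_inner_self, Finset.sum_mul]
    exact Finset.sum_congr rfl fun i _ ↦ by linarith [h.conformal y hy (e i) (e i)]
  have hcov : ∀ i, H y (complexDefect J (covEnd Γ (covField Γ Ξ) y (e i)) (Ξ y)) (e i)
      = -H y (complexDefect J (covEnd Γ (covField Γ Ξ) y (e i)) (e i)) (Ξ y) := fun i ↦
    hJ.complexDefect_skew (h.conformal_covEnd hy (e i)) _ _
  have hsq : ∀ i, H y (complexDefect J (covField Γ Ξ y) (covField Γ Ξ y (e i))) (e i)
      = -H y (covField Γ Ξ y (e i)) (complexDefect J (covField Γ Ξ y) (e i)) := fun i ↦ by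
    rw [hJ.complexDefect_skew (h.conformal y hy), h.metric_symm hy]
  rw [he.trace_eq, hJ.sum_inner_complexDefect (h.isInnerProduct y hy) he]
  simp only [ContinuousLinearMap.coe_coe, h.covField_potential hy hW, map_sub, map_add, map_smul,
    sub_apply, add_apply, smul_apply, smul_eq_mul, hcov, hsq, Finset.sum_sub_distrib,
    Finset.sum_add_distrib, Finset.sum_neg_distrib, h.sum_complexDefect_covEnd hy he, mul_assoc,
    ← Finset.mul_sum, he.sum_mul, htrace]
  ring

end IsConformalFieldOn

end Kaehler

section LieDerivative

variable {E : Type*} [NormedAddCommGroup E] [NormedSpace ℝ E] {U : Set E}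
  {G : E → E →L[ℝ] E →L[ℝ] ℝ} {Γ : E → E →L[ℝ] E →L[ℝ] E} {Ξ : E → E} {y : E}

namespace IsLeviCivitaOn

variable (h : IsLeviCivitaOn U G Γ) (hy : y ∈ U)

include h hy

theorem inner_covField_add_inner_covField (u v : E) :
    G y (covField Γ Ξ y u) v + G y (covField Γ Ξ y v) u =
      fderiv ℝ G y (Ξ y) u v + G y (fderiv ℝ Ξ y u) v + G y u (fderiv ℝ Ξ y v) := by
  rw [h.fderiv_metric y hy, covField_apply, covField_apply, h.metric_symm hy _ u,
    h.symm y hy (Ξ y) u, h.symm y hy (Ξ y) v]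
  simp only [map_add, add_apply]
  ring

theorem inner_covField_sub_inner_covField (hΞ : DifferentiableAt ℝ Ξ y) (u v : E) :
    G y (covField Γ Ξ y u) v - G y (covField Γ Ξ y v) u =
      fderiv ℝ (fun z ↦ G z (Ξ z) v) y u - fderiv ℝ (fun z ↦ G z (Ξ z) u) y v := by
  rw [h.fderiv_inner hy hΞ (differentiableAt_const v),
    h.fderiv_inner hy hΞ (differentiableAt_const u), covField_const, covField_const,
    h.symm y hy v u]
  ring

end IsLeviCivitaOn

end LieDerivative

section Density

theorem hasDerivAt_det_one_add_smul {n : Type*} [Fintype n] [DecidableEq n] (P : Matrix n n ℝ) :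
    HasDerivAt (fun t : ℝ ↦ (1 + t • P).det) P.trace 0 := by
  have h := Polynomial.hasDerivAt
    (Matrix.det (1 + (Polynomial.X : Polynomial ℝ) • P.map Polynomial.C)) 0
  rw [Matrix.derivative_det_one_add_X_smul] at h
  simpa [eval_det, ← Matrix.smul_eq_mul_diagonal] using h

variable {E : Type*} [NormedAddCommGroup E] [NormedSpace ℝ E] [FiniteDimensional ℝ E]

theorem hasDerivAt_det_id_add_smul (A : E →ₗ[ℝ] E) :
    HasDerivAt (fun t : ℝ ↦ LinearMap.det (LinearMap.id + t • A)) (LinearMap.trace ℝ E A) 0 := by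
  let b := Module.finBasis ℝ E
  rw [LinearMap.trace_eq_matrix_trace ℝ b]
  refine (hasDerivAt_det_one_add_smul _).congr_of_eventuallyEq (.of_forall fun t ↦ ?_)
  simp only [← LinearMap.det_toMatrix b, map_add, map_smul, LinearMap.toMatrix_id]

/-- The Gram determinant of a bilinear form in the fixed basis `Module.finBasis ℝ E` of `E`; it is
the square of the Riemannian volume density. -/
def gramDet (B : E →L[ℝ] E →L[ℝ] ℝ) : ℝ :=
  (Matrix.of fun i j ↦ B (Module.finBasis ℝ E i) (Module.finBasis ℝ E j)).det

theorem gramDet_comp (B : E →L[ℝ] E →L[ℝ] ℝ) (A : E →L[ℝ] E) :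
    gramDet (B.bilinearComp A A) = LinearMap.det A.toLinearMap ^ 2 * gramDet B := by
  set b := Module.finBasis ℝ E
  set P := LinearMap.toMatrix b b A.toLinearMap with hP
  have hA : ∀ i, A (b i) = ∑ k, P k i • b k := fun i ↦ by
    simp only [hP, LinearMap.toMatrix_apply]
    exact (b.sum_repr _).symm
  have hgram : (Matrix.of fun i j ↦ B.bilinearComp A A (b i) (b j))
      = P.transpose * (Matrix.of fun i j ↦ B (b i) (b j)) * P := by
    ext i j
    simp only [Matrix.of_apply, ContinuousLinearMap.bilinearComp_apply, hA, map_sum, map_smul,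
      sum_apply, smul_apply, smul_eq_mul, Matrix.mul_apply, Matrix.transpose_apply,
      Finset.mul_sum, Finset.sum_mul]
    exact Finset.sum_congr rfl fun k _ ↦ Finset.sum_congr rfl fun l _ ↦ by ring
  rw [gramDet, hgram, Matrix.det_mul, Matrix.det_mul, Matrix.det_transpose, hP,
    LinearMap.det_toMatrix, gramDet]
  ring

theorem IsInnerProduct.gramDet_pos {B : E →L[ℝ] E →L[ℝ] ℝ} (hB : IsInnerProduct B) :
    0 < gramDet B := by
  obtain ⟨e, he⟩ := hB.exists_isOrthonormal
  let A : E →L[ℝ] E := LinearMap.toContinuousLinearMap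
    ((Module.finBasis ℝ E).equiv e (Equiv.refl _)).toLinearMap
  have hA : ∀ i, A (Module.finBasis ℝ E i) = e i := fun i ↦ by simp [A]
  have hone : gramDet (B.bilinearComp A A) = 1 := by
    rw [gramDet]
    convert Matrix.det_one (n := Fin (Module.finrank ℝ E)) (R := ℝ) using 2
    ext i j
    rw [Matrix.of_apply, ContinuousLinearMap.bilinearComp_apply, hA, hA, he i j, Matrix.one_apply]
  refine pos_of_mul_pos_right (a := LinearMap.det A.toLinearMap ^ 2) ?_ (sq_nonneg _)
  rw [← gramDet_comp, hone]
  exact one_pos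

theorem contDiff_gramDet : ContDiff ℝ ∞ (gramDet (E := E)) := by
  unfold gramDet
  simp only [Matrix.det_apply, Matrix.of_apply]
  fun_prop

/-- The curve `t ↦ B ((1 + t A) ·, (1 + t A) ·)` has velocity `B (A ·, ·) + B (·, A ·)`, and
`gramDet` is `det (1 + t A) ^ 2 * gramDet B` along it. -/
theorem fderiv_gramDet (B : E →L[ℝ] E →L[ℝ] ℝ) (A : E →L[ℝ] E) :
    fderiv ℝ gramDet B (B.bilinearComp A (.id ℝ E) + B.bilinearComp (.id ℝ E) A)
      = 2 * LinearMap.trace ℝ E A.toLinearMap * gramDet B := by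
  set C := B.bilinearComp A (.id ℝ E) + B.bilinearComp (.id ℝ E) A with hC
  let c : ℝ → E →L[ℝ] E →L[ℝ] ℝ := fun t ↦ B + t • C + t ^ 2 • B.bilinearComp A A
  have hc : HasDerivAt c C 0 := by
    simpa using (((hasDerivAt_id (0 : ℝ)).smul_const C).const_add B).fun_add
      ((hasDerivAt_pow 2 (0 : ℝ)).smul_const (B.bilinearComp A A))
  have hfderiv : HasDerivAt (fun t ↦ gramDet (c t)) (fderiv ℝ gramDet B C) 0 := by
    have hB : HasFDerivAt gramDet (fderiv ℝ gramDet B) (c 0) := by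
      simpa [c] using (contDiff_gramDet.contDiffAt.differentiableAt (by simp)).hasFDerivAt
    exact hB.comp_hasDerivAt 0 hc
  have hgram (t : ℝ) :
      gramDet (c t) = LinearMap.det (LinearMap.id + t • A.toLinearMap) ^ 2 * gramDet B := by
    have hct : c t = B.bilinearComp (.id ℝ E + t • A) (.id ℝ E + t • A) := by
      ext u v
      simp only [c, hC, add_apply, smul_apply, ContinuousLinearMap.bilinearComp_apply,
        ContinuousLinearMap.id_apply, map_add, map_smul, smul_eq_mul]
      ring
    rw [hct, gramDet_comp]
    rfl
  have hdet := ((hasDerivAt_det_id_add_smul A.toLinearMap).fun_pow 2).mul_const (gramDet B)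
  rw [← funext hgram] at hdet
  simpa using hfderiv.unique hdet

/-- The density of the Riemannian volume with respect to Lebesgue measure, up to a constant factor
depending on `Module.finBasis ℝ E`. -/
def density (B : E →L[ℝ] E →L[ℝ] ℝ) : ℝ := Real.sqrt (gramDet B)

theorem density_comp (B : E →L[ℝ] E →L[ℝ] ℝ) (A : E →L[ℝ] E) :
    density (B.bilinearComp A A) = |A.det| * density B := by
  rw [density, gramDet_comp, Real.sqrt_mul (sq_nonneg _), Real.sqrt_sq_eq_abs]
  rfl

theorem IsInnerProduct.density_pos {B : E →L[ℝ] E →L[ℝ] ℝ} (hB : IsInnerProduct B) :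
    0 < density B :=
  Real.sqrt_pos.2 hB.gramDet_pos

theorem contDiffOn_density {U : Set E} {G : E → E →L[ℝ] E →L[ℝ] ℝ} (hG : ContDiffOn ℝ ∞ G U)
    (hinner : ∀ y ∈ U, IsInnerProduct (G y)) : ContDiffOn ℝ ∞ (fun y ↦ density (G y)) U :=
  (contDiff_gramDet.comp_contDiffOn hG).sqrt fun y hy ↦ (hinner y hy).gramDet_pos.ne'

omit [FiniteDimensional ℝ E] in
theorem IsTorsionFreeOn.trace_covField {U : Set E} {Γ : E → E →L[ℝ] E →L[ℝ] E}
    (h : IsTorsionFreeOn U Γ) {y : E} (hy : y ∈ U) (W : E → E) :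
    LinearMap.trace ℝ E (covField Γ W y).toLinearMap
      = LinearMap.trace ℝ E (fderiv ℝ W y).toLinearMap
        + LinearMap.trace ℝ E (Γ y (W y)).toLinearMap := by
  rw [← map_add]
  congr 1
  ext v
  exact congrArg (fderiv ℝ W y v + ·) (h.symm y hy v (W y))

namespace IsLeviCivitaOn

variable {U : Set E} {G : E → E →L[ℝ] E →L[ℝ] ℝ} {Γ : E → E →L[ℝ] E →L[ℝ] E} {y : E}
  (h : IsLeviCivitaOn U G Γ)

include h

theorem fderiv_density (hy : y ∈ U) (u : E) :
    fderiv ℝ (fun z ↦ density (G z)) y u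
      = LinearMap.trace ℝ E (Γ y u).toLinearMap * density (G y) := by
  have dG := h.differentiableAt_metric hy
  have pos := (h.isInnerProduct y hy).gramDet_pos
  have dg : DifferentiableAt ℝ gramDet (G y) :=
    contDiff_gramDet.contDiffAt.differentiableAt (by simp)
  have hG : fderiv ℝ G y u
      = (G y).bilinearComp (Γ y u) (.id ℝ E) + (G y).bilinearComp (.id ℝ E) (Γ y u) := by
    ext v w
    exact h.fderiv_metric y hy u v w
  have hgram : fderiv ℝ (fun z ↦ gramDet (G z)) y u
      = 2 * LinearMap.trace ℝ E (Γ y u).toLinearMap * gramDet (G y) := by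
    rw [fderiv_fun_comp y dg dG, ContinuousLinearMap.comp_apply, hG, fderiv_gramDet]
  have hsqrt : fderiv ℝ (fun z ↦ density (G z)) y = _ := fderiv_sqrt (dg.comp y dG) pos.ne'
  have hne := (Real.sqrt_pos.2 pos).ne'
  rw [hsqrt, smul_apply, smul_eq_mul, hgram, density]
  field_simp
  rw [Real.sq_sqrt pos.le, mul_comm]

theorem trace_fderiv_density_smul (hy : y ∈ U) {r : E → ℝ} {W : E → E}
    (hr : DifferentiableAt ℝ r y) (hW : DifferentiableAt ℝ W y) :
    LinearMap.trace ℝ E (fderiv ℝ (fun z ↦ (density (G z) * r z) • W z) y).toLinearMap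
      = (r y * LinearMap.trace ℝ E (covField Γ W y).toLinearMap + fderiv ℝ r y (W y))
        * density (G y) := by
  have hdens : DifferentiableAt ℝ (fun z ↦ density (G z)) y :=
    ((contDiffOn_density h.contDiffOn_metric h.isInnerProduct).contDiffAt
      (h.isOpen.mem_nhds hy)).differentiableAt (by simp)
  have htrace (L : E →L[ℝ] ℝ) (w : E) :
      LinearMap.trace ℝ E (L.smulRight w : E →L[ℝ] E).toLinearMap = L w :=
    LinearMap.trace_smulRight L.toLinearMap w
  rw [fderiv_fun_smul (hdens.fun_mul hr) hW, fderiv_fun_mul hdens hr,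
    h.toIsTorsionFreeOn.trace_covField hy, ContinuousLinearMap.toLinearMap_add, map_add,
    ContinuousLinearMap.toLinearMap_smul, map_smul, htrace]
  simp only [add_apply, smul_apply, smul_eq_mul, h.fderiv_density hy]
  ring

end IsLeviCivitaOn

end Density

section DivergenceTheorem

open MeasureTheory

variable {E F : Type*} [NormedAddCommGroup E] [NormedSpace ℝ E] [FiniteDimensional ℝ E]
  [NormedAddCommGroup F] [NormedSpace ℝ F]

theorem integral_fderiv_eq_zero [MeasurableSpace E] [BorelSpace E] (μ : Measure E)
    [μ.IsAddHaarMeasure] {f : E → F} (hf : ContDiff ℝ 1 f) (hc : HasCompactSupport f) :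
    ∫ x, fderiv ℝ f x ∂μ = 0 := by
  have hint : Integrable (fderiv ℝ f) μ :=
    (hf.continuous_fderiv (by simp)).integrable_of_hasCompactSupport (hc.fderiv ℝ)
  ext v
  have hparts := integral_smul_fderiv_eq_neg_fderiv_smul_of_integrable (μ := μ)
    (f := fun _ : E ↦ (1 : ℝ)) (g := f) (v := v) (by simp)
    (by simpa using hint.apply_continuousLinearMap v)
    (by simpa using hf.continuous.integrable_of_hasCompactSupport hc) (by simp)
    (fun x _ ↦ hf.contDiffAt.differentiableAt (by simp))
  rw [ContinuousLinearMap.integral_apply hint]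
  simpa using hparts

theorem integral_trace_fderiv_eq_zero [MeasurableSpace E] [BorelSpace E] (μ : Measure E)
    [μ.IsAddHaarMeasure] {F : E → E} (hF : ContDiff ℝ 1 F) (hc : HasCompactSupport F) :
    ∫ x, LinearMap.trace ℝ E (fderiv ℝ F x).toLinearMap ∂μ = 0 := by
  let τ : (E →L[ℝ] E) →L[ℝ] ℝ :=
    LinearMap.toContinuousLinearMap (LinearMap.trace ℝ E ∘ₗ ContinuousLinearMap.coeLM ℝ)
  have hint : Integrable (fderiv ℝ F) μ :=
    (hF.continuous_fderiv (by simp)).integrable_of_hasCompactSupport (hc.fderiv ℝ)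
  calc ∫ x, τ (fderiv ℝ F x) ∂μ = τ (∫ x, fderiv ℝ F x ∂μ) := τ.integral_comp_comm hint
    _ = 0 := by rw [integral_fderiv_eq_zero μ hF hc, map_zero]

variable {T K : Set E} {X : E → F}

theorem indicator_eq_zero_of_notMem {α β : Type*} [Zero β] {T K : Set α} {X : α → β}
    (h0 : ∀ y ∈ T, y ∉ K → X y = 0) {y : α} (hy : y ∉ K) :
    T.indicator X y = 0 := by
  by_cases hyT : y ∈ T
  · rw [Set.indicator_of_mem hyT, h0 y hyT hy]
  · exact Set.indicator_of_notMem hyT X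

omit [FiniteDimensional ℝ E] in
theorem contDiff_indicator {n : ℕ∞ω} (hT : IsOpen T) (hK : IsClosed K) (hKT : K ⊆ T)
    (hX : ContDiffOn ℝ n X T) (h0 : ∀ y ∈ T, y ∉ K → X y = 0) : ContDiff ℝ n (T.indicator X) := by
  refine contDiff_iff_contDiffAt.2 fun y ↦ ?_
  by_cases hyT : y ∈ T
  · refine (hX.contDiffAt (hT.mem_nhds hyT)).congr_of_eventuallyEq ?_
    filter_upwards [hT.mem_nhds hyT] with z hz using Set.indicator_of_mem hz X
  · refine contDiffAt_const (c := (0 : F)).congr_of_eventuallyEq ?_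
    filter_upwards [hK.isOpen_compl.mem_nhds fun h ↦ hyT (hKT h)] with z hz
      using indicator_eq_zero_of_notMem h0 hz

theorem setIntegral_trace_fderiv_eq_zero [MeasurableSpace E] [BorelSpace E] (μ : Measure E)
    [μ.IsAddHaarMeasure] (hT : IsOpen T) (hK : IsCompact K) (hKT : K ⊆ T) {F : E → E}
    (hF : ContDiffOn ℝ 1 F T) (h0 : ∀ y ∈ T, y ∉ K → F y = 0) :
    ∫ y in T, LinearMap.trace ℝ E (fderiv ℝ F y).toLinearMap ∂μ = 0 := by
  have hzero {y : E} (hy : y ∉ K) : T.indicator F y = 0 := indicator_eq_zero_of_notMem h0 hy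
  calc ∫ y in T, LinearMap.trace ℝ E (fderiv ℝ F y).toLinearMap ∂μ
      = ∫ y in T, LinearMap.trace ℝ E (fderiv ℝ (T.indicator F) y).toLinearMap ∂μ :=
        setIntegral_congr_fun hT.measurableSet fun y hy ↦ by
          have hev : T.indicator F =ᶠ[nhds y] F :=
            Filter.eventually_of_mem (hT.mem_nhds hy) fun z hz ↦ Set.indicator_of_mem hz F
          simp only [hev.fderiv_eq]
    _ = ∫ y, LinearMap.trace ℝ E (fderiv ℝ (T.indicator F) y).toLinearMap ∂μ := by
        refine setIntegral_eq_integral_of_forall_compl_eq_zero fun y hy ↦ ?_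
        have hev : T.indicator F =ᶠ[nhds y] fun _ ↦ 0 :=
          Filter.eventually_of_mem (hK.isClosed.isOpen_compl.mem_nhds fun h ↦ hy (hKT h))
            fun z hz ↦ hzero hz
        simp [hev.fderiv_eq]
    _ = 0 := integral_trace_fderiv_eq_zero μ (contDiff_indicator hT hK.isClosed hKT hF h0)
        (HasCompactSupport.intro hK fun _ ↦ hzero)

end DivergenceTheorem

section Charts

variable {E : Type*} [NormedAddCommGroup E] [NormedSpace ℝ E]
  {M : Type*} [TopologicalSpace M] [ChartedSpace E M] [IsManifold 𝓘(ℝ, E) ∞ M]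

/-- The linear map from the model space to the tangent space at `q` given by the chart at `p`. -/
def frame (p q : M) : E →L[ℝ] TangentSpace 𝓘(ℝ, E) q :=
  (tangentCoordChange 𝓘(ℝ, E) p q q : E →L[ℝ] E)

/-- The coordinates, in the chart at `p`, of the tangent vectors at `q`. -/
def coframe (p q : M) : TangentSpace 𝓘(ℝ, E) q →L[ℝ] E :=
  (tangentCoordChange 𝓘(ℝ, E) q p q : E →L[ℝ] E)

theorem frame_coframe {p q : M} (hq : q ∈ (chartAt E p).source) (v : TangentSpace 𝓘(ℝ, E) q) :
    frame p q (coframe p q v) = v := by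
  have h : q ∈ (extChartAt 𝓘(ℝ, E) q).source ∩ (extChartAt 𝓘(ℝ, E) p).source ∩
      (extChartAt 𝓘(ℝ, E) q).source := by simp [hq]
  exact (tangentCoordChange_comp (I := 𝓘(ℝ, E)) (v := v) h).trans
    (tangentCoordChange_self (I := 𝓘(ℝ, E)) h.2)

theorem coframe_frame {p q : M} (hq : q ∈ (chartAt E p).source) (v : E) :
    coframe p q (frame p q v) = v := by
  have h : q ∈ (extChartAt 𝓘(ℝ, E) p).source ∩ (extChartAt 𝓘(ℝ, E) q).source ∩
      (extChartAt 𝓘(ℝ, E) p).source := by simp [hq]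
  exact (tangentCoordChange_comp (I := 𝓘(ℝ, E)) (v := v) h).trans
    (tangentCoordChange_self (I := 𝓘(ℝ, E)) h.2)

/-- A vector field on `M` read in the chart at `p`. -/
def fieldIn (p : M) (X : Π x : M, TangentSpace 𝓘(ℝ, E) x) (y : E) : E :=
  coframe p ((chartAt E p).symm y) (X ((chartAt E p).symm y))

omit [NormedSpace ℝ E] [IsManifold 𝓘(ℝ, E) ∞ M] in
theorem symm_mem_source {p : M} {y : E} (hy : y ∈ (chartAt E p).target) :
    (chartAt E p).symm y ∈ (chartAt E p).source := (chartAt E p).map_target hy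

theorem frame_fieldIn {p : M} (X : Π x : M, TangentSpace 𝓘(ℝ, E) x) {y : E}
    (hy : y ∈ (chartAt E p).target) :
    frame p _ (fieldIn p X y) = X ((chartAt E p).symm y) :=
  frame_coframe (symm_mem_source hy) _

theorem mfderiv_chart_symm {p : M} {y : E} (hy : y ∈ (chartAt E p).target) :
    mfderiv 𝓘(ℝ, E) 𝓘(ℝ, E) (chartAt E p).symm y
      = (frame p ((chartAt E p).symm y) : E →L[ℝ] _) := by
  have h := (TangentBundle.symmL_trivializationAt (I := 𝓘(ℝ, E)) (symm_mem_source hy)).symm.trans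
    (TangentBundle.symmL_trivializationAt_eq_core (I := 𝓘(ℝ, E)) (symm_mem_source hy))
  simp only [mfld_simps, modelWithCornersSelf_coe, Set.range_id, mfderivWithin_univ] at h
  -- `h` is the claim at `chartAt E p ((chartAt E p).symm y)`, on which the type of `h` depends
  suffices ∀ z, z = y → mfderiv 𝓘(ℝ, E) 𝓘(ℝ, E) (chartAt E p).symm z =
      (tangentBundleCore 𝓘(ℝ, E) M).coordChange (achart E p) (achart E ((chartAt E p).symm y))
        ((chartAt E p).symm y) → mfderiv 𝓘(ℝ, E) 𝓘(ℝ, E) (chartAt E p).symm y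
      = (frame p ((chartAt E p).symm y) : E →L[ℝ] _) from
    this _ ((chartAt E p).right_inv hy) h
  rintro z rfl h
  exact h

theorem mdifferentiableAt_chart_symm {p : M} {y : E} (hy : y ∈ (chartAt E p).target) :
    MDifferentiableAt 𝓘(ℝ, E) 𝓘(ℝ, E) (chartAt E p).symm y :=
  mdifferentiableAt_atlas_symm (chart_mem_atlas E p) hy

theorem mvfderiv_frame {p : M} {y : E} (hy : y ∈ (chartAt E p).target) {f : M → ℝ}
    (hf : MDifferentiableAt 𝓘(ℝ, E) 𝓘(ℝ, ℝ) f ((chartAt E p).symm y)) (u : E) :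
    mvfderiv 𝓘(ℝ, E) f ((chartAt E p).symm y) (frame p _ u)
      = fderiv ℝ (f ∘ (chartAt E p).symm) y u := by
  have h := mvfderiv_comp_apply y hf (mdifferentiableAt_chart_symm hy) u
  rw [mfderiv_chart_symm hy] at h
  refine h.symm.trans ?_
  simp [mvfderiv]
  rfl

theorem contMDiffAt_comp_chart_symm_iff {p : M} {y : E} (hy : y ∈ (chartAt E p).target)
    {F : Type*} [NormedAddCommGroup F] [NormedSpace ℝ F] {f : M → F} :
    ContMDiffAt 𝓘(ℝ, E) 𝓘(ℝ, F) ∞ f ((chartAt E p).symm y) ↔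
      ContDiffAt ℝ ∞ (f ∘ (chartAt E p).symm) y := by
  rw [contMDiffAt_iff_source_of_mem_source (x := p) (symm_mem_source hy),
    ← contMDiffAt_iff_contDiffAt]
  simp [mfld_simps, (chartAt E p).right_inv hy, contMDiffWithinAt_univ]

theorem mdifferentiableAt_comp_chart_symm_iff {p : M} {y : E} (hy : y ∈ (chartAt E p).target)
    {F : Type*} [NormedAddCommGroup F] [NormedSpace ℝ F] {f : M → F} :
    MDifferentiableAt 𝓘(ℝ, E) 𝓘(ℝ, F) f ((chartAt E p).symm y) ↔
      DifferentiableAt ℝ (f ∘ (chartAt E p).symm) y := by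
  rw [← mdifferentiableAt_iff_differentiableAt]
  refine ⟨fun h ↦ h.comp y (mdifferentiableAt_chart_symm hy), fun h ↦ ?_⟩
  have h1 : MDifferentiableAt 𝓘(ℝ, E) 𝓘(ℝ, E) (chartAt E p) ((chartAt E p).symm y) :=
    mdifferentiableAt_atlas (chart_mem_atlas E p) (symm_mem_source hy)
  have h2 := MDifferentiableAt.comp ((chartAt E p).symm y)
    (by rw [(chartAt E p).right_inv hy]; exact h) h1
  refine h2.congr_of_eventuallyEq ?_
  filter_upwards [(chartAt E p).open_source.mem_nhds (symm_mem_source hy)] with q hq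
  simp [(chartAt E p).left_inv hq]

theorem diffFieldAt_iff {p : M} {y : E} (hy : y ∈ (chartAt E p).target)
    {X : Π x : M, TangentSpace 𝓘(ℝ, E) x} :
    DiffFieldAt X ((chartAt E p).symm y) ↔ DifferentiableAt ℝ (fieldIn p X) y :=
  ((trivializationAt E (TangentSpace 𝓘(ℝ, E)) p).mdifferentiableAt_section_iff 𝓘(ℝ, E) X
    (symm_mem_source hy)).trans (mdifferentiableAt_comp_chart_symm_iff hy)

theorem contMDiffAt_field_iff {p : M} {y : E} (hy : y ∈ (chartAt E p).target)
    {X : Π x : M, TangentSpace 𝓘(ℝ, E) x} :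
    ContMDiffAt 𝓘(ℝ, E) 𝓘(ℝ, E).tangent ∞
      (fun y ↦ (⟨y, X y⟩ : TangentBundle 𝓘(ℝ, E) M)) ((chartAt E p).symm y) ↔
    ContDiffAt ℝ ∞ (fieldIn p X) y :=
  ((trivializationAt E (TangentSpace 𝓘(ℝ, E)) p).contMDiffAt_section_iff
    (symm_mem_source hy)).trans (contMDiffAt_comp_chart_symm_iff hy)

theorem smoothField_iff {X : Π x : M, TangentSpace 𝓘(ℝ, E) x} :
    SmoothField X ↔ ∀ p : M, ∀ y ∈ (chartAt E p).target, ContDiffAt ℝ ∞ (fieldIn p X) y := by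
  refine ⟨fun h p y hy ↦ (contMDiffAt_field_iff hy).1 (h _), fun h p ↦ ?_⟩
  have := (contMDiffAt_field_iff (mem_chart_target E p)).2 (h p _ (mem_chart_target E p))
  rwa [(chartAt E p).left_inv (mem_chart_source E p)] at this

/-- The field which is constant, equal to `v`, in the chart at `p`. -/
def constField (p : M) (v : E) (q : M) : TangentSpace 𝓘(ℝ, E) q := frame p q v

theorem fieldIn_constField {p : M} (v : E) {y : E} (hy : y ∈ (chartAt E p).target) :
    fieldIn p (constField p v) y = v := coframe_frame (symm_mem_source hy) v

theorem fieldIn_constField_eventually {p : M} (v : E) {y : E} (hy : y ∈ (chartAt E p).target) :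
    fieldIn p (constField p v) =ᶠ[nhds y] fun _ ↦ v := by
  filter_upwards [(chartAt E p).open_target.mem_nhds hy] with z hz using fieldIn_constField v hz

theorem contDiffAt_constField {p : M} (v : E) {y : E} (hy : y ∈ (chartAt E p).target) :
    ContDiffAt ℝ ∞ (fieldIn p (constField p v)) y :=
  contDiffAt_const.congr_of_eventuallyEq (fieldIn_constField_eventually v hy)

theorem diffFieldAt_constField {p : M} (v : E) {y : E} (hy : y ∈ (chartAt E p).target) :
    DiffFieldAt (constField p v) ((chartAt E p).symm y) :=
  (diffFieldAt_iff hy).2 ((contDiffAt_constField v hy).differentiableAt (by simp))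

theorem inverse_mfderiv_chart_symm {p : M} {y : E} (hy : y ∈ (chartAt E p).target) :
    (mfderiv 𝓘(ℝ, E) 𝓘(ℝ, E) (chartAt E p).symm y).inverse
      = coframe p ((chartAt E p).symm y) := by
  rw [mfderiv_chart_symm hy]
  apply ContinuousLinearMap.inverse_eq
  · ext v; exact frame_coframe (symm_mem_source hy) v
  · ext v; exact coframe_frame (symm_mem_source hy) v

theorem mpullback_chart_symm (X : Π x : M, TangentSpace 𝓘(ℝ, E) x) {p : M} {y : E}
    (hy : y ∈ (chartAt E p).target) :
    mpullback 𝓘(ℝ, E) 𝓘(ℝ, E) (chartAt E p).symm X y = fieldIn p X y := by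
  rw [mpullback_apply, inverse_mfderiv_chart_symm hy]
  rfl

theorem mpullback_chart_symm_eventuallyEq (X : Π x : M, TangentSpace 𝓘(ℝ, E) x) {p : M} {y : E}
    (hy : y ∈ (chartAt E p).target) :
    mpullback 𝓘(ℝ, E) 𝓘(ℝ, E) (chartAt E p).symm X =ᶠ[nhds y] fieldIn p X :=
  Filter.eventually_of_mem ((chartAt E p).open_target.mem_nhds hy) fun _ ↦ mpullback_chart_symm X

theorem mlieBracket_frame [CompleteSpace E] {p : M} {y : E} (hy : y ∈ (chartAt E p).target)
    {X Y : Π x : M, TangentSpace 𝓘(ℝ, E) x}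
    (hX : DiffFieldAt X ((chartAt E p).symm y)) (hY : DiffFieldAt Y ((chartAt E p).symm y)) :
    mlieBracket 𝓘(ℝ, E) X Y ((chartAt E p).symm y) =
      frame p _ (fderiv ℝ (fieldIn p Y) y (fieldIn p X y)
        - fderiv ℝ (fieldIn p X) y (fieldIn p Y y)) := by
  have two_le : (2 : ℕ∞ω) ≤ ∞ := WithTop.coe_le_coe.2 le_top
  have : IsManifold 𝓘(ℝ, E) (minSmoothness ℝ 2) M := by
    rw [minSmoothness_of_isRCLikeNormedField]; exact IsManifold.of_le (n := ∞) two_le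
  have hpull := mpullback_mlieBracket (n := ∞) hX hY
    ((contMDiffOn_chart_symm y hy).contMDiffAt ((chartAt E p).open_target.mem_nhds hy))
    (by rw [minSmoothness_of_isRCLikeNormedField]; exact two_le)
  have hbracket (V W : Π z : E, TangentSpace 𝓘(ℝ, E) z) :
      mlieBracket 𝓘(ℝ, E) V W = lieBracket ℝ V W := by
    rw [← mlieBracketWithin_univ, mlieBracketWithin_eq_lieBracketWithin]
    exact lieBracketWithin_univ
  rw [(mpullback_chart_symm_eventuallyEq X hy).mlieBracket_vectorField_eq
    (mpullback_chart_symm_eventuallyEq Y hy), mpullback_chart_symm _ hy] at hpull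
  have hcoord : coframe p _ (mlieBracket 𝓘(ℝ, E) X Y ((chartAt E p).symm y))
      = lieBracket ℝ (fieldIn p X) (fieldIn p Y) y :=
    hpull.trans (congrFun (hbracket _ _) y)
  rw [← frame_coframe (symm_mem_source hy) (mlieBracket 𝓘(ℝ, E) X Y _), hcoord]
  rfl

end Charts

section Local

variable {E : Type*} [NormedAddCommGroup E] [NormedSpace ℝ E]
  {M : Type*} [TopologicalSpace M] [ChartedSpace E M] [IsManifold 𝓘(ℝ, E) ∞ M]

/-- The metric read in the chart at `p`. -/
def metricIn (g : Metric E M) (p : M) (y : E) : E →L[ℝ] E →L[ℝ] ℝ :=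
  let B : E →L[ℝ] E →L[ℝ] ℝ := g.inner ((chartAt E p).symm y)
  let F : E →L[ℝ] E := frame p ((chartAt E p).symm y)
  B.bilinearComp F F

theorem metricIn_apply (g : Metric E M) (p : M) (y u v : E) :
    metricIn g p y u v = g.inner ((chartAt E p).symm y) (frame p _ u) (frame p _ v) := rfl

/-- A 1-form read in the chart at `p`. -/
def formIn (p : M) (α : Π x : M, TangentSpace 𝓘(ℝ, E) x →L[ℝ] ℝ) (y : E) : E →L[ℝ] ℝ :=
  (α ((chartAt E p).symm y)).comp (frame p ((chartAt E p).symm y))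

theorem formIn_apply (p : M) (α : Π x : M, TangentSpace 𝓘(ℝ, E) x →L[ℝ] ℝ) (y u : E) :
    formIn p α y u = α ((chartAt E p).symm y) (frame p _ u) := rfl

theorem isInnerProduct_metricIn (g : Metric E M) {p : M} {y : E} (hy : y ∈ (chartAt E p).target) :
    IsInnerProduct (metricIn g p y) where
  symm u v := by rw [metricIn_apply, metricIn_apply, g.symm]
  pos u hu := by
    rw [metricIn_apply]
    refine g.pos _ _ fun h ↦ hu ?_
    rw [← coframe_frame (symm_mem_source hy) u, h, map_zero]

theorem inner_eq_metricIn (g : Metric E M) {p : M} {y : E} (hy : y ∈ (chartAt E p).target)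
    (X Y : Π x : M, TangentSpace 𝓘(ℝ, E) x) :
    g.inner ((chartAt E p).symm y) (X _) (Y _)
      = metricIn g p y (fieldIn p X y) (fieldIn p Y y) := by
  rw [metricIn_apply, frame_fieldIn X hy, frame_fieldIn Y hy]

theorem contMDiffAt_constField {p : M} (v : E) {q : M} (hq : q ∈ (chartAt E p).source) :
    ContMDiffAt 𝓘(ℝ, E) 𝓘(ℝ, E).tangent ∞
      (fun x ↦ (⟨x, constField p v x⟩ : TangentBundle 𝓘(ℝ, E) M)) q := by
  have := (contMDiffAt_field_iff ((chartAt E p).map_source hq)).2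
    (contDiffAt_constField v ((chartAt E p).map_source hq))
  rwa [(chartAt E p).left_inv hq] at this

theorem contMDiffAt_inner (g : Metric E M) {q : M} {X Y : Π x : M, TangentSpace 𝓘(ℝ, E) x}
    (hX : ContMDiffAt 𝓘(ℝ, E) 𝓘(ℝ, E).tangent ∞
      (fun x ↦ (⟨x, X x⟩ : TangentBundle 𝓘(ℝ, E) M)) q)
    (hY : ContMDiffAt 𝓘(ℝ, E) 𝓘(ℝ, E).tangent ∞
      (fun x ↦ (⟨x, Y x⟩ : TangentBundle 𝓘(ℝ, E) M)) q) :
    ContMDiffAt 𝓘(ℝ, E) 𝓘(ℝ, ℝ) ∞ (fun x ↦ g.inner x (X x) (Y x)) q := by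
  have : ContMDiffAt 𝓘(ℝ, E) (𝓘(ℝ, E).prod 𝓘(ℝ)) ∞
      (fun m ↦ TotalSpace.mk' ℝ (E := Bundle.Trivial M ℝ) m (g.inner m (X m) (Y m))) q := by
    apply ContMDiffAt.clm_bundle_apply₂ (F₁ := E) (F₂ := E)
    · exact g.contMDiff.contMDiffAt
    · exact hX
    · exact hY
  simp only [contMDiffAt_totalSpace] at this
  exact this.2

theorem contMDiffAt_form {α : Π x : M, TangentSpace 𝓘(ℝ, E) x →L[ℝ] ℝ} (hα : IsSmoothOneForm α)
    {q : M} {X : Π x : M, TangentSpace 𝓘(ℝ, E) x}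
    (hX : ContMDiffAt 𝓘(ℝ, E) 𝓘(ℝ, E).tangent ∞
      (fun x ↦ (⟨x, X x⟩ : TangentBundle 𝓘(ℝ, E) M)) q) :
    ContMDiffAt 𝓘(ℝ, E) 𝓘(ℝ, ℝ) ∞ (fun x ↦ α x (X x)) q := by
  have : ContMDiffAt 𝓘(ℝ, E) (𝓘(ℝ, E).prod 𝓘(ℝ)) ∞
      (fun m ↦ TotalSpace.mk' ℝ (E := Bundle.Trivial M ℝ) m (α m (X m))) q := by
    apply ContMDiffAt.clm_bundle_apply (F₁ := E)
    · exact hα.contMDiffAt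
    · exact hX
  simp only [contMDiffAt_totalSpace] at this
  exact this.2

variable [FiniteDimensional ℝ E]

theorem contDiffOn_metricIn (g : Metric E M) (p : M) :
    ContDiffOn ℝ ∞ (metricIn g p) (chartAt E p).target := by
  rw [contDiffOn_clm_apply]; intro u
  rw [contDiffOn_clm_apply]; intro v y hy
  exact ContDiffAt.contDiffWithinAt <| (contMDiffAt_comp_chart_symm_iff hy).1 (contMDiffAt_inner g
    (contMDiffAt_constField u (symm_mem_source hy)) (contMDiffAt_constField v (symm_mem_source hy)))

theorem contDiffOn_formIn {α : Π x : M, TangentSpace 𝓘(ℝ, E) x →L[ℝ] ℝ} (hα : IsSmoothOneForm α)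
    (p : M) : ContDiffOn ℝ ∞ (formIn p α) (chartAt E p).target := by
  rw [contDiffOn_clm_apply]; intro u y hy
  exact ContDiffAt.contDiffWithinAt <| (contMDiffAt_comp_chart_symm_iff hy).1 (contMDiffAt_form hα
    (contMDiffAt_constField u (symm_mem_source hy)))

theorem contDiffAt_metricIn (g : Metric E M) {p : M} {y : E} (hy : y ∈ (chartAt E p).target) :
    ContDiffAt ℝ ∞ (metricIn g p) y :=
  (contDiffOn_metricIn g p).contDiffAt ((chartAt E p).open_target.mem_nhds hy)

theorem contDiffAt_formIn {α : Π x : M, TangentSpace 𝓘(ℝ, E) x →L[ℝ] ℝ} (hα : IsSmoothOneForm α)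
    {p : M} {y : E} (hy : y ∈ (chartAt E p).target) : ContDiffAt ℝ ∞ (formIn p α) y :=
  (contDiffOn_formIn hα p).contDiffAt ((chartAt E p).open_target.mem_nhds hy)

theorem metricIn_sharp (g : Metric E M) (α : Π x : M, TangentSpace 𝓘(ℝ, E) x →L[ℝ] ℝ)
    {p : M} {y : E} (hy : y ∈ (chartAt E p).target) :
    metricIn g p y (fieldIn p (sharp g α) y) = formIn p α y := by
  ext u
  rw [metricIn_apply, frame_fieldIn _ hy, inner_sharp, formIn_apply]

theorem contDiffAt_sharp (g : Metric E M) {α : Π x : M, TangentSpace 𝓘(ℝ, E) x →L[ℝ] ℝ}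
    {p : M} {y : E} (hy : y ∈ (chartAt E p).target) {k : ℕ∞} (hα : ContDiffAt ℝ k (formIn p α) y) :
    ContDiffAt ℝ k (fieldIn p (sharp g α)) y :=
  contDiffAt_of_inner ((contDiffAt_metricIn g hy).of_le (WithTop.coe_le_coe.2 le_top))
    (isInnerProduct_metricIn g hy) <| hα.congr_of_eventuallyEq <|
      Filter.eventually_of_mem ((chartAt E p).open_target.mem_nhds hy) fun _ ↦ metricIn_sharp g α

theorem smoothField_sharp (g : Metric E M) {α : Π x : M, TangentSpace 𝓘(ℝ, E) x →L[ℝ] ℝ}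
    (hα : IsSmoothOneForm α) : SmoothField (sharp g α) :=
  smoothField_iff.2 fun _ _ hy ↦ contDiffAt_sharp g hy (k := ⊤) (contDiffAt_formIn hα hy)

end Local

section Christoffel

variable {E : Type*} [NormedAddCommGroup E] [NormedSpace ℝ E] [FiniteDimensional ℝ E]
  {M : Type*} [TopologicalSpace M] [ChartedSpace E M] [IsManifold 𝓘(ℝ, E) ∞ M]

/-- The Christoffel symbols of `D` in the chart at `p`: `christoffel D p y u v` is the derivative at
`y`, in the direction `u`, of the field with constant coordinates `v`. -/
def christoffel (D : Connection E M) (p : M) (y : E) : E →L[ℝ] E →L[ℝ] E :=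
  ∑ i, (ContinuousLinearMap.smulRightL ℝ E E
    (LinearMap.toContinuousLinearMap ((Module.finBasis ℝ E).coord i))).comp
    ((coframe p ((chartAt E p).symm y)).comp
      ((D (constField p (Module.finBasis ℝ E i)) ((chartAt E p).symm y)).comp
        (frame p ((chartAt E p).symm y))))

theorem christoffel_apply (D : Connection E M) (p : M) (y u v : E) :
    christoffel D p y u v = ∑ i, (Module.finBasis ℝ E).repr v i •
      coframe p ((chartAt E p).symm y) (D (constField p (Module.finBasis ℝ E i))
        ((chartAt E p).symm y) (frame p _ u)) := by
  simp [christoffel]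

omit [FiniteDimensional ℝ E] in
theorem connection_sum (D : Connection E M) {ι : Type*} (s : Finset ι) {q : M}
    {X : ι → Π x : M, TangentSpace 𝓘(ℝ, E) x} (h : ∀ i ∈ s, DiffFieldAt (X i) q) :
    D (∑ i ∈ s, X i) q = ∑ i ∈ s, D (X i) q := by
  classical
  induction s using Finset.induction_on with
  | empty => simp
  | insert a s ha ih =>
    have hs : ∀ i ∈ s, DiffFieldAt (X i) q := fun i hi ↦ h i (Finset.mem_insert_of_mem hi)
    have hsum : DiffFieldAt (∑ i ∈ s, X i) q := by
      simp only [DiffFieldAt, Finset.sum_apply]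
      exact MDifferentiableAt.sum_section hs
    rw [Finset.sum_insert ha, Finset.sum_insert ha,
      D.isCovariantDerivativeOnUniv.add (h a (Finset.mem_insert_self a s)) hsum, ih hs]

/-- The `i`-th component of a vector field in the chart at `p`. -/
def component (p : M) (X : Π x : M, TangentSpace 𝓘(ℝ, E) x) (i : Fin (Module.finrank ℝ E))
    (q : M) : ℝ :=
  (Module.finBasis ℝ E).coord i (coframe p q (X q))

theorem component_comp_chart_symm (p : M) (X : Π x : M, TangentSpace 𝓘(ℝ, E) x)
    (i : Fin (Module.finrank ℝ E)) :
    component p X i ∘ (chartAt E p).symm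
      = fun z ↦ ((Module.finBasis ℝ E).coord i).toContinuousLinearMap (fieldIn p X z) := rfl

theorem mdifferentiableAt_component {p : M} {y : E} (hy : y ∈ (chartAt E p).target)
    {X : Π x : M, TangentSpace 𝓘(ℝ, E) x} (hX : DiffFieldAt X ((chartAt E p).symm y))
    (i : Fin (Module.finrank ℝ E)) :
    MDifferentiableAt 𝓘(ℝ, E) 𝓘(ℝ, ℝ) (component p X i) ((chartAt E p).symm y) := by
  rw [mdifferentiableAt_comp_chart_symm_iff hy, component_comp_chart_symm]
  exact (ContinuousLinearMap.differentiableAt _).comp y ((diffFieldAt_iff hy).1 hX)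

theorem mvfderiv_component {p : M} {y : E} (hy : y ∈ (chartAt E p).target)
    {X : Π x : M, TangentSpace 𝓘(ℝ, E) x} (hX : DiffFieldAt X ((chartAt E p).symm y))
    (i : Fin (Module.finrank ℝ E)) (u : E) :
    mvfderiv 𝓘(ℝ, E) (component p X i) ((chartAt E p).symm y) (frame p _ u)
      = (Module.finBasis ℝ E).coord i (fderiv ℝ (fieldIn p X) y u) := by
  rw [mvfderiv_frame hy (mdifferentiableAt_component hy hX i), component_comp_chart_symm,
    fderiv_fun_comp y (ContinuousLinearMap.differentiableAt _) ((diffFieldAt_iff hy).1 hX),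
    ContinuousLinearMap.fderiv]
  rfl

theorem sum_component_smul_constField {p q : M} (hq : q ∈ (chartAt E p).source)
    (X : Π x : M, TangentSpace 𝓘(ℝ, E) x) :
    (∑ i, component p X i • constField p (Module.finBasis ℝ E i)) q = X q := by
  have h := congrArg (frame p q) ((Module.finBasis ℝ E).sum_repr (coframe p q (X q)))
  rw [map_sum, frame_coframe hq] at h
  rw [← h]
  simp [component, constField]

theorem connection_component_smul_constField (D : Connection E M) {p : M} {y : E}
    (hy : y ∈ (chartAt E p).target) {X : Π x : M, TangentSpace 𝓘(ℝ, E) x}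
    (hX : DiffFieldAt X ((chartAt E p).symm y)) (i : Fin (Module.finrank ℝ E)) (u : E) :
    D (component p X i • constField p (Module.finBasis ℝ E i)) ((chartAt E p).symm y)
      (frame p _ u) = frame p _
        ((Module.finBasis ℝ E).repr (fderiv ℝ (fieldIn p X) y u) i • Module.finBasis ℝ E i
          + (Module.finBasis ℝ E).repr (fieldIn p X y) i • coframe p _
            (D (constField p (Module.finBasis ℝ E i)) ((chartAt E p).symm y) (frame p _ u))) := by
  rw [D.isCovariantDerivativeOnUniv.leibniz (diffFieldAt_constField _ hy)
    (mdifferentiableAt_component hy hX i), add_apply, smul_apply,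
    ContinuousLinearMap.smulRight_apply, mvfderiv_component hy hX, map_add, map_smul, map_smul,
    frame_coframe (symm_mem_source hy), add_comm]
  rfl

theorem connection_frame (D : Connection E M) {p : M} {y : E} (hy : y ∈ (chartAt E p).target)
    {X : Π x : M, TangentSpace 𝓘(ℝ, E) x} (hX : DiffFieldAt X ((chartAt E p).symm y)) (u : E) :
    D X ((chartAt E p).symm y) (frame p _ u) =
      frame p _ (covField (christoffel D p) (fieldIn p X) y u) := by
  have hdiff (i) : DiffFieldAt (component p X i • constField p (Module.finBasis ℝ E i))
      ((chartAt E p).symm y) :=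
    (mdifferentiableAt_component hy hX i).smul_section (diffFieldAt_constField _ hy)
  have hsum : DiffFieldAt (∑ i, component p X i • constField p (Module.finBasis ℝ E i))
      ((chartAt E p).symm y) := by
    simp only [DiffFieldAt, Finset.sum_apply]
    exact MDifferentiableAt.sum_section fun i _ ↦ hdiff i
  have hX_eq : ∀ᶠ q in nhds ((chartAt E p).symm y),
      X q = (∑ i, component p X i • constField p (Module.finBasis ℝ E i)) q :=
    Filter.eventually_of_mem ((chartAt E p).open_source.mem_nhds (symm_mem_source hy)) fun q hq ↦
      (sum_component_smul_constField hq X).symm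
  rw [D.isCovariantDerivativeOnUniv.congr_of_eventuallyEq hX hsum Filter.univ_mem hX_eq,
    connection_sum D _ fun i _ ↦ hdiff i, sum_apply,
    Finset.sum_congr rfl fun i _ ↦ connection_component_smul_constField D hy hX i u, ← map_sum,
    Finset.sum_add_distrib, (Module.finBasis ℝ E).sum_repr, ← christoffel_apply, covField_apply]

theorem connection_constField (D : Connection E M) {p : M} {y : E} (hy : y ∈ (chartAt E p).target)
    (u v : E) : D (constField p v) ((chartAt E p).symm y) (frame p _ u) =
      frame p _ (christoffel D p y u v) := by
  rw [connection_frame D hy (diffFieldAt_constField v hy),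
    covField_congr (fieldIn_constField_eventually v hy), covField_const]

theorem fieldIn_connection (D : Connection E M) {p : M} {y : E} (hy : y ∈ (chartAt E p).target)
    {X Y : Π x : M, TangentSpace 𝓘(ℝ, E) x} (hX : DiffFieldAt X ((chartAt E p).symm y)) :
    fieldIn p (fun q ↦ D X q (Y q)) y
      = covField (christoffel D p) (fieldIn p X) y (fieldIn p Y y) := by
  rw [fieldIn, ← frame_fieldIn Y hy, connection_frame D hy hX,
    coframe_frame (symm_mem_source hy)]

omit [FiniteDimensional ℝ E] in
theorem frame_injective {p q : M} (hq : q ∈ (chartAt E p).source) :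
    Function.Injective (frame (E := E) p q) := fun u v h ↦ by
  rw [← coframe_frame hq u, h, coframe_frame hq]

theorem christoffel_symm {D : Connection E M} (hD : IsTorsionFree D) {p : M} {y : E}
    (hy : y ∈ (chartAt E p).target) (u v : E) :
    christoffel D p y u v = christoffel D p y v u := by
  have : CompleteSpace E := FiniteDimensional.complete ℝ E
  have h := (CovariantDerivative.torsion_eq_zero_iff (cov := D)).1 hD
    (diffFieldAt_constField u hy) (diffFieldAt_constField v hy)
  rw [mlieBracket_frame hy (diffFieldAt_constField u hy) (diffFieldAt_constField v hy),
    (fieldIn_constField_eventually v hy).fderiv_eq,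
    (fieldIn_constField_eventually u hy).fderiv_eq] at h
  have e : D (constField p v) ((chartAt E p).symm y) (frame p _ u)
      - D (constField p u) ((chartAt E p).symm y) (frame p _ v) = 0 := by
    refine h.trans ?_
    simp
  rw [connection_constField D hy, connection_constField D hy, sub_eq_zero] at e
  exact frame_injective (symm_mem_source hy) e

theorem fderiv_metricIn {g : Metric E M} {D : Connection E M}
    {α : Π x : M, TangentSpace 𝓘(ℝ, E) x →L[ℝ] ℝ} (h : DerivMetricEq g D α) {p : M} {y : E}
    (hy : y ∈ (chartAt E p).target) (u v w : E) :
    fderiv ℝ (metricIn g p) y u v w = metricIn g p y (christoffel D p y u v) w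
      + metricIn g p y v (christoffel D p y u w) + formIn p α y u * metricIn g p y v w := by
  have h1 := h ((chartAt E p).symm y) (frame p _ u) (constField p v) (constField p w)
    (diffFieldAt_constField v hy) (diffFieldAt_constField w hy)
  have hs : ContMDiffAt 𝓘(ℝ, E) 𝓘(ℝ, ℝ) ∞
      (fun x ↦ g.inner x (constField p v x) (constField p w x)) ((chartAt E p).symm y) :=
    contMDiffAt_inner g (contMDiffAt_constField v (symm_mem_source hy))
      (contMDiffAt_constField w (symm_mem_source hy))
  rw [mvfderiv_frame hy (hs.mdifferentiableAt (by simp)), connection_constField D hy,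
    connection_constField D hy] at h1
  have hcomp : (fun x ↦ g.inner x (constField p v x) (constField p w x)) ∘ (chartAt E p).symm
      = fun z ↦ metricIn g p z v w := rfl
  have hd : DifferentiableAt ℝ (metricIn g p) y :=
    (contDiffAt_metricIn g hy).differentiableAt (by simp)
  rw [hcomp, fderiv_apply_const (hd.clm_apply (differentiableAt_const v)),
    fderiv_apply_const hd] at h1
  simp only [constField] at h1
  simp only [metricIn_apply, formIn_apply]
  linarith

theorem exists_smoothField_eventuallyEq [T2Space M] {p : M} {y : E}
    (hy : y ∈ (chartAt E p).target) (v : E) :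
    ∃ X : Π x : M, TangentSpace 𝓘(ℝ, E) x, SmoothField X ∧
      ∀ᶠ q in nhds ((chartAt E p).symm y), X q = constField p v q := by
  obtain ⟨χ, -, hχ⟩ := (SmoothBumpFunction.nhds_basis_tsupport (I := 𝓘(ℝ, E))
    ((chartAt E p).symm y)).mem_iff.1 ((chartAt E p).open_source.mem_nhds (symm_mem_source hy))
  refine ⟨(χ : M → ℝ) • constField p v, fun q ↦ ?_, ?_⟩
  · by_cases hq : q ∈ (chartAt E p).source
    · exact χ.contMDiff.contMDiffAt.smul_section (contMDiffAt_constField v hq)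
    · have hq' : q ∉ tsupport χ := fun h ↦ hq (hχ h)
      have h0 : ContMDiffAt 𝓘(ℝ, E) 𝓘(ℝ, E).tangent ∞
          (fun x ↦ (⟨x, 0⟩ : TangentBundle 𝓘(ℝ, E) M)) q :=
        (contMDiff_zeroSection ℝ (TangentSpace 𝓘(ℝ, E) : M → Type _)).contMDiffAt
      refine h0.congr_of_eventuallyEq ?_
      filter_upwards [(isClosed_tsupport χ).isOpen_compl.mem_nhds hq'] with x hx
      have : χ x = 0 := image_eq_zero_of_notMem_tsupport hx
      simp [this]
  · filter_upwards [χ.eventuallyEq_one] with q hq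
    simp [hq]

theorem contDiffOn_christoffel [T2Space M] {D : Connection E M}
    (hD : CovariantDerivative.ContMDiffCovariantDerivative D ∞) (p : M) :
    ContDiffOn ℝ ∞ (christoffel D p) (chartAt E p).target := by
  have hcolumn : ∀ u v, ∀ y ∈ (chartAt E p).target,
      ContDiffAt ℝ ∞ (fun z ↦ coframe p ((chartAt E p).symm z)
      (D (constField p v) ((chartAt E p).symm z) (frame p _ u))) y := by
    intro u v y hy
    obtain ⟨X, hX, hXv⟩ := exists_smoothField_eventuallyEq hy v
    have h1 := hD.contMDiff.contMDiff (σ := X) (by simpa using! hX.contMDiffOn)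
    have h2 := (h1.contMDiffAt (x := (chartAt E p).symm y) Filter.univ_mem).clm_bundle_apply
      (contMDiffAt_constField u (symm_mem_source hy))
    have h3 := (contMDiffAt_field_iff hy).1 h2
    refine h3.congr_of_eventuallyEq ?_
    have hc : Filter.Tendsto (chartAt E p).symm (nhds y) (nhds ((chartAt E p).symm y)) :=
      (chartAt E p).continuousAt_symm hy
    filter_upwards [(chartAt E p).open_target.mem_nhds hy, hc.eventually hXv.eventually_nhds]
      with z hz hz2
    have : D X ((chartAt E p).symm z) = D (constField p v) ((chartAt E p).symm z) :=
      D.isCovariantDerivativeOnUniv.congr_of_eventuallyEq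
        (hX.contMDiffAt.mdifferentiableAt (by simp)) (diffFieldAt_constField v hz)
        Filter.univ_mem hz2
    rw [← this]; rfl
  rw [contDiffOn_clm_apply]; intro u
  rw [contDiffOn_clm_apply]; intro v y hy
  simp only [christoffel_apply]
  exact ContDiffWithinAt.sum fun i _ ↦
    (contDiffAt_const.smul (hcolumn u _ y hy)).contDiffWithinAt

theorem isTorsionFreeOn_christoffel [T2Space M] {D : Connection E M}
    (hD : CovariantDerivative.ContMDiffCovariantDerivative D ∞) (hT : IsTorsionFree D) (p : M) :
    IsTorsionFreeOn (chartAt E p).target (christoffel D p) where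
  isOpen := (chartAt E p).open_target
  contDiffOn := contDiffOn_christoffel hD p
  symm _ hy := christoffel_symm hT hy

theorem curvature_frame [T2Space M] {D : Connection E M}
    (hD : CovariantDerivative.ContMDiffCovariantDerivative D ∞) (hT : IsTorsionFree D)
    {p : M} {y : E} (hy : y ∈ (chartAt E p).target) {X Y Z : Π x : M, TangentSpace 𝓘(ℝ, E) x}
    (hX : DifferentiableAt ℝ (fieldIn p X) y) (hY : DifferentiableAt ℝ (fieldIn p Y) y)
    (hZ : ContDiffAt ℝ ∞ (fieldIn p Z) y) :
    curvature D X Y Z ((chartAt E p).symm y) =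
      frame p _ (riem (christoffel D p) y (fieldIn p X y) (fieldIn p Y y) (fieldIn p Z y)) := by
  have : CompleteSpace E := FiniteDimensional.complete ℝ E
  have hΓ := isTorsionFreeOn_christoffel hD hT p
  have hZ_diff : ∀ᶠ z in nhds y, DifferentiableAt ℝ (fieldIn p Z) z := by
    filter_upwards [(hZ.of_le (m := 1) (WithTop.coe_le_coe.2 le_top)).eventually (by simp)]
      with z hz using hz.differentiableAt (by simp)
  have hfieldIn (W : Π x : M, TangentSpace 𝓘(ℝ, E) x) :
      fieldIn p (fun q ↦ D Z q (W q)) =ᶠ[nhds y]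
        fun z ↦ covField (christoffel D p) (fieldIn p Z) z (fieldIn p W z) := by
    filter_upwards [(chartAt E p).open_target.mem_nhds hy, hZ_diff] with z hz hz_diff
    exact fieldIn_connection D hz ((diffFieldAt_iff hz).2 hz_diff)
  have hdiff {W : Π x : M, TangentSpace 𝓘(ℝ, E) x} (hW : DifferentiableAt ℝ (fieldIn p W) y) :
      DiffFieldAt (fun q ↦ D Z q (W q)) ((chartAt E p).symm y) :=
    (diffFieldAt_iff hy).2 <| ((differentiableAt_covField (hΓ.differentiableAt hy) hZ).clm_apply
      hW).congr_of_eventuallyEq (hfieldIn W)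
  rw [curvature, mlieBracket_frame hy ((diffFieldAt_iff hy).2 hX) ((diffFieldAt_iff hy).2 hY),
    connection_frame D hy ((diffFieldAt_iff hy).2 hZ_diff.self_of_nhds), ← frame_fieldIn X hy,
    ← frame_fieldIn Y hy, connection_frame D hy (hdiff hY), connection_frame D hy (hdiff hX),
    ← map_sub, ← map_sub, covField_congr (hfieldIn Y), covField_congr (hfieldIn X),
    hΓ.riem_fields hy hX hY hZ]

theorem ricci_frame [T2Space M] {D : Connection E M}
    (hD : CovariantDerivative.ContMDiffCovariantDerivative D ∞) (hT : IsTorsionFree D)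
    {p : M} {y : E} (hy : y ∈ (chartAt E p).target) (u v : E) :
    ricci D ((chartAt E p).symm y) (frame p _ u) (frame p _ v) = ric (christoffel D p) y u v := by
  set q := (chartAt E p).symm y with hq
  have hext (w : TangentSpace 𝓘(ℝ, E) q) :
      ContDiffAt ℝ ∞ (fieldIn p (FiberBundle.extend E w)) y :=
    (contMDiffAt_field_iff hy).1 (FiberBundle.contMDiffAt_extend 𝓘(ℝ, E) E w)
  have hval (w : TangentSpace 𝓘(ℝ, E) q) :
      fieldIn p (FiberBundle.extend E w) y = coframe p q w := by
    change coframe p q (FiberBundle.extend E w q) = _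
    rw [FiberBundle.extend_apply_self]
  let A : E →ₗ[ℝ] E := (((riem (christoffel D p) y).flip u).flip v : E →L[ℝ] E).toLinearMap
  let e : E ≃ₗ[ℝ] E := LinearEquiv.ofLinearMap (frame p q : E →L[ℝ] E).toLinearMap
    (coframe p q : E →L[ℝ] E).toLinearMap
    (LinearMap.ext fun w ↦ frame_coframe (symm_mem_source hy) w)
    (LinearMap.ext fun w ↦ coframe_frame (symm_mem_source hy) w)
  rw [ric, ← LinearMap.trace_conj' A e, trace_eq_sum_repr (Module.finBasis ℝ E), ricci]
  refine Finset.sum_congr rfl fun i _ ↦ ?_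
  rw [hq, curvature_frame hD hT hy ((hext _).differentiableAt (by simp))
    ((hext _).differentiableAt (by simp)) (hext _), hval, hval, hval,
    coframe_frame (symm_mem_source hy), coframe_frame (symm_mem_source hy)]
  rfl

end Christoffel

section Chart

variable {H M : Type*} [TopologicalSpace H] [TopologicalSpace M] [ChartedSpace H M]

theorem isCompact_image_chart [CompactSpace M] {p : M} {K : Set M} (hK : IsClosed K)
    (hKp : K ⊆ (chartAt H p).source) : IsCompact (chartAt H p '' K) :=
  hK.isCompact.image_of_continuousOn ((chartAt H p).continuousOn.mono hKp)

theorem continuous_of_chart {X : Type*} [TopologicalSpace X] {u : M → X}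
    (h : ∀ p : M, ContinuousOn (u ∘ (chartAt H p).symm) (chartAt H p).target) : Continuous u :=
  continuous_iff_continuousAt.2 fun x ↦
    ((chartAt H x).symm.continuousAt_iff_continuousAt_comp_right (mem_chart_source H x)).2
      ((h x).continuousAt ((chartAt H x).open_target.mem_nhds (mem_chart_target H x)))

end Chart

section ChartIntegral

open MeasureTheory

variable {E : Type*} [NormedAddCommGroup E] [NormedSpace ℝ E]
  {M : Type*} [TopologicalSpace M] [ChartedSpace E M] [IsManifold 𝓘(ℝ, E) ∞ M]

theorem metricIn_of_eq (g : Metric E M) {p q : M} {y : E} (hq : (chartAt E p).symm y = q)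
    (u v : E) : metricIn g p y u v = g.inner q (frame p q u) (frame p q v) := by
  subst hq; rfl

theorem frame_coordChange {p p' q : M} (hq : q ∈ (chartAt E p).source)
    (hq' : q ∈ (chartAt E p').source) (v : E) :
    frame p' q (tangentCoordChange 𝓘(ℝ, E) p p' q v) = frame p q v :=
  tangentCoordChange_comp (I := 𝓘(ℝ, E)) (by simp [hq, hq'])

theorem metricIn_coordChange (g : Metric E M) {p p' : M} {y : E} (hy : y ∈ (chartAt E p).target)
    (hy' : (chartAt E p).symm y ∈ (chartAt E p').source) :
    metricIn g p y = (metricIn g p' (chartAt E p' ((chartAt E p).symm y))).bilinearComp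
      (tangentCoordChange 𝓘(ℝ, E) p p' ((chartAt E p).symm y))
      (tangentCoordChange 𝓘(ℝ, E) p p' ((chartAt E p).symm y)) := by
  ext u v
  rw [ContinuousLinearMap.bilinearComp_apply, metricIn_of_eq g ((chartAt E p').left_inv hy'),
    metricIn_of_eq g rfl, frame_coordChange (symm_mem_source hy) hy',
    frame_coordChange (symm_mem_source hy) hy']

theorem hasFDerivAt_coordChange {p p' : M} {y : E} (hy : y ∈ (chartAt E p).target)
    (hy' : (chartAt E p).symm y ∈ (chartAt E p').source) :
    HasFDerivAt ((chartAt E p).symm.trans (chartAt E p'))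
      (tangentCoordChange 𝓘(ℝ, E) p p' ((chartAt E p).symm y)) y := by
  have h := hasFDerivWithinAt_tangentCoordChange (I := 𝓘(ℝ, E)) (x := p) (y := p')
    (z := (chartAt E p).symm y) (by simp [hy', symm_mem_source hy])
  simp only [mfld_simps, modelWithCornersSelf_coe, Set.range_id, hasFDerivWithinAt_univ] at h
  rwa [(chartAt E p).right_inv hy] at h

variable [FiniteDimensional ℝ E]

theorem continuousOn_density_metricIn (g : Metric E M) (p : M) :
    ContinuousOn (fun y ↦ density (metricIn g p y)) (chartAt E p).target :=
  (contDiffOn_density (contDiffOn_metricIn g p) fun _ ↦ isInnerProduct_metricIn g).continuousOn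

variable [MeasurableSpace E] [BorelSpace E] (μ : Measure E)

/-- The integral of `u` with respect to the Riemannian density in the chart at `p`. It is the
integral of `u` over the manifold, up to a factor independent of the chart, when `u` vanishes
outside the domain of the chart. -/
def chartIntegral (g : Metric E M) (p : M) (u : M → ℝ) : ℝ :=
  ∫ y in (chartAt E p).target, u ((chartAt E p).symm y) * density (metricIn g p y) ∂μ

theorem chartIntegral_eq_setIntegral (g : Metric E M) {p : M} {u : M → ℝ} {T : Set E}
    (hT : T ⊆ (chartAt E p).target)
    (hu : ∀ y ∈ (chartAt E p).target, y ∉ T → u ((chartAt E p).symm y) = 0) :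
    chartIntegral μ g p u
      = ∫ y in T, u ((chartAt E p).symm y) * density (metricIn g p y) ∂μ :=
  setIntegral_eq_of_subset_of_forall_sdiff_eq_zero (chartAt E p).open_target.measurableSet hT
    fun y hy ↦ by rw [hu y hy.1 hy.2, zero_mul]

theorem chartIntegral_eq_chartIntegral [μ.IsAddHaarMeasure] (g : Metric E M) {p p' : M}
    {u : M → ℝ} (hp : Function.support u ⊆ (chartAt E p).source)
    (hp' : Function.support u ⊆ (chartAt E p').source) :
    chartIntegral μ g p u = chartIntegral μ g p' u := by
  set e := (chartAt E p).symm.trans (chartAt E p') with he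
  have mem_source {y : E} : y ∈ e.source ↔ y ∈ (chartAt E p).target ∧
      (chartAt E p).symm y ∈ (chartAt E p').source := by simp [he]
  have mem_target {y : E} : y ∈ e.target ↔ y ∈ (chartAt E p').target ∧
      (chartAt E p').symm y ∈ (chartAt E p).source := by simp [he]
  rw [chartIntegral_eq_setIntegral μ g (fun y hy ↦ (mem_source.1 hy).1) fun y hy hye ↦
      by_contra fun hne ↦ hye (mem_source.2 ⟨hy, hp' hne⟩),
    chartIntegral_eq_setIntegral μ g (fun y hy ↦ (mem_target.1 hy).1) fun y hy hye ↦
      by_contra fun hne ↦ hye (mem_target.2 ⟨hy, hp hne⟩),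
    integral_target_eq_integral_abs_det_fderiv_smul μ
      (f' := fun y ↦ tangentCoordChange 𝓘(ℝ, E) p p' ((chartAt E p).symm y))
      fun y hy ↦ hasFDerivAt_coordChange (mem_source.1 hy).1 (mem_source.1 hy).2]
  refine setIntegral_congr_fun e.open_source.measurableSet fun y hy ↦ ?_
  obtain ⟨hy, hy'⟩ := mem_source.1 hy
  have he_apply : e y = chartAt E p' ((chartAt E p).symm y) := rfl
  rw [metricIn_coordChange g hy hy', density_comp, he_apply, (chartAt E p').left_inv hy',
    smul_eq_mul]
  ring

theorem integrableOn_chart [CompactSpace M] [IsFiniteMeasureOnCompacts μ] (g : Metric E M) {p : M}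
    {u : M → ℝ} (hu : Continuous u) (hup : tsupport u ⊆ (chartAt E p).source) :
    IntegrableOn (fun y ↦ u ((chartAt E p).symm y) * density (metricIn g p y))
      (chartAt E p).target μ := by
  have hcont : ContinuousOn (fun y ↦ u ((chartAt E p).symm y) * density (metricIn g p y))
      (chartAt E p).target :=
    (hu.comp_continuousOn (chartAt E p).continuousOn_symm).mul (continuousOn_density_metricIn g p)
  refine ((hcont.mono ((Set.image_mono hup).trans
    (chartAt E p).image_source_eq_target.subset)).integrableOn_compact
      (isCompact_image_chart (isClosed_tsupport u) hup)).of_forall_sdiff_eq_zero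
    (chartAt E p).open_target.measurableSet fun y hy ↦ ?_
  have hy_notMem : (chartAt E p).symm y ∉ tsupport u := fun h ↦
    hy.2 ⟨_, h, (chartAt E p).right_inv hy.1⟩
  rw [image_eq_zero_of_notMem_tsupport hy_notMem, zero_mul]

theorem chartIntegral_finsetSum [CompactSpace M] [IsFiniteMeasureOnCompacts μ] (g : Metric E M)
    {p : M} {ι : Type*} (s : Finset ι) {u : ι → M → ℝ} (hu : ∀ i ∈ s, Continuous (u i))
    (hup : ∀ i ∈ s, tsupport (u i) ⊆ (chartAt E p).source) :
    chartIntegral μ g p (fun x ↦ ∑ i ∈ s, u i x) = ∑ i ∈ s, chartIntegral μ g p (u i) := by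
  simp only [chartIntegral, Finset.sum_mul]
  exact integral_finsetSum s fun i hi ↦ integrableOn_chart μ g (hu i hi) (hup i hi)

theorem eq_zero_of_chartIntegral_eq_zero [CompactSpace M] [μ.IsAddHaarMeasure] (g : Metric E M)
    {p : M} {u : M → ℝ} (hu : Continuous u) (hup : tsupport u ⊆ (chartAt E p).source)
    (hnonneg : ∀ x, 0 ≤ u x) (h : chartIntegral μ g p u = 0) (x : M) : u x = 0 := by
  by_cases hx : x ∈ (chartAt E p).source
  · have hdensity {y : E} (hy : y ∈ (chartAt E p).target) : 0 < density (metricIn g p y) :=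
      (isInnerProduct_metricIn g hy).density_pos
    have hae := (setIntegral_eq_zero_iff_of_nonneg_ae
      (ae_restrict_of_forall_mem (chartAt E p).open_target.measurableSet fun y hy ↦
        mul_nonneg (hnonneg _) (hdensity hy).le) (integrableOn_chart μ g hu hup)).1 h
    have heq := Measure.eqOn_open_of_ae_eq hae (chartAt E p).open_target
      ((hu.comp_continuousOn (chartAt E p).continuousOn_symm).mul
        (continuousOn_density_metricIn g p)) continuousOn_const ((chartAt E p).map_source hx)
    simpa [(chartAt E p).left_inv hx, (hdensity ((chartAt E p).map_source hx)).ne'] using heq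
  · exact image_eq_zero_of_notMem_tsupport fun h ↦ hx (hup h)

end ChartIntegral

section Divergence

open MeasureTheory

variable {E : Type*} [NormedAddCommGroup E] [NormedSpace ℝ E]
  {M : Type*} [TopologicalSpace M] [ChartedSpace E M] [IsManifold 𝓘(ℝ, E) ∞ M]

theorem mvfderiv_field_chart_symm {p : M} {y : E} (hy : y ∈ (chartAt E p).target) {f : M → ℝ}
    (hf : MDifferentiableAt 𝓘(ℝ, E) 𝓘(ℝ, ℝ) f ((chartAt E p).symm y))
    (W : Π x : M, TangentSpace 𝓘(ℝ, E) x) :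
    mvfderiv 𝓘(ℝ, E) f ((chartAt E p).symm y) (W ((chartAt E p).symm y))
      = fderiv ℝ (f ∘ (chartAt E p).symm) y (fieldIn p W y) := by
  rw [← frame_fieldIn W hy, mvfderiv_frame hy hf]

theorem contDiffOn_comp_chart_symm {φ : M → ℝ} (hφ : ContMDiff 𝓘(ℝ, E) 𝓘(ℝ, ℝ) ∞ φ) (p : M) :
    ContDiffOn ℝ ∞ (φ ∘ (chartAt E p).symm) (chartAt E p).target := fun _ hy ↦
  ((contMDiffAt_comp_chart_symm_iff hy).1 hφ.contMDiffAt).contDiffWithinAt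

theorem sum_mvfderiv_eq_zero {ι : Type*} {s : Finset ι} {ρ : ι → M → ℝ}
    (hρ : ∀ i ∈ s, MDifferentiable 𝓘(ℝ, E) 𝓘(ℝ, ℝ) (ρ i)) (hsum : ∀ x, ∑ i ∈ s, ρ i x = 1)
    (W : Π x : M, TangentSpace 𝓘(ℝ, E) x) (x : M) :
    ∑ i ∈ s, mvfderiv 𝓘(ℝ, E) (ρ i) x (W x) = 0 := by
  have hx := mem_chart_target E x
  rw [← (chartAt E x).left_inv (mem_chart_source E x)]
  have hchart (i : ι) (hi : i ∈ s) :=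
    mvfderiv_field_chart_symm hx (hρ i hi ((chartAt E x).symm (chartAt E x x))) W
  rw [Finset.sum_congr rfl hchart, ← sum_apply, ← fderiv_fun_sum fun i hi ↦
    (mdifferentiableAt_comp_chart_symm_iff hx).1 (hρ i hi _)]
  simp only [Function.comp_apply, hsum, fderiv_fun_const, Pi.zero_apply, zero_apply]

variable {W : Π x : M, TangentSpace 𝓘(ℝ, E) x}

theorem continuous_mvfderiv_field {φ : M → ℝ} (hφ : ContMDiff 𝓘(ℝ, E) 𝓘(ℝ, ℝ) ∞ φ)
    (hW : ∀ p : M, ContinuousOn (fieldIn p W) (chartAt E p).target) :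
    Continuous fun x ↦ mvfderiv 𝓘(ℝ, E) φ x (W x) :=
  continuous_of_chart fun p ↦ ContinuousOn.congr
    (((contDiffOn_comp_chart_symm hφ p).continuousOn_fderiv_of_isOpen (chartAt E p).open_target
      (by simp)).clm_apply (hW p))
    fun _ hy ↦ mvfderiv_field_chart_symm hy (hφ.mdifferentiableAt (by simp)) W

omit [IsManifold 𝓘(ℝ, E) ∞ M] in
theorem tsupport_mvfderiv_field_subset (φ : M → ℝ) :
    tsupport (fun x ↦ mvfderiv 𝓘(ℝ, E) φ x (W x)) ⊆ tsupport φ := by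
  refine closure_minimal (fun x hx ↦ by_contra fun hxφ ↦ hx ?_) (isClosed_tsupport φ)
  have hzero : φ =ᶠ[nhds x] fun _ ↦ (0 : ℝ) :=
    Filter.eventually_of_mem ((isClosed_tsupport φ).isOpen_compl.mem_nhds hxφ) fun _ ↦
      image_eq_zero_of_notMem_tsupport
  change mvfderiv 𝓘(ℝ, E) φ x (W x) = 0
  rw [mvfderiv, hzero.mfderiv_eq, mfderiv_const]
  rfl

variable [FiniteDimensional ℝ E]

/-- The divergence `tr (D W)` of the field `W` with respect to the connection `D`. -/
def divergence (D : Connection E M) (W : Π x : M, TangentSpace 𝓘(ℝ, E) x) (x : M) : ℝ :=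
  LinearMap.trace ℝ (TangentSpace 𝓘(ℝ, E) x) (D W x).toLinearMap

theorem divergence_chart_symm {D : Connection E M} {p : M} {y : E} (hy : y ∈ (chartAt E p).target)
    (hW : DifferentiableAt ℝ (fieldIn p W) y) :
    divergence D W ((chartAt E p).symm y)
      = LinearMap.trace ℝ E (covField (christoffel D p) (fieldIn p W) y).toLinearMap := by
  set q := (chartAt E p).symm y
  let e : E ≃ₗ[ℝ] TangentSpace 𝓘(ℝ, E) q := LinearEquiv.ofLinearMap (frame p q).toLinearMap
    (coframe p q).toLinearMap
    (LinearMap.ext fun w ↦ frame_coframe (symm_mem_source hy) w)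
    (LinearMap.ext fun w ↦ coframe_frame (symm_mem_source hy) w)
  rw [← LinearMap.trace_conj' (covField (christoffel D p) (fieldIn p W) y).toLinearMap e]
  unfold divergence
  congr 1
  ext w
  have h := connection_frame D hy ((diffFieldAt_iff hy).2 hW) (coframe p q w)
  rw [frame_coframe (symm_mem_source hy)] at h
  exact h

theorem continuous_divergence {D : Connection E M}
    (hΓ : ∀ p : M, ContinuousOn (christoffel D p) (chartAt E p).target)
    (hW : ∀ p : M, ContDiffOn ℝ 1 (fieldIn p W) (chartAt E p).target) :
    Continuous (divergence D W) := by
  refine continuous_of_chart fun p ↦ ContinuousOn.congr ?_ fun y hy ↦ divergence_chart_symm hy <|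
    ((hW p).contDiffAt ((chartAt E p).open_target.mem_nhds hy)).differentiableAt (by simp)
  have hflip : ContinuousOn (fun y ↦ (christoffel D p y).flip) (chartAt E p).target :=
    (ContinuousLinearMap.flipₗᵢ ℝ E E E).continuous.comp_continuousOn (hΓ p)
  have hcov : ContinuousOn (covField (christoffel D p) (fieldIn p W)) (chartAt E p).target :=
    ((hW p).continuousOn_fderiv_of_isOpen (chartAt E p).open_target le_rfl).add
      (hflip.clm_apply (hW p).continuousOn)
  let traceL : (E →L[ℝ] E) →L[ℝ] ℝ := LinearMap.toContinuousLinearMap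
    (LinearMap.trace ℝ E ∘ₗ (ContinuousLinearMap.coeLM ℝ : (E →L[ℝ] E) →ₗ[ℝ] (E →ₗ[ℝ] E)))
  exact traceL.continuous.comp_continuousOn hcov

variable [CompactSpace M] {g : Metric E M} {D : Connection E M}

theorem chartIntegral_mul_divergence [MeasurableSpace E] [BorelSpace E] (μ : Measure E)
    [μ.IsAddHaarMeasure]
    (hLC : ∀ p : M, IsLeviCivitaOn (chartAt E p).target (metricIn g p) (christoffel D p))
    (hW : ∀ p : M, ContDiffOn ℝ 1 (fieldIn p W) (chartAt E p).target) {p : M} {φ : M → ℝ}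
    (hφ : ContMDiff 𝓘(ℝ, E) 𝓘(ℝ, ℝ) ∞ φ) (hφp : tsupport φ ⊆ (chartAt E p).source) :
    chartIntegral μ g p (fun x ↦ φ x * divergence D W x)
      = -chartIntegral μ g p (fun x ↦ mvfderiv 𝓘(ℝ, E) φ x (W x)) := by
  have hφ_chart := contDiffOn_comp_chart_symm hφ p
  have hφ_div : Continuous fun x ↦ φ x * divergence D W x :=
    hφ.continuous.mul (continuous_divergence (fun p ↦ (hLC p).contDiffOn.continuousOn) hW)
  rw [← add_eq_zero_iff_eq_neg, chartIntegral, chartIntegral,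
    ← integral_add
      (integrableOn_chart μ g hφ_div (tsupport_mul_subset_left.trans hφp))
      (integrableOn_chart μ g (continuous_mvfderiv_field hφ fun p ↦ (hW p).continuousOn)
        ((tsupport_mvfderiv_field_subset φ).trans hφp)),
    ← setIntegral_trace_fderiv_eq_zero μ (chartAt E p).open_target
      (isCompact_image_chart (isClosed_tsupport φ) hφp)
      ((Set.image_mono hφp).trans (chartAt E p).image_source_eq_target.subset)
      (F := fun y ↦ (density (metricIn g p y) * φ ((chartAt E p).symm y)) • fieldIn p W y)
      ((((contDiffOn_density (hLC p).contDiffOn_metric (hLC p).isInnerProduct).mul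
        hφ_chart).of_le (WithTop.coe_le_coe.2 le_top)).smul (hW p))
      fun y hy hyφ ↦ by
        rw [image_eq_zero_of_notMem_tsupport fun h ↦ hyφ ⟨_, h, (chartAt E p).right_inv hy⟩,
          mul_zero, zero_smul]]
  refine setIntegral_congr_fun (chartAt E p).open_target.measurableSet fun y hy ↦ ?_
  have hy_nhds := (chartAt E p).open_target.mem_nhds hy
  have hW_diff := ((hW p).contDiffAt hy_nhds).differentiableAt (by simp)
  rw [divergence_chart_symm hy hW_diff,
    mvfderiv_field_chart_symm hy (hφ.mdifferentiableAt (by simp)) W, ← add_mul]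
  exact ((hLC p).trace_fderiv_density_smul hy
    ((hφ_chart.contDiffAt hy_nhds).differentiableAt (by simp)) hW_diff).symm

theorem sum_chartIntegral_divergence [MeasurableSpace E] [BorelSpace E] (μ : Measure E)
    [μ.IsAddHaarMeasure]
    (hLC : ∀ p : M, IsLeviCivitaOn (chartAt E p).target (metricIn g p) (christoffel D p))
    (hW : ∀ p : M, ContDiffOn ℝ 1 (fieldIn p W) (chartAt E p).target)
    {ρ : M → M → ℝ} {s : Finset M} (hρ : ∀ i, ContMDiff 𝓘(ℝ, E) 𝓘(ℝ, ℝ) ∞ (ρ i))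
    (hρs : ∀ i, tsupport (ρ i) ⊆ (chartAt E i).source) (hsum : ∀ x, ∑ i ∈ s, ρ i x = 1) :
    ∑ i ∈ s, chartIntegral μ g i (fun x ↦ ρ i x * divergence D W x) = 0 := by
  let d (i : M) (x : M) : ℝ := mvfderiv 𝓘(ℝ, E) (ρ i) x (W x)
  have hd (i : M) : Continuous (d i) :=
    continuous_mvfderiv_field (hρ i) fun p ↦ (hW p).continuousOn
  have hds (i : M) : tsupport (d i) ⊆ (chartAt E i).source :=
    (tsupport_mvfderiv_field_subset (ρ i)).trans (hρs i)
  have hρd (i j : M) : Continuous fun x ↦ ρ j x * d i x := (hρ j).continuous.mul (hd i)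
  have hρd_left (i j : M) : tsupport (fun x ↦ ρ j x * d i x) ⊆ (chartAt E j).source :=
    tsupport_mul_subset_left.trans (hρs j)
  have hρd_right (i j : M) : tsupport (fun x ↦ ρ j x * d i x) ⊆ (chartAt E i).source :=
    tsupport_mul_subset_right.trans (hds i)
  have hsplit (i : M) : chartIntegral μ g i (d i)
      = ∑ j ∈ s, chartIntegral μ g j (fun x ↦ ρ j x * d i x) := calc
    chartIntegral μ g i (d i) = chartIntegral μ g i (fun x ↦ ∑ j ∈ s, ρ j x * d i x) := by
      simp only [← Finset.sum_mul, hsum, one_mul]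
    _ = ∑ j ∈ s, chartIntegral μ g i (fun x ↦ ρ j x * d i x) :=
      chartIntegral_finsetSum μ g s (fun j _ ↦ hρd i j) fun j _ ↦ hρd_right i j
    _ = ∑ j ∈ s, chartIntegral μ g j (fun x ↦ ρ j x * d i x) :=
      Finset.sum_congr rfl fun j _ ↦ chartIntegral_eq_chartIntegral μ g
        ((subset_tsupport _).trans (hρd_right i j)) ((subset_tsupport _).trans (hρd_left i j))
  have hd_sum (x : M) : ∑ i ∈ s, d i x = 0 :=
    sum_mvfderiv_eq_zero (fun i _ ↦ (hρ i).mdifferentiable (by simp)) hsum W x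
  calc
    ∑ i ∈ s, chartIntegral μ g i (fun x ↦ ρ i x * divergence D W x)
      = -∑ i ∈ s, chartIntegral μ g i (d i) := by
        rw [← Finset.sum_neg_distrib]
        exact Finset.sum_congr rfl fun i _ ↦
          chartIntegral_mul_divergence μ hLC hW (hρ i) (hρs i)
    _ = -∑ j ∈ s, ∑ i ∈ s, chartIntegral μ g j (fun x ↦ ρ j x * d i x) := by
        rw [Finset.sum_congr rfl fun i _ ↦ hsplit i, Finset.sum_comm]
    _ = -∑ j ∈ s, chartIntegral μ g j (fun x ↦ ∑ i ∈ s, ρ j x * d i x) := by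
        rw [Finset.sum_congr rfl fun j _ ↦ (chartIntegral_finsetSum μ g s
          (fun i _ ↦ hρd i j) fun i _ ↦ hρd_left i j).symm]
    _ = 0 := by simp [← Finset.mul_sum, hd_sum, chartIntegral]

theorem divergence_eq_zero_of_nonneg [T2Space M]
    (hLC : ∀ p : M, IsLeviCivitaOn (chartAt E p).target (metricIn g p) (christoffel D p))
    (hW : ∀ p : M, ContDiffOn ℝ 1 (fieldIn p W) (chartAt E p).target)
    (hnonneg : ∀ x, 0 ≤ divergence D W x) (x : M) : divergence D W x = 0 := by
  let _ : MeasurableSpace E := borel E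
  have : BorelSpace E := ⟨rfl⟩
  obtain ⟨ρ, hρ⟩ := SmoothPartitionOfUnity.exists_isSubordinate_chartAt_source 𝓘(ℝ, E) M
  let s : Finset M := ρ.locallyFinite.finite_nonempty_of_compact.toFinset
  have hsum (x : M) : ∑ i ∈ s, ρ i x = 1 := by
    rw [← ρ.sum_eq_one (Set.mem_univ x), finsum_eq_sum_of_support_subset]
    intro i hi
    simp only [s, Finset.mem_coe, Set.Finite.mem_toFinset, Set.mem_ofPred_eq]
    exact ⟨x, hi⟩
  have hcont (i : M) : Continuous fun x ↦ ρ i x * divergence D W x :=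
    (ρ i).contMDiff.continuous.mul
      (continuous_divergence (fun p ↦ (hLC p).contDiffOn.continuousOn) hW)
  have htsupport (i : M) : tsupport (fun x ↦ ρ i x * divergence D W x) ⊆ (chartAt E i).source :=
    tsupport_mul_subset_left.trans (hρ i)
  have hnonneg' (i x : M) : 0 ≤ ρ i x * divergence D W x := mul_nonneg (ρ.nonneg i x) (hnonneg x)
  have hzero := (Finset.sum_eq_zero_iff_of_nonneg fun i _ ↦ ?_).1 <|
    sum_chartIntegral_divergence (g := g) Measure.addHaar hLC hW (fun i ↦ (ρ i).contMDiff) hρ hsum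
  · rw [← one_mul (divergence D W x), ← hsum x, Finset.sum_mul]
    exact Finset.sum_eq_zero fun i hi ↦ eq_zero_of_chartIntegral_eq_zero Measure.addHaar g (hcont i)
      (htsupport i) (hnonneg' i) (hzero i hi) x
  · exact setIntegral_nonneg (chartAt E i).open_target.measurableSet fun y hy ↦
      mul_nonneg (hnonneg' i _) (isInnerProduct_metricIn g hy).density_pos.le

end Divergence

section Complex

variable {E : Type*} [NormedAddCommGroup E] [NormedSpace ℂ E]
  {M : Type*} [TopologicalSpace M] [ChartedSpace E M]

variable (E) in
/-- Multiplication by `i` on the model space, the complex structure in any holomorphic chart. -/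
def modelJ : E →L[ℝ] E := Complex.I • ContinuousLinearMap.id ℝ E

theorem modelJ_apply (v : E) : modelJ E v = Complex.I • v := rfl

theorem modelJ_modelJ (v : E) : modelJ E (modelJ E v) = -v := by
  simp [modelJ_apply, smul_smul]

variable [IsManifold 𝓘(ℂ, E) ω M] {p : M} {y : E}

/-- `J` is parallel for the connection `D`, that is, `∇ (J X) = J (∇ X)`. -/
def IsComplexConnection (D : Connection E M) : Prop :=
  ∀ (x : M) (v : TangentSpace 𝓘(ℝ, E) x) (X : Π x : M, TangentSpace 𝓘(ℝ, E) x),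
    DiffFieldAt X x → D (fun y ↦ J y (X y)) x v = J x (D X x v)

theorem tangentCoordChange_modelJ {p p' q : M} (hq : q ∈ (chartAt E p).source)
    (hq' : q ∈ (chartAt E p').source) (v : E) :
    tangentCoordChange 𝓘(ℝ, E) p p' q (modelJ E v)
      = modelJ E (tangentCoordChange 𝓘(ℝ, E) p p' q v) := by
  have : IsManifold 𝓘(ℂ, E) 1 M := IsManifold.of_le (n := ω) le_top
  have hℂ := hasFDerivWithinAt_tangentCoordChange (I := 𝓘(ℂ, E)) (x := p) (y := p')
    (z := q) (by simp [hq, hq'])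
  have hℝ := hasFDerivWithinAt_tangentCoordChange (I := 𝓘(ℝ, E)) (x := p) (y := p')
    (z := q) (by simp [hq, hq'])
  simp only [mfld_simps, modelWithCornersSelf_coe, Set.range_id, hasFDerivWithinAt_univ] at hℂ hℝ
  rw [hℝ.unique (hℂ.restrictScalars ℝ)]
  simp [modelJ_apply]

theorem frame_modelJ {p q : M} (hq : q ∈ (chartAt E p).source) (v : E) :
    frame p q (modelJ E v) = J q (frame p q v) :=
  tangentCoordChange_modelJ hq (mem_chart_source E q) v

theorem fieldIn_J (hy : y ∈ (chartAt E p).target) (X : Π x : M, TangentSpace 𝓘(ℝ, E) x) :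
    fieldIn p (fun q ↦ J q (X q)) y = modelJ E (fieldIn p X y) :=
  tangentCoordChange_modelJ (mem_chart_source E _) (symm_mem_source hy) _

theorem fieldIn_J_eventuallyEq (hy : y ∈ (chartAt E p).target)
    (X : Π x : M, TangentSpace 𝓘(ℝ, E) x) :
    fieldIn p (fun q ↦ J q (X q)) =ᶠ[nhds y] fun z ↦ modelJ E (fieldIn p X z) :=
  Filter.eventually_of_mem ((chartAt E p).open_target.mem_nhds hy) fun _ hz ↦ fieldIn_J hz X

theorem diffFieldAt_J (hy : y ∈ (chartAt E p).target) {X : Π x : M, TangentSpace 𝓘(ℝ, E) x}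
    (hX : DiffFieldAt X ((chartAt E p).symm y)) :
    DiffFieldAt (fun q ↦ J q (X q)) ((chartAt E p).symm y) := by
  rw [diffFieldAt_iff hy] at hX ⊢
  exact ((modelJ E).differentiableAt.comp _ hX).congr_of_eventuallyEq (fieldIn_J_eventuallyEq hy X)

theorem isOrthogonalComplex_metricIn {g : Metric E M} (hg : IsHermitian g)
    (hy : y ∈ (chartAt E p).target) : IsOrthogonalComplex (metricIn g p y) (modelJ E) where
  sq := modelJ_modelJ
  inner u v := by
    rw [metricIn_apply, metricIn_apply, frame_modelJ (symm_mem_source hy),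
      frame_modelJ (symm_mem_source hy), hg]

theorem christoffel_modelJ [FiniteDimensional ℝ E] {D : Connection E M}
    (hD : IsComplexConnection D) (hy : y ∈ (chartAt E p).target) (u v : E) :
    christoffel D p y u (modelJ E v) = modelJ E (christoffel D p y u v) := by
  have hconst : fieldIn p (fun q ↦ J q (constField p v q)) =ᶠ[nhds y] fun _ ↦ modelJ E v := by
    filter_upwards [fieldIn_J_eventuallyEq hy (constField p v), fieldIn_constField_eventually v hy]
      with z hJ hv
    rw [hJ, hv]
  have hparallel := hD _ (frame p _ u) (constField p v) (diffFieldAt_constField v hy)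
  rw [connection_constField D hy, connection_frame D hy
    (diffFieldAt_J hy (diffFieldAt_constField v hy)), covField_congr hconst, covField_const,
    ← frame_modelJ (symm_mem_source hy)] at hparallel
  exact frame_injective (symm_mem_source hy) hparallel

theorem isKaehlerOn_chart [FiniteDimensional ℝ E] {g : Metric E M} {D : Connection E M}
    (hg : IsHermitian g) (hD : IsComplexConnection D)
    (hLC : IsLeviCivitaOn (chartAt E p).target (metricIn g p) (christoffel D p)) :
    IsKaehlerOn (chartAt E p).target (metricIn g p) (christoffel D p) (modelJ E) where
  __ := hLC
  complex _ hy := isOrthogonalComplex_metricIn hg hy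
  parallel _ hy := christoffel_modelJ hD hy

end Complex

section Killing

variable {E : Type*} [NormedAddCommGroup E] [NormedSpace ℝ E]
  {M : Type*} [TopologicalSpace M] [ChartedSpace E M] [IsManifold 𝓘(ℝ, E) ∞ M]
  {X ξ : Π x : M, TangentSpace 𝓘(ℝ, E) x} {p : M} {y : E}

omit [NormedSpace ℝ E] [IsManifold 𝓘(ℝ, E) ∞ M] in
theorem forall_of_chart {P : M → Prop}
    (h : ∀ p : M, ∀ y ∈ (chartAt E p).target, P ((chartAt E p).symm y)) (x : M) : P x := by
  have := h x _ (mem_chart_target E x)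
  rwa [(chartAt E x).left_inv (mem_chart_source E x)] at this

theorem SmoothField.contDiffOn_fieldIn (hX : SmoothField X) (p : M) :
    ContDiffOn ℝ ∞ (fieldIn p X) (chartAt E p).target := fun y hy ↦
  (smoothField_iff.1 hX p y hy).contDiffWithinAt

theorem SmoothField.diffFieldAt (hX : SmoothField X) (x : M) : DiffFieldAt X x :=
  hX.contMDiffAt.mdifferentiableAt (by simp)

variable [FiniteDimensional ℝ E] {g : Metric E M} {D D₀ : Connection E M}
  {θ : Π x : M, TangentSpace 𝓘(ℝ, E) x →L[ℝ] ℝ} {Λ : M → ℝ}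

theorem IsLeviCivita.isLeviCivitaOn_chart (h : IsLeviCivita g D) (p : M) :
    IsLeviCivitaOn (chartAt E p).target (metricIn g p) (christoffel D p) :=
  isLeviCivitaOn_of_fderiv_metric (chartAt E p).open_target (contDiffOn_metricIn g p)
    (fun _ hy ↦ isInnerProduct_metricIn g hy) (fun _ hy ↦ christoffel_symm h.torsion_free hy)
    fun _ hy u v w ↦ by simp [fderiv_metricIn h.deriv_metric hy, formIn]

theorem isKilling_of_fderiv_metricIn (hξ : SmoothField ξ)
    (h : ∀ p : M, ∀ y ∈ (chartAt E p).target, ∀ u v,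
      fderiv ℝ (metricIn g p) y (fieldIn p ξ y) u v
        + metricIn g p y (fderiv ℝ (fieldIn p ξ) y u) v
        + metricIn g p y u (fderiv ℝ (fieldIn p ξ) y v) = 0) : IsKilling g ξ := by
  have : CompleteSpace E := FiniteDimensional.complete ℝ E
  refine ⟨hξ, forall_of_chart (E := E) fun p y hy X Y hX hY ↦ ?_⟩
  have hX' := (diffFieldAt_iff hy).1 hX
  have hY' := (diffFieldAt_iff hy).1 hY
  have hG := (contDiffAt_metricIn g hy).differentiableAt (by simp)
  have hlocal : (fun q ↦ g.inner q (X q) (Y q)) ∘ (chartAt E p).symm =ᶠ[nhds y]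
      fun z ↦ metricIn g p z (fieldIn p X z) (fieldIn p Y z) :=
    Filter.eventually_of_mem ((chartAt E p).open_target.mem_nhds hy) fun z hz ↦
      inner_eq_metricIn g hz X Y
  have hinner : MDifferentiableAt 𝓘(ℝ, E) 𝓘(ℝ, ℝ) (fun q ↦ g.inner q (X q) (Y q))
      ((chartAt E p).symm y) := by
    rw [mdifferentiableAt_comp_chart_symm_iff hy]
    exact ((hG.clm_apply hX').clm_apply hY').congr_of_eventuallyEq hlocal
  rw [mvfderiv_field_chart_symm hy hinner, hlocal.fderiv_eq, fderiv_apply₂ hG hX' hY',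
    mlieBracket_frame hy (hξ.diffFieldAt _) hX, mlieBracket_frame hy (hξ.diffFieldAt _) hY,
    ← frame_fieldIn X hy, ← frame_fieldIn Y hy, ← metricIn_apply, ← metricIn_apply]
  simp only [map_sub, sub_apply]
  linarith [h p y hy (fieldIn p X y) (fieldIn p Y y)]

/-- The 1-form `½ (g (∇_ξ ξ, ·) + g (ξ, ∇ ξ)) + (½ Λ + ¼ (n - 2) |ξ|²) g (ξ, ·)`. On an
Einstein-Weyl manifold, with `ξ` dual to the 1-form of the Gauduchon metric `g`, the divergence of
its dual field is `¼ |L_ξ g|²`. -/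
def potentialForm (g : Metric E M) (D : Connection E M) (Λ : M → ℝ)
    (ξ : Π x : M, TangentSpace 𝓘(ℝ, E) x) (x : M) : TangentSpace 𝓘(ℝ, E) x →L[ℝ] ℝ :=
  (1 / 2 : ℝ) • (g.inner x (D ξ x (ξ x)) + (g.inner x (ξ x)).comp (D ξ x))
    + (1 / 2 * Λ x + ((Module.finrank ℝ E : ℝ) - 2) / 4 * g.inner x (ξ x) (ξ x)) • g.inner x (ξ x)

theorem formIn_potentialForm (hy : y ∈ (chartAt E p).target)
    (hξ : DiffFieldAt ξ ((chartAt E p).symm y)) (u : E) :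
    formIn p (potentialForm g D Λ ξ) y u
      = 1 / 2 * (metricIn g p y (covField (christoffel D p) (fieldIn p ξ) y (fieldIn p ξ y)) u
        + metricIn g p y (covField (christoffel D p) (fieldIn p ξ) y u) (fieldIn p ξ y))
      + einsteinFactor (metricIn g p) (fieldIn p ξ) (Λ ∘ (chartAt E p).symm) y
        * metricIn g p y (fieldIn p ξ y) u := by
  rw [(isInnerProduct_metricIn g hy).symm _ (fieldIn p ξ y), einsteinFactor]
  simp only [metricIn_apply, ← connection_frame D hy hξ, frame_fieldIn ξ hy]
  rfl

theorem contDiffOn_formIn_potentialForm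
    (hΓ : ContDiffOn ℝ ∞ (christoffel D p) (chartAt E p).target) (hξ : SmoothField ξ)
    (hΛ : ContMDiff 𝓘(ℝ, E) 𝓘(ℝ, ℝ) ∞ Λ) :
    ContDiffOn ℝ ∞ (formIn p (potentialForm g D Λ ξ)) (chartAt E p).target := by
  have hG := contDiffOn_metricIn g p
  have hΞ := hξ.contDiffOn_fieldIn p
  have hT := contDiffOn_covField (chartAt E p).open_target hΓ hΞ
  have hΛ' := contDiffOn_comp_chart_symm hΛ p
  rw [contDiffOn_clm_apply]
  intro u
  refine ContDiffOn.congr ?_ fun y hy ↦ formIn_potentialForm hy (hξ.diffFieldAt _) u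
  have hnorm := (hG.clm_apply hΞ).clm_apply hΞ
  exact (contDiffOn_const.mul (((hG.clm_apply (hT.clm_apply hΞ)).clm_apply contDiffOn_const).add
    ((hG.clm_apply (hT.clm_apply contDiffOn_const)).clm_apply hΞ))).add
      (((contDiffOn_const.mul hΛ').add (contDiffOn_const.mul hnorm)).mul
        ((hG.clm_apply hΞ).clm_apply contDiffOn_const))

theorem contDiffOn_fieldIn_sharp_potentialForm (h : IsLeviCivita g D) (hξ : SmoothField ξ)
    (hΛ : ContMDiff 𝓘(ℝ, E) 𝓘(ℝ, ℝ) ∞ Λ) (p : M) :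
    ContDiffOn ℝ 1 (fieldIn p (sharp g (potentialForm g D Λ ξ))) (chartAt E p).target :=
  fun _ hy ↦ (contDiffAt_sharp g hy (k := 1) <| ((contDiffOn_formIn_potentialForm
    (h.isLeviCivitaOn_chart p).contDiffOn hξ hΛ).contDiffAt
      ((chartAt E p).open_target.mem_nhds hy)).of_le (WithTop.coe_le_coe.2 le_top)).contDiffWithinAt

namespace IsEinsteinWeyl

variable [T2Space M] (hEW : IsEinsteinWeyl g D θ) (hD₀ : IsLeviCivita g D₀)

include hEW hD₀

omit [T2Space M] in
theorem christoffel_eq (hy : y ∈ (chartAt E p).target) : christoffel D p y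
    = christoffel D₀ p y + weylTensor (metricIn g p y) (fieldIn p (sharp g θ) y) :=
  eq_add_weylTensor (isInnerProduct_metricIn g hy) (christoffel_symm hD₀.torsion_free hy)
    (christoffel_symm hEW.torsion_free hy) ((hD₀.isLeviCivitaOn_chart p).fderiv_metric y hy)
    fun u v w ↦ by rw [fderiv_metricIn hEW.deriv_metric hy, metricIn_sharp g θ hy]

theorem ric_sub_ric (hy : y ∈ (chartAt E p).target) (u v : E) :
    ric (christoffel D p) y u v - ric (christoffel D p) y v u
      = (Module.finrank ℝ E : ℝ) / 2
        * (metricIn g p y (covField (christoffel D₀ p) (fieldIn p (sharp g θ)) y u) v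
          - metricIn g p y (covField (christoffel D₀ p) (fieldIn p (sharp g θ)) y v) u) := by
  have hLC := hD₀.isLeviCivitaOn_chart p
  have hΞ := (diffFieldAt_iff hy).1
    ((smoothField_sharp g hEW.smooth_form).diffFieldAt ((chartAt E p).symm y))
  have hΓ := ((contDiffOn_christoffel hEW.smooth p).differentiableOn (by simp)).differentiableAt
    ((chartAt E p).open_target.mem_nhds hy)
  have hW : christoffel D p =ᶠ[nhds y] fun z ↦
      christoffel D₀ p z + weylTensor (metricIn g p z) (fieldIn p (sharp g θ) z) :=
    Filter.eventually_of_mem ((chartAt E p).open_target.mem_nhds hy) fun _ hz ↦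
      hEW.christoffel_eq hD₀ hz
  rw [hLC.ric_weyl hy hΞ hΓ hW, hLC.ric_weyl hy hΞ hΓ hW, hLC.ric_symm hy v u,
    hLC.metric_symm hy v u]
  ring

variable (hδ : ∀ x, codifferential g D₀ θ x = 0)

include hδ

theorem isEinsteinWeylOn_chart (hΛ : ContMDiff 𝓘(ℝ, E) 𝓘(ℝ, ℝ) ∞ Λ)
    (hric : ∀ (x : M) (u v : TangentSpace 𝓘(ℝ, E) x),
      ricci D x u v + ricci D x v u = Λ x * g.inner x u v) (p : M) :
    IsEinsteinWeylOn (chartAt E p).target (metricIn g p) (christoffel D₀ p) (christoffel D p)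
      (fieldIn p (sharp g θ)) (Λ ∘ (chartAt E p).symm) where
  __ := hD₀.isLeviCivitaOn_chart p
  contDiffOn_field := (smoothField_sharp g hEW.smooth_form).contDiffOn_fieldIn p
  differentiableOn_weyl := (contDiffOn_christoffel hEW.smooth p).differentiableOn (by simp)
  differentiableOn_factor := (contDiffOn_comp_chart_symm hΛ p).differentiableOn (by simp)
  weyl_eq _ hy := hEW.christoffel_eq hD₀ hy
  trace_eq_zero y hy := by
    have hξ := (smoothField_sharp g hEW.smooth_form).diffFieldAt ((chartAt E p).symm y)
    rw [← divergence_chart_symm hy ((diffFieldAt_iff hy).1 hξ)]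
    exact neg_eq_zero.1 (hδ _)
  ric_add_ric y hy v w := by
    rw [← ricci_frame hEW.smooth hEW.torsion_free hy, ← ricci_frame hEW.smooth hEW.torsion_free hy,
      hric, metricIn_apply]
    rfl

theorem inner_covField_add_inner_covField [CompactSpace M] (hn : 2 < Module.finrank ℝ E)
    (hy : y ∈ (chartAt E p).target) (u v : E) :
    metricIn g p y (covField (christoffel D₀ p) (fieldIn p (sharp g θ)) y u) v
      + metricIn g p y (covField (christoffel D₀ p) (fieldIn p (sharp g θ)) y v) u = 0 := by
  obtain ⟨Λ, hΛ, hric⟩ := hEW.ricci_eq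
  have hξ := smoothField_sharp g hEW.smooth_form
  let W := sharp g (potentialForm g D₀ Λ (sharp g θ))
  have hW : ∀ p, ContDiffOn ℝ 1 (fieldIn p W) (chartAt E p).target :=
    contDiffOn_fieldIn_sharp_potentialForm hD₀ hξ hΛ
  have hdiv (p : M) {y : E} (hy : y ∈ (chartAt E p).target)
      {e : Module.Basis (Fin (Module.finrank ℝ E)) ℝ E} (he : IsOrthonormal (metricIn g p y) e) :
      divergence D₀ W ((chartAt E p).symm y) = 1 / 4 * ∑ i, ∑ j,
        (metricIn g p y (covField (christoffel D₀ p) (fieldIn p (sharp g θ)) y (e i)) (e j)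
          + metricIn g p y (covField (christoffel D₀ p) (fieldIn p (sharp g θ)) y (e j)) (e i))
            ^ 2 := by
    have hW' := ((hW p).differentiableOn one_ne_zero).differentiableAt
      ((chartAt E p).open_target.mem_nhds hy)
    rw [divergence_chart_symm hy hW', (hEW.isEinsteinWeylOn_chart hD₀ hδ hΛ hric p
      ).trace_covField_potential hy hW' (fun z hz u ↦ ?_) he hn]
    rw [metricIn_sharp g _ hz, formIn_potentialForm hz (hξ.diffFieldAt _)]
  have hnonneg : ∀ x, 0 ≤ divergence D₀ W x := forall_of_chart (E := E) fun p y hy ↦ by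
    obtain ⟨e, he⟩ := (isInnerProduct_metricIn g hy).exists_isOrthonormal
    rw [hdiv p hy he]
    positivity
  obtain ⟨e, he⟩ := (isInnerProduct_metricIn g hy).exists_isOrthonormal
  have hzero := divergence_eq_zero_of_nonneg hD₀.isLeviCivitaOn_chart hW hnonneg
    ((chartAt E p).symm y)
  rw [hdiv p hy he] at hzero
  exact skew_of_sum_sum_add_sq_eq_zero (by linarith) u v

end IsEinsteinWeyl

end Killing

section Conformal

variable {E : Type*} [NormedAddCommGroup E] [NormedSpace ℝ E] {M : Type*} [TopologicalSpace M]
  [ChartedSpace E M] [IsManifold 𝓘(ℝ, E) ∞ M] {g g₁ : Metric E M} {D₀ D₁ : Connection E M}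
  {f : M → ℝ} {ξ : Π x : M, TangentSpace 𝓘(ℝ, E) x} {p : M} {y : E}

/-- The function `ξ f / f`. If `ξ` is a Killing field of `g` and `l` is this function, then
`L_ξ (f² g) = 2 l f² g`. -/
def conformalFactor (f : M → ℝ) (ξ : Π x : M, TangentSpace 𝓘(ℝ, E) x) (x : M) : ℝ :=
  mvfderiv 𝓘(ℝ, E) f x (ξ x) / f x

theorem conformalFactor_chart_symm (hf : ContMDiff 𝓘(ℝ, E) 𝓘(ℝ, ℝ) ∞ f)
    (hy : y ∈ (chartAt E p).target) :
    conformalFactor f ξ ((chartAt E p).symm y)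
      = fderiv ℝ (f ∘ (chartAt E p).symm) y (fieldIn p ξ y) / f ((chartAt E p).symm y) := by
  rw [conformalFactor, mvfderiv_field_chart_symm hy (hf.mdifferentiableAt (by simp))]

theorem conformalFactor_chart_symm_eq_zero (hf : ContMDiff 𝓘(ℝ, E) 𝓘(ℝ, ℝ) ∞ f)
    (hf₀ : ∀ x, f x ≠ 0) (hy : y ∈ (chartAt E p).target) :
    conformalFactor f ξ ((chartAt E p).symm y) = 0
      ↔ fderiv ℝ (f ∘ (chartAt E p).symm) y (fieldIn p ξ y) = 0 := by
  simp [conformalFactor_chart_symm hf hy, hf₀]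

theorem differentiableAt_comp_chart_symm (hf : ContMDiff 𝓘(ℝ, E) 𝓘(ℝ, ℝ) ∞ f)
    (hy : y ∈ (chartAt E p).target) : DifferentiableAt ℝ (f ∘ (chartAt E p).symm) y :=
  ((contDiffOn_comp_chart_symm hf p).differentiableOn (by simp)).differentiableAt
    ((chartAt E p).open_target.mem_nhds hy)

theorem contMDiff_conformalFactor (hf : ContMDiff 𝓘(ℝ, E) 𝓘(ℝ, ℝ) ∞ f) (hf₀ : ∀ x, f x ≠ 0)
    (hξ : SmoothField ξ) : ContMDiff 𝓘(ℝ, E) 𝓘(ℝ, ℝ) ∞ (conformalFactor f ξ) :=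
  forall_of_chart (E := E) fun p y hy ↦ (contMDiffAt_comp_chart_symm_iff hy).2 <| by
    have hfp := contDiffOn_comp_chart_symm hf p
    refine (ContDiffOn.congr ?_ fun _ hz ↦ conformalFactor_chart_symm hf hz).contDiffAt
      ((chartAt E p).open_target.mem_nhds hy)
    exact ((hfp.fderiv_of_isOpen (chartAt E p).open_target le_rfl).clm_apply
      (hξ.contDiffOn_fieldIn p)).div hfp fun _ _ ↦ hf₀ _

variable (hg₁ : ∀ (x : M) (u v : TangentSpace 𝓘(ℝ, E) x), g₁.inner x u v = f x ^ 2 * g.inner x u v)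

include hg₁

theorem ne_zero_of_conformal [Nontrivial E] (x : M) : f x ≠ 0 := by
  obtain ⟨v, hv⟩ := exists_ne (0 : E)
  exact fun hfx ↦ (g₁.pos x v hv).ne' ((hg₁ x v v).trans (by simp [hfx]))

theorem metricIn_conformal (y u v : E) :
    metricIn g₁ p y u v = f ((chartAt E p).symm y) ^ 2 * metricIn g p y u v := by
  rw [metricIn_apply, hg₁, metricIn_apply]

variable [FiniteDimensional ℝ E] (hf : ContMDiff 𝓘(ℝ, E) 𝓘(ℝ, ℝ) ∞ f)
  (hy : y ∈ (chartAt E p).target)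

include hf hy

theorem fderiv_metricIn_conformal_field {Z : E → E} (hZ : DifferentiableAt ℝ Z y) (u v : E) :
    fderiv ℝ (fun z ↦ metricIn g₁ p z (Z z) v) y u
      = 2 * f ((chartAt E p).symm y) * fderiv ℝ (f ∘ (chartAt E p).symm) y u
          * metricIn g p y (Z y) v
        + f ((chartAt E p).symm y) ^ 2 * fderiv ℝ (fun z ↦ metricIn g p z (Z z) v) y u := by
  have hfy := differentiableAt_comp_chart_symm hf hy
  have hG := (contDiffAt_metricIn g hy).differentiableAt (by simp)
  have hsq : (fun z ↦ metricIn g₁ p z (Z z) v)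
      = fun z ↦ (f ∘ (chartAt E p).symm) z ^ 2 * metricIn g p z (Z z) v :=
    funext fun z ↦ metricIn_conformal hg₁ z _ v
  rw [hsq, fderiv_fun_mul (hfy.fun_pow 2) (by fun_prop), fderiv_fun_pow 2 hfy]
  simp only [add_apply, smul_apply, smul_eq_mul, Function.comp_apply, nsmul_eq_mul]
  norm_num
  ring

variable (hD₀ : IsLeviCivita g D₀) (hD₁ : IsLeviCivita g₁ D₁)

include hD₀ hD₁

theorem inner_covField_add_inner_covField_conformal (hf₀ : ∀ x, f x ≠ 0)
    (hskew : ∀ u v, metricIn g p y (covField (christoffel D₀ p) (fieldIn p ξ) y u) v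
      + metricIn g p y (covField (christoffel D₀ p) (fieldIn p ξ) y v) u = 0) (u v : E) :
    metricIn g₁ p y (covField (christoffel D₁ p) (fieldIn p ξ) y u) v
        + metricIn g₁ p y (covField (christoffel D₁ p) (fieldIn p ξ) y v) u
      = 2 * conformalFactor f ξ ((chartAt E p).symm y) * metricIn g₁ p y u v := by
  have hLC₀ := hD₀.isLeviCivitaOn_chart p
  have hLC₁ := hD₁.isLeviCivitaOn_chart p
  have hconf := fderiv_metricIn_conformal_field hg₁ hf hy (differentiableAt_const u)
    (fieldIn p ξ y) v
  have hG := hLC₀.differentiableAt_metric hy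
  have hG₁ := hLC₁.differentiableAt_metric hy
  rw [fderiv_apply_const (by fun_prop), fderiv_apply_const hG₁, fderiv_apply_const (by fun_prop),
    fderiv_apply_const hG] at hconf
  have hkilling := hskew u v
  rw [hLC₀.inner_covField_add_inner_covField hy] at hkilling
  rw [hLC₁.inner_covField_add_inner_covField hy, hconf, conformalFactor_chart_symm hf hy]
  simp only [metricIn_conformal hg₁]
  have hfy := hf₀ ((chartAt E p).symm y)
  field_simp
  linear_combination f ((chartAt E p).symm y) * hkilling

/-- In invariant form: `d (f² ω) = 2 f df ∧ ω + f² dω`, where `ω` is `g`-dual to `ξ`. -/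
theorem inner_covField_sub_inner_covField_conformal (hξ : SmoothField ξ) (u v : E) :
    metricIn g₁ p y (covField (christoffel D₁ p) (fieldIn p ξ) y u) v
        - metricIn g₁ p y (covField (christoffel D₁ p) (fieldIn p ξ) y v) u
      = 2 * f ((chartAt E p).symm y)
          * (fderiv ℝ (f ∘ (chartAt E p).symm) y u * metricIn g p y (fieldIn p ξ y) v
            - fderiv ℝ (f ∘ (chartAt E p).symm) y v * metricIn g p y (fieldIn p ξ y) u)
        + f ((chartAt E p).symm y) ^ 2
          * (metricIn g p y (covField (christoffel D₀ p) (fieldIn p ξ) y u) v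
            - metricIn g p y (covField (christoffel D₀ p) (fieldIn p ξ) y v) u) := by
  have hΞ : DifferentiableAt ℝ (fieldIn p ξ) y := (diffFieldAt_iff hy).1 (hξ.diffFieldAt _)
  rw [(hD₁.isLeviCivitaOn_chart p).inner_covField_sub_inner_covField hy hΞ,
    (hD₀.isLeviCivitaOn_chart p).inner_covField_sub_inner_covField hy hΞ,
    fderiv_metricIn_conformal_field hg₁ hf hy hΞ, fderiv_metricIn_conformal_field hg₁ hf hy hΞ]
  ring

end Conformal

section Kaehler

variable {E : Type*} [NormedAddCommGroup E] [NormedSpace ℂ E] {M : Type*} [TopologicalSpace M]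
  [ChartedSpace E M] [IsManifold 𝓘(ℂ, E) ω M] {g : Metric E M} {D : Connection E M}
  {ξ : Π x : M, TangentSpace 𝓘(ℝ, E) x} {l : M → ℝ} {p : M} {y : E}

/-- The field `(n - 2) l ξ - (∇_ξ ξ + J ∇_{Jξ} ξ)`. If `L_ξ g = 2 l g` for a Kähler metric `g` with
Levi-Civita connection `D`, its divergence is `n (n - 2) l² + ½ |L_ξ J|²`. -/
def kaehlerPotential (D : Connection E M) (l : M → ℝ) (ξ : Π x : M, TangentSpace 𝓘(ℝ, E) x)
    (x : M) : TangentSpace 𝓘(ℝ, E) x :=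
  (((Module.finrank ℝ E : ℝ) - 2) * l x) • ξ x - (D ξ x (ξ x) + J x (D ξ x (J x (ξ x))))

variable [FiniteDimensional ℝ E]

theorem fieldIn_kaehlerPotential (hy : y ∈ (chartAt E p).target)
    (hξ : DiffFieldAt ξ ((chartAt E p).symm y)) : fieldIn p (kaehlerPotential D l ξ) y
      = (((Module.finrank ℝ E : ℝ) - 2) * (l ∘ (chartAt E p).symm) y) • fieldIn p ξ y
        - complexDefect (modelJ E) (covField (christoffel D p) (fieldIn p ξ) y)
          (fieldIn p ξ y) := by
  have hs := symm_mem_source hy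
  refine frame_injective hs ?_
  rw [frame_fieldIn _ hy, kaehlerPotential, ← frame_fieldIn ξ hy, ← frame_modelJ hs,
    connection_frame D hy hξ, connection_frame D hy hξ, ← frame_modelJ hs, complexDefect_apply,
    map_sub, map_add, map_smul]
  rfl

variable (h : ∀ p : M, IsConformalFieldOn (chartAt E p).target (metricIn g p) (christoffel D p)
  (modelJ E) (fieldIn p ξ) (l ∘ (chartAt E p).symm))

include h

theorem divergence_kaehlerPotential
    (hW : ContDiffOn ℝ 1 (fieldIn p (kaehlerPotential D l ξ)) (chartAt E p).target)
    (hy : y ∈ (chartAt E p).target) {e : Module.Basis (Fin (Module.finrank ℝ E)) ℝ E}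
    (he : IsOrthonormal (metricIn g p y) e) :
    divergence D (kaehlerPotential D l ξ) ((chartAt E p).symm y)
      = (Module.finrank ℝ E : ℝ) * ((Module.finrank ℝ E : ℝ) - 2) * l ((chartAt E p).symm y) ^ 2
        + 1 / 2 * ∑ i, metricIn g p y
          (complexDefect (modelJ E) (covField (christoffel D p) (fieldIn p ξ) y) (e i))
          (complexDefect (modelJ E) (covField (christoffel D p) (fieldIn p ξ) y) (e i)) := by
  have hW' := (hW.differentiableOn one_ne_zero).differentiableAt
    ((chartAt E p).open_target.mem_nhds hy)
  rw [divergence_chart_symm hy hW', (h p).trace_covField_potential hy he fun z hz ↦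
    fieldIn_kaehlerPotential hz
      ((diffFieldAt_iff hz).2 (((h p).contDiffAt_field hz).differentiableAt (by simp)))]
  rfl

variable (hl : ContMDiff 𝓘(ℝ, E) 𝓘(ℝ, ℝ) ∞ l)

include hl

theorem contDiffOn_kaehlerPotential (p : M) :
    ContDiffOn ℝ 1 (fieldIn p (kaehlerPotential D l ξ)) (chartAt E p).target := by
  have hΞ := (h p).contDiffOn_field
  have hT := contDiffOn_covField (chartAt E p).open_target (h p).contDiffOn hΞ
  refine ContDiffOn.congr (ContDiffOn.of_le (n := ∞) ?_ (WithTop.coe_le_coe.2 le_top))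
    fun z hz ↦ fieldIn_kaehlerPotential hz
      ((diffFieldAt_iff hz).2 (((h p).contDiffAt_field hz).differentiableAt (by simp)))
  simp only [complexDefect_apply]
  exact ((contDiffOn_const.mul (contDiffOn_comp_chart_symm hl p)).smul hΞ).sub
    ((hT.clm_apply hΞ).add ((modelJ E).contDiff.comp_contDiffOn
      (hT.clm_apply ((modelJ E).contDiff.comp_contDiffOn hΞ))))

variable [T2Space M] [CompactSpace M] (hn : 2 < Module.finrank ℝ E)

include hn

theorem factor_eq_zero_and_complexDefect_eq_zero (hy : y ∈ (chartAt E p).target) :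
    l ((chartAt E p).symm y) = 0
      ∧ complexDefect (modelJ E) (covField (christoffel D p) (fieldIn p ξ) y) = 0 := by
  have hn' : 0 < (Module.finrank ℝ E : ℝ) * ((Module.finrank ℝ E : ℝ) - 2) := by
    have : (2 : ℝ) < Module.finrank ℝ E := by exact_mod_cast hn
    nlinarith
  have hW := contDiffOn_kaehlerPotential h hl
  have hnonneg (p : M) {y : E} (hy : y ∈ (chartAt E p).target) (u : E) :
      0 ≤ metricIn g p y u u := ((h p).isInnerProduct y hy).nonneg u
  have hdiv : ∀ x, 0 ≤ divergence D (kaehlerPotential D l ξ) x :=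
    forall_of_chart (E := E) fun p y hy ↦ by
      obtain ⟨e, he⟩ := ((h p).isInnerProduct y hy).exists_isOrthonormal
      rw [divergence_kaehlerPotential h (hW p) hy he]
      exact add_nonneg (mul_nonneg hn'.le (sq_nonneg _))
        (mul_nonneg (by norm_num) (Finset.sum_nonneg fun i _ ↦ hnonneg p hy _))
  obtain ⟨e, he⟩ := ((h p).isInnerProduct y hy).exists_isOrthonormal
  have hzero := divergence_eq_zero_of_nonneg (fun p ↦ (h p).toIsLeviCivitaOn) hW hdiv
    ((chartAt E p).symm y)
  rw [divergence_kaehlerPotential h (hW p) hy he] at hzero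
  have hsum := Finset.sum_nonneg fun i (_ : i ∈ Finset.univ) ↦ hnonneg p hy
    (complexDefect (modelJ E) (covField (christoffel D p) (fieldIn p ξ) y) (e i))
  have hsq := mul_nonneg hn'.le (sq_nonneg (l ((chartAt E p).symm y)))
  have hdefect := (Finset.sum_eq_zero_iff_of_nonneg fun i _ ↦ hnonneg p hy _).1
    (by linarith : ∑ i, metricIn g p y
      (complexDefect (modelJ E) (covField (christoffel D p) (fieldIn p ξ) y) (e i))
      (complexDefect (modelJ E) (covField (christoffel D p) (fieldIn p ξ) y) (e i)) = 0)
  exact ⟨pow_eq_zero_iff two_ne_zero |>.1 <| (mul_eq_zero.1 (by linarith)).resolve_left hn'.ne',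
    ContinuousLinearMap.coe_injective <| e.ext fun i ↦
      ((h p).isInnerProduct y hy).eq_zero_of_self (hdefect i (Finset.mem_univ i))⟩

end Kaehler

section Conclusion

variable {E : Type*} [NormedAddCommGroup E] [NormedSpace ℂ E] [FiniteDimensional ℝ E] {M : Type*}
  [TopologicalSpace M] [ChartedSpace E M] [IsManifold 𝓘(ℂ, E) ω M] {g g₁ : Metric E M}
  {D D₀ D₁ : Connection E M} {θ : Π x : M, TangentSpace 𝓘(ℝ, E) x →L[ℝ] ℝ} {f : M → ℝ}
  {ξ : Π x : M, TangentSpace 𝓘(ℝ, E) x} {p : M} {y : E}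

theorem isConformalFieldOn_chart
    (hg₁ : ∀ (x : M) (u v : TangentSpace 𝓘(ℝ, E) x), g₁.inner x u v = f x ^ 2 * g.inner x u v)
    (hf : ContMDiff 𝓘(ℝ, E) 𝓘(ℝ, ℝ) ∞ f) (hf₀ : ∀ x, f x ≠ 0) (hD₀ : IsLeviCivita g D₀)
    (hD₁ : IsLeviCivita g₁ D₁) (hH : IsHermitian g₁) (hJ : IsComplexConnection D₁)
    (hξ : SmoothField ξ) (hskew : ∀ {y}, y ∈ (chartAt E p).target → ∀ u v,
      metricIn g p y (covField (christoffel D₀ p) (fieldIn p ξ) y u) v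
        + metricIn g p y (covField (christoffel D₀ p) (fieldIn p ξ) y v) u = 0) :
    IsConformalFieldOn (chartAt E p).target (metricIn g₁ p) (christoffel D₁ p) (modelJ E)
      (fieldIn p ξ) (conformalFactor f ξ ∘ (chartAt E p).symm) where
  __ := isKaehlerOn_chart hH hJ (hD₁.isLeviCivitaOn_chart p)
  contDiffOn_field := hξ.contDiffOn_fieldIn p
  differentiableOn_factor :=
    (contDiffOn_comp_chart_symm (contMDiff_conformalFactor hf hf₀ hξ) p).differentiableOn (by simp)
  conformal _ hy :=
    inner_covField_add_inner_covField_conformal hg₁ hf hy hD₀ hD₁ hf₀ (hskew hy)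

theorem isHolomorphicField_of_covField_modelJ (hD : IsTorsionFree D) (hJ : IsComplexConnection D)
    (hξ : SmoothField ξ) (h : ∀ {p : M} {y : E}, y ∈ (chartAt E p).target → ∀ u,
      covField (christoffel D p) (fieldIn p ξ) y (modelJ E u)
        = modelJ E (covField (christoffel D p) (fieldIn p ξ) y u)) : IsHolomorphicField ξ := by
  have : CompleteSpace E := FiniteDimensional.complete ℝ E
  refine ⟨hξ, forall_of_chart (E := E) fun p y hy X hX ↦ ?_⟩
  have hderiv (u : E) :
      fderiv ℝ (fieldIn p ξ) y (modelJ E u) = modelJ E (fderiv ℝ (fieldIn p ξ) y u) := by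
    have hu := h hy u
    rw [covField_apply, covField_apply, christoffel_symm hD hy, christoffel_modelJ hJ hy, map_add,
      christoffel_symm hD hy _ u] at hu
    exact add_right_cancel hu
  have hlocal := fieldIn_J_eventuallyEq hy X
  rw [mlieBracket_frame hy (hξ.diffFieldAt _) (diffFieldAt_J hy hX),
    mlieBracket_frame hy (hξ.diffFieldAt _) hX, hlocal.fderiv_eq, hlocal.eq_of_nhds,
    ← frame_modelJ (symm_mem_source hy), hderiv,
    fderiv_fun_comp y (modelJ E).differentiableAt ((diffFieldAt_iff hy).1 hX), map_sub (modelJ E)]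
  simp

theorem exists_gradient_eq_smul (hg : IsHermitian g) (hy : y ∈ (chartAt E p).target)
    (hf : MDifferentiableAt 𝓘(ℝ, E) 𝓘(ℝ, ℝ) f ((chartAt E p).symm y))
    (hfξ : fderiv ℝ (f ∘ (chartAt E p).symm) y (fieldIn p ξ y) = 0)
    (hinv : ∀ u v, fderiv ℝ (f ∘ (chartAt E p).symm) y (modelJ E u)
          * metricIn g p y (fieldIn p ξ y) (modelJ E v)
        - fderiv ℝ (f ∘ (chartAt E p).symm) y (modelJ E v)
          * metricIn g p y (fieldIn p ξ y) (modelJ E u)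
      = fderiv ℝ (f ∘ (chartAt E p).symm) y u * metricIn g p y (fieldIn p ξ y) v
        - fderiv ℝ (f ∘ (chartAt E p).symm) y v * metricIn g p y (fieldIn p ξ y) u)
    (hξ : ξ ((chartAt E p).symm y) ≠ 0) :
    ∃ c : ℝ, gradient g f ((chartAt E p).symm y)
      = c • J ((chartAt E p).symm y) (ξ ((chartAt E p).symm y)) := by
  have hG := isInnerProduct_metricIn g hy
  have hΞ : fieldIn p ξ y ≠ 0 := fun h ↦ hξ (by rw [← frame_fieldIn ξ hy, h, map_zero])
  have hcollinear := (isOrthogonalComplex_metricIn hg hy).mul_inner_self_of_invariant hG hfξ hinv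
  have hgradient : fieldIn p (gradient g f) y
      = (fderiv ℝ (f ∘ (chartAt E p).symm) y (modelJ E (fieldIn p ξ y))
        / metricIn g p y (fieldIn p ξ y) (fieldIn p ξ y)) • modelJ E (fieldIn p ξ y) :=
    hG.ext fun w ↦ by
      change metricIn g p y (fieldIn p (sharp g (mvfderiv 𝓘(ℝ, E) f)) y) w = _
      rw [metricIn_sharp g _ hy, formIn_apply, mvfderiv_frame hy hf, map_smul, smul_apply,
        smul_eq_mul, div_mul_eq_mul_div, eq_div_iff (hG.pos _ hΞ).ne', hcollinear]
  exact ⟨_, by rw [← frame_fieldIn (gradient g f) hy, hgradient, map_smul,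
    frame_modelJ (symm_mem_source hy), frame_fieldIn ξ hy]⟩

namespace IsEinsteinWeyl

variable [T2Space M] (hEW : IsEinsteinWeyl g D θ) (hD₀ : IsLeviCivita g D₀)
  (hric : ∀ (x : M) (u v : TangentSpace 𝓘(ℝ, E) x), ricci D x (J x u) (J x v) = ricci D x u v)
  (hy : y ∈ (chartAt E p).target)

include hEW hD₀ hric hy

/-- The skew-symmetric part of the Ricci tensor is a multiple of `dω`. -/
theorem inner_covField_sub_inner_covField_modelJ (u v : E) :
    metricIn g p y (covField (christoffel D₀ p) (fieldIn p (sharp g θ)) y (modelJ E u)) (modelJ E v)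
        - metricIn g p y (covField (christoffel D₀ p) (fieldIn p (sharp g θ)) y (modelJ E v))
          (modelJ E u)
      = metricIn g p y (covField (christoffel D₀ p) (fieldIn p (sharp g θ)) y u) v
        - metricIn g p y (covField (christoffel D₀ p) (fieldIn p (sharp g θ)) y v) u := by
  rcases subsingleton_or_nontrivial E with _ | _
  · simp [Subsingleton.elim u 0, Subsingleton.elim v 0]
  have hn : (Module.finrank ℝ E : ℝ) / 2 ≠ 0 := by
    have := (Module.finrank_pos (R := ℝ) (M := E)).ne'
    positivity
  have hinv (u v : E) : ric (christoffel D p) y (modelJ E u) (modelJ E v)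
      = ric (christoffel D p) y u v := by
    have hs := symm_mem_source hy
    rw [← ricci_frame hEW.smooth hEW.torsion_free hy, ← ricci_frame hEW.smooth hEW.torsion_free hy,
      frame_modelJ hs, frame_modelJ hs, hric]
  refine mul_left_cancel₀ hn ?_
  rw [← hEW.ric_sub_ric hD₀ hy, ← hEW.ric_sub_ric hD₀ hy, hinv, hinv]

theorem fderiv_mul_inner_sub_modelJ
    (hg₁ : ∀ (x : M) (u v : TangentSpace 𝓘(ℝ, E) x), g₁.inner x u v = f x ^ 2 * g.inner x u v)
    (hf : ContMDiff 𝓘(ℝ, E) 𝓘(ℝ, ℝ) ∞ f) (hf₀ : ∀ x, f x ≠ 0) (hH : IsHermitian g₁)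
    (hD₁ : IsLeviCivita g₁ D₁)
    (hcomm : ∀ u, covField (christoffel D₁ p) (fieldIn p (sharp g θ)) y (modelJ E u)
        = modelJ E (covField (christoffel D₁ p) (fieldIn p (sharp g θ)) y u)) (u v : E) :
    fderiv ℝ (f ∘ (chartAt E p).symm) y (modelJ E u)
          * metricIn g p y (fieldIn p (sharp g θ) y) (modelJ E v)
        - fderiv ℝ (f ∘ (chartAt E p).symm) y (modelJ E v)
          * metricIn g p y (fieldIn p (sharp g θ) y) (modelJ E u)
      = fderiv ℝ (f ∘ (chartAt E p).symm) y u * metricIn g p y (fieldIn p (sharp g θ) y) v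
        - fderiv ℝ (f ∘ (chartAt E p).symm) y v * metricIn g p y (fieldIn p (sharp g θ) y) u := by
  have hξ := smoothField_sharp g hEW.smooth_form
  have hcurl := inner_covField_sub_inner_covField_conformal hg₁ hf hy hD₀ hD₁ hξ
  have hH' := isOrthogonalComplex_metricIn hH hy
  have hinv := hcurl (modelJ E u) (modelJ E v)
  rw [hcomm, hcomm, hH'.inner, hH'.inner, hcurl,
    hEW.inner_covField_sub_inner_covField_modelJ hD₀ hric hy] at hinv
  exact (mul_left_cancel₀ (mul_ne_zero two_ne_zero (hf₀ _)) (add_right_cancel hinv)).symm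

end IsEinsteinWeyl

end Conclusion

end EinsteinWeyl

end

theorem proposition3p1 {E : Type*} [NormedAddCommGroup E] [NormedSpace ℂ E] [FiniteDimensional ℂ E]
    (hdim : 2 ≤ Module.finrank ℂ E)
    {M : Type*} [TopologicalSpace M] [T2Space M] [CompactSpace M] [ChartedSpace E M]
    [IsManifold 𝓘(ℂ, E) ω M]
    (g g₁ : EinsteinWeyl.Metric E M) (D : EinsteinWeyl.Connection E M)
    (θ : Π x : M, TangentSpace 𝓘(ℝ, E) x →L[ℝ] ℝ) (f : M → ℝ)
    (hg : EinsteinWeyl.IsHermitian g)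
    (hEW : EinsteinWeyl.IsEinsteinWeyl g D θ)
    (hstd : EinsteinWeyl.IsStandard g θ)
    (hf : ContMDiff 𝓘(ℝ, E) 𝓘(ℝ, ℝ) ∞ f)
    (hg₁ : ∀ (x : M) (u v : TangentSpace 𝓘(ℝ, E) x),
      g₁.inner x u v = f x ^ 2 * g.inner x u v)
    (hK : EinsteinWeyl.IsKaehler g₁)
    (hric : ∀ (x : M) (u v : TangentSpace 𝓘(ℝ, E) x),
      EinsteinWeyl.ricci D x (EinsteinWeyl.J x u) (EinsteinWeyl.J x v)
        = EinsteinWeyl.ricci D x u v) :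
    EinsteinWeyl.IsHolomorphicField (EinsteinWeyl.sharp g θ) ∧
    EinsteinWeyl.IsKilling g₁ (EinsteinWeyl.sharp g θ) ∧
    ∀ x : M, EinsteinWeyl.sharp g θ x ≠ 0 →
      ∃ c : ℝ, EinsteinWeyl.gradient g f x = c • EinsteinWeyl.J x (EinsteinWeyl.sharp g θ x) := by
  obtain ⟨D₀, hD₀, hδ⟩ := hstd
  obtain ⟨hH, D₁, hD₁, hJ⟩ := hK
  have : FiniteDimensional ℝ E := FiniteDimensional.complexToReal E
  have hn : 2 < Module.finrank ℝ E := by rw [finrank_real_of_complex]; omega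
  have : Nontrivial E := Module.nontrivial_of_finrank_pos (R := ℂ) (by omega)
  have hf₀ := EinsteinWeyl.ne_zero_of_conformal hg₁
  have hξ := EinsteinWeyl.smoothField_sharp g hEW.smooth_form
  have hconf (p : M) := EinsteinWeyl.isConformalFieldOn_chart (p := p) hg₁ hf hf₀ hD₀ hD₁ hH hJ hξ
    fun hy ↦ hEW.inner_covField_add_inner_covField hD₀ hδ hn hy
  have hzero {p : M} {y : E} (hy : y ∈ (chartAt E p).target) :=
    EinsteinWeyl.factor_eq_zero_and_complexDefect_eq_zero hconf
      (EinsteinWeyl.contMDiff_conformalFactor hf hf₀ hξ) hn hy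
  have hcomm {p : M} {y : E} (hy : y ∈ (chartAt E p).target) (u : E) :=
    ((hconf p).complex y hy).comm_of_complexDefect_eq_zero congr($((hzero hy).2) u)
  refine ⟨EinsteinWeyl.isHolomorphicField_of_covField_modelJ hD₁.torsion_free hJ hξ hcomm,
    EinsteinWeyl.isKilling_of_fderiv_metricIn hξ fun p y hy u v ↦ ?_,
    EinsteinWeyl.forall_of_chart (E := E) fun p y hy hne ↦ ?_⟩
  · rw [← (hD₁.isLeviCivitaOn_chart p).inner_covField_add_inner_covField hy,
      (hconf p).conformal y hy]
    simp [(hzero hy).1]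
  · exact EinsteinWeyl.exists_gradient_eq_smul hg hy (hf.mdifferentiableAt (by simp))
      ((EinsteinWeyl.conformalFactor_chart_symm_eq_zero hf hf₀ hy).1 (hzero hy).1)
      (hEW.fderiv_mul_inner_sub_modelJ hD₀ hric hy hg₁ hf hf₀ hH hD₁ (hcomm hy)) hne
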